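/- Let $\kappa>0$, let $(N,g)$ be a time-oriented Lorentzian manifold of dimension $3$, with signature $(2,1)$ and constant sectional curvature $-\kappa$, and let $M$ be a closed surface (a compact smooth $2$-manifold without boundary). Let $0<T\le\infty$ and let $F:M\times[0,T)\to N$ be a smooth family of spacelike immersions with future directed timelike unit normal $\nu(p,t)$, i.e. $g(\nu,\nu)=-1$ and $\nu$ is normal to $F(M,t)$. Let $h=-g(\nabla dF,\nu)$ denote the second fundamental form, let $\lambda_1\le\lambda_2$ denote the principal curvatures, i.e. the eigenvalues of the Weingarten map $h^k{}_i=g^{kl}h_{li}$, where $g_{ij}$ is the induced Riemannian metric, and let $K=\lambda_1\lambda_2$ and $|h|^2=\lambda_1^2+\lambda_2^2$. Suppose that $$\frac{\partial}{\partial t}F(p,t)=\phi(p,t)\,\nu(p,t),\qquad \phi=\frac{1}{\sqrt{\kappa}}\Bigl(\arctan\frac{\lambda_1}{\sqrt{\kappa}}+\arctan\frac{\lambda_2}{\sqrt{\kappa}}\Bigr),$$ for all $(p,t)\in M\times[0,T)$, and that $K^2<\kappa^2$ on $M$ at $t=0$. Then there is a constant $\varepsilon>0$ such that $$\kappa-K>\varepsilon\qquad\text{and}\qquad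 \kappa+K>0$$ on $M$ for all $t\in[0,T)$. As a consequence, the second fundamental form stays uniformly bounded: there is a constant $C$ such that $|h|\le C$ on $M\times[0,T)$. -/

import Mathlib

open scoped Manifold ContDiff

noncomputable section

namespace AdSFlow

/-- The partial derivative `∂f/∂zⁱ`. -/
def pd {n : ℕ} (i : Fin n) (f : EuclideanSpace ℝ (Fin n) → ℝ) (z : EuclideanSpace ℝ (Fin n)) : ℝ :=
  fderiv ℝ f z (EuclideanSpace.single i 1)

/-! ### Levi-Civita connection and curvature of a metric given in coordinates -/

/-- The Christoffel symbols
`Γ^α_{βγ} = ½ g^{αδ} (∂_β g_{δγ} + ∂_γ g_{βδ} - ∂_δ g_{βγ})` of a coordinate metric `G`. -/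
def christoffel {m : ℕ} (G : EuclideanSpace ℝ (Fin m) → Matrix (Fin m) (Fin m) ℝ)
    (z : EuclideanSpace ℝ (Fin m)) (α β γ : Fin m) : ℝ :=
  1 / 2 * ∑ δ, (G z)⁻¹ α δ *
    (pd β (fun w => G w δ γ) z + pd γ (fun w => G w β δ) z - pd δ (fun w => G w β γ) z)

/-- The component `R^α_{βγδ}` of the Riemann tensor, i.e. the `∂_α`-component of
`R(∂_γ, ∂_δ) ∂_β = ∇_γ ∇_δ ∂_β - ∇_δ ∇_γ ∂_β`. -/
def riemannUp {m : ℕ} (G : EuclideanSpace ℝ (Fin m) → Matrix (Fin m) (Fin m) ℝ)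
    (z : EuclideanSpace ℝ (Fin m)) (α β γ δ : Fin m) : ℝ :=
  pd γ (fun w => christoffel G w α δ β) z - pd δ (fun w => christoffel G w α γ β) z
    + ∑ μ, (christoffel G z α γ μ * christoffel G z μ δ β
      - christoffel G z α δ μ * christoffel G z μ γ β)

/-- The product `g(u, v)` of two coordinate vectors at `z`. -/
def coordInner {m : ℕ} (G : EuclideanSpace ℝ (Fin m) → Matrix (Fin m) (Fin m) ℝ)
    (z u v : EuclideanSpace ℝ (Fin m)) : ℝ :=
  ∑ α, ∑ β, G z α β * u α * v β

/-- `g(R(u, v)v, u)`, the numerator of the sectional curvature of the plane of `u, v`. -/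
def riemannUVVU {m : ℕ} (G : EuclideanSpace ℝ (Fin m) → Matrix (Fin m) (Fin m) ℝ)
    (z u v : EuclideanSpace ℝ (Fin m)) : ℝ :=
  ∑ α, ∑ μ, ∑ β, ∑ γ, ∑ δ, G z α μ * riemannUp G z μ β γ δ * u α * v β * u γ * v δ

/-- `g(u,u) g(v,v) - g(u,v)²`; nonzero iff `u, v` span a nondegenerate plane. -/
def gram {m : ℕ} (G : EuclideanSpace ℝ (Fin m) → Matrix (Fin m) (Fin m) ℝ)
    (z u v : EuclideanSpace ℝ (Fin m)) : ℝ :=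
  coordInner G z u u * coordInner G z v v - coordInner G z u v ^ 2

/-- The sectional curvature of the plane spanned by `u, v` at `z` (if nondegenerate). -/
def sectional {m : ℕ} (G : EuclideanSpace ℝ (Fin m) → Matrix (Fin m) (Fin m) ℝ)
    (z u v : EuclideanSpace ℝ (Fin m)) : ℝ :=
  riemannUVVU G z u v / gram G z u v

/-! ### Lorentzian manifolds -/

/-- The components `g_{αβ} = g(∂_α, ∂_β)` in the chart `y`, as functions on the target of `y`,
of a field `g` of bilinear forms on the tangent spaces. -/
def coordMetric {m : ℕ} {N : Type*} [TopologicalSpace N]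
    [ChartedSpace (EuclideanSpace ℝ (Fin m)) N]
    (g : ∀ q : N, TangentSpace (𝓡 m) q →L[ℝ] TangentSpace (𝓡 m) q →L[ℝ] ℝ)
    (y : OpenPartialHomeomorph N (EuclideanSpace ℝ (Fin m))) (z : EuclideanSpace ℝ (Fin m)) :
    Matrix (Fin m) (Fin m) ℝ :=
  Matrix.of fun α β =>
    g (y.symm z)
      (mfderiv (𝓡 m) (𝓡 m) y.symm z (EuclideanSpace.single α (1 : ℝ) : EuclideanSpace ℝ (Fin m)))
      (mfderiv (𝓡 m) (𝓡 m) y.symm z (EuclideanSpace.single β (1 : ℝ) : EuclideanSpace ℝ (Fin m)))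

/-- A smooth Lorentzian metric, of signature `(m - 1, 1)`: a symmetric bilinear form on every
tangent space that is negative on some vector and positive definite on the orthogonal complement
of that vector, with smooth components in every smooth chart. -/
structure LorentzMetric (m : ℕ) (N : Type*) [TopologicalSpace N]
    [ChartedSpace (EuclideanSpace ℝ (Fin m)) N] where
  form : ∀ q : N, TangentSpace (𝓡 m) q →L[ℝ] TangentSpace (𝓡 m) q →L[ℝ] ℝ
  symm : ∀ (q : N) (v w : TangentSpace (𝓡 m) q), form q v w = form q w v
  lorentzian : ∀ q : N, ∃ v : TangentSpace (𝓡 m) q, form q v v < 0 ∧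
    ∀ w : TangentSpace (𝓡 m) q, w ≠ 0 → form q v w = 0 → 0 < form q w w
  smooth : ∀ y ∈ IsManifold.maximalAtlas (𝓡 m) ∞ N, ∀ α β : Fin m,
    ContDiffOn ℝ ∞ (fun z => coordMetric form y z α β) y.target

/-- Every nondegenerate tangent plane has sectional curvature `c`. -/
def LorentzMetric.HasConstantSectionalCurvature {m : ℕ} {N : Type*} [TopologicalSpace N]
    [ChartedSpace (EuclideanSpace ℝ (Fin m)) N] (g : LorentzMetric m N) (c : ℝ) : Prop :=
  ∀ y ∈ IsManifold.maximalAtlas (𝓡 m) ∞ N, ∀ z ∈ y.target,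
    ∀ u v : EuclideanSpace ℝ (Fin m), gram (coordMetric g.form y) z u v ≠ 0 →
      sectional (coordMetric g.form y) z u v = c

/-- A time orientation: a continuous timelike vector field. -/
structure TimeOrientation {m : ℕ} {N : Type*} [TopologicalSpace N]
    [ChartedSpace (EuclideanSpace ℝ (Fin m)) N] [IsManifold (𝓡 m) ∞ N]
    (g : LorentzMetric m N) where
  field : ∀ q : N, TangentSpace (𝓡 m) q
  continuous : Continuous fun q => (⟨q, field q⟩ : TangentBundle (𝓡 m) N)
  timelike : ∀ q, g.form q (field q) (field q) < 0

/-! ### Spacelike hypersurfaces -/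

section Hypersurface

variable {n m : ℕ} {M : Type*} [TopologicalSpace M] [ChartedSpace (EuclideanSpace ℝ (Fin n)) M]
  {N : Type*} [TopologicalSpace N] [ChartedSpace (EuclideanSpace ℝ (Fin m)) N]

/-- The induced form `f^*g` is positive definite at every point; in particular a differentiable
such `f` is an immersion. -/
def IsSpacelike (g : LorentzMetric m N) (f : M → N) : Prop :=
  ∀ (p : M) (v : TangentSpace (𝓡 n) p), v ≠ 0 →
    0 < g.form (f p) (mfderiv (𝓡 n) (𝓡 m) f p v) (mfderiv (𝓡 n) (𝓡 m) f p v)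

/-- `ν` is a future directed timelike unit normal of `f` at `p`. -/
structure IsFutureUnitNormal [IsManifold (𝓡 m) ∞ N] (g : LorentzMetric m N)
    (τ : TimeOrientation g) (f : M → N) (p : M) (ν : TangentSpace (𝓡 m) (f p)) : Prop where
  unit : g.form (f p) ν ν = -1
  normal : ∀ v : TangentSpace (𝓡 n) p, g.form (f p) (mfderiv (𝓡 n) (𝓡 m) f p v) ν = 0
  future : g.form (f p) ν (τ.field (f p)) < 0

/-- The components `v^α` of a tangent vector `v` in the chart `y`, i.e. `v = v^α ∂/∂y^α`. -/
def components (y : OpenPartialHomeomorph N (EuclideanSpace ℝ (Fin m))) {q : N}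
    (v : TangentSpace (𝓡 m) q) : EuclideanSpace ℝ (Fin m) :=
  mfderiv (𝓡 m) (𝓡 m) y q v

/-- The component `f^α = y^α ∘ f ∘ x⁻¹` of `f` in the charts `x` of `M` and `y` of `N`. -/
def coordMap (x : OpenPartialHomeomorph M (EuclideanSpace ℝ (Fin n)))
    (y : OpenPartialHomeomorph N (EuclideanSpace ℝ (Fin m))) (f : M → N) (α : Fin m)
    (z : EuclideanSpace ℝ (Fin n)) : ℝ :=
  y (f (x.symm z)) α

/-- The first fundamental form `g_{ij} = g_{αβ} ∂_i f^α ∂_j f^β` at `p`, in the charts `x, y`. -/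
def firstForm (g : LorentzMetric m N) (x : OpenPartialHomeomorph M (EuclideanSpace ℝ (Fin n)))
    (y : OpenPartialHomeomorph N (EuclideanSpace ℝ (Fin m))) (f : M → N) (p : M) :
    Matrix (Fin n) (Fin n) ℝ :=
  Matrix.of fun i j => ∑ α, ∑ β, coordMetric g.form y (y (f p)) α β *
    pd i (coordMap x y f α) (x p) * pd j (coordMap x y f β) (x p)

/-- The vector `∇_i (∂_j f)` of the ambient covariant derivative along `f`, i.e.
`∂_i ∂_j f^α + Γ^α_{βγ} ∂_i f^β ∂_j f^γ`, at `p`, in the charts `x, y`. -/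
def ambientHessian (g : LorentzMetric m N)
    (x : OpenPartialHomeomorph M (EuclideanSpace ℝ (Fin n)))
    (y : OpenPartialHomeomorph N (EuclideanSpace ℝ (Fin m))) (f : M → N) (p : M)
    (i j : Fin n) (α : Fin m) : ℝ :=
  pd i (pd j (coordMap x y f α)) (x p) +
    ∑ β, ∑ γ, christoffel (coordMetric g.form y) (y (f p)) α β γ *
      pd i (coordMap x y f β) (x p) * pd j (coordMap x y f γ) (x p)

/-- The second fundamental form `h_{ij} = -g(∇_i (∂_j f), ν)` at `p` with respect to the normal
vector `ν`, in the charts `x, y`. The tangential part of `∇_i (∂_j f)`, which is the part that the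
Levi-Civita connection of the induced metric removes, does not contribute. -/
def secondForm (g : LorentzMetric m N) (x : OpenPartialHomeomorph M (EuclideanSpace ℝ (Fin n)))
    (y : OpenPartialHomeomorph N (EuclideanSpace ℝ (Fin m))) (f : M → N) (p : M)
    (ν : TangentSpace (𝓡 m) (f p)) : Matrix (Fin n) (Fin n) ℝ :=
  Matrix.of fun i j => -∑ α, ∑ β, coordMetric g.form y (y (f p)) α β *
    ambientHessian g x y f p i j α * components y ν β

/-- The Weingarten map `h^k_i = g^{kl} h_{li}` at `p`, in the preferred charts at `p` and `f p`. -/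
def weingarten (g : LorentzMetric m N) (f : M → N) (p : M) (ν : TangentSpace (𝓡 m) (f p)) :
    Matrix (Fin n) (Fin n) ℝ :=
  (firstForm g (chartAt (EuclideanSpace ℝ (Fin n)) p) (chartAt (EuclideanSpace ℝ (Fin m)) (f p))
      f p)⁻¹ *
    secondForm g (chartAt (EuclideanSpace ℝ (Fin n)) p) (chartAt (EuclideanSpace ℝ (Fin m)) (f p))
      f p ν

/-- The principal curvatures `λ₁, …, λₙ` at `p`: the eigenvalues of the Weingarten map, with
multiplicity. -/
def principalCurvatures (g : LorentzMetric m N) (f : M → N) (p : M)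
    (ν : TangentSpace (𝓡 m) (f p)) : Multiset ℝ :=
  (weingarten (n := n) g f p ν).charpoly.roots

/-- `K = λ₁ ⋯ λₙ`; for surfaces, `K = λ₁ λ₂`. -/
def gaussCurvature (g : LorentzMetric m N) (f : M → N) (p : M)
    (ν : TangentSpace (𝓡 m) (f p)) : ℝ :=
  (principalCurvatures (n := n) g f p ν).prod

/-- The squared norm `|h|² = λ₁² + ⋯ + λₙ²` of the second fundamental form. -/
def secondFormNormSq (g : LorentzMetric m N) (f : M → N) (p : M)
    (ν : TangentSpace (𝓡 m) (f p)) : ℝ :=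
  ((principalCurvatures (n := n) g f p ν).map fun l => l ^ 2).sum

/-- The Lagrangian angle `φ = κ^{-1/2} ∑ᵢ arctan (λᵢ / √κ)`. -/
def lagrangianAngle (κ : ℝ) (g : LorentzMetric m N) (f : M → N) (p : M)
    (ν : TangentSpace (𝓡 m) (f p)) : ℝ :=
  1 / √κ * ((principalCurvatures (n := n) g f p ν).map fun l => Real.arctan (l / √κ)).sum

/-- The time interval `[0, T)`, where `T = ∞` is allowed. -/
def timeInterval (T : EReal) : Set ℝ := {t | 0 ≤ t ∧ (t : EReal) < T}

/-- `F : M × [0, T) → N` is a smooth family of spacelike immersions, `ν(p, t)` is its future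
directed timelike unit normal, and `∂F/∂t = φ ν` with `φ` the Lagrangian angle. -/
structure IsLagrangianAngleFlow [IsManifold (𝓡 m) ∞ N] (κ : ℝ) (g : LorentzMetric m N)
    (τ : TimeOrientation g) (T : EReal) (F : M → ℝ → N)
    (ν : ∀ (p : M) (t : ℝ), TangentSpace (𝓡 m) (F p t)) : Prop where
  smooth : ContMDiffOn ((𝓡 n).prod 𝓘(ℝ, ℝ)) (𝓡 m) ∞ (fun a : M × ℝ => F a.1 a.2)
    (Set.univ ×ˢ timeInterval T)
  spacelike : ∀ t ∈ timeInterval T, IsSpacelike (n := n) g fun p => F p t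
  normal : ∀ t ∈ timeInterval T, ∀ p : M,
    IsFutureUnitNormal (n := n) g τ (fun p' => F p' t) p (ν p t)
  evolution : ∀ t ∈ timeInterval T, ∀ p : M,
    HasMFDerivWithinAt 𝓘(ℝ, ℝ) (𝓡 m) (F p) (timeInterval T) t
      (ContinuousLinearMap.smulRight (1 : ℝ →L[ℝ] ℝ)
        (lagrangianAngle (n := n) κ g (fun p' => F p' t) p (ν p t) • ν p t))

end Hypersurface

end AdSFlow

end

noncomputable section

set_option maxSynthPendingDepth 3

namespace AdSFlow

/-! Write `s = √κ`, let `a ≥ b` be the principal curvatures, `α = arctan (a/s)`, `β = arctan (b/s)`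
and `θ = α + β = s φ`. The complex number `(s + i a)(s + i b) = (s² - K) + i s H` has argument `θ`,
so `K < κ` means `|θ| < π/2`. Likewise `v = cos (α - β)` has the sign of `s² + K`, so `κ + K > 0`
means `v > 0`. The theorem thus becomes two maximum principles on a compact surface, one for `θ` and
one for `v`.

From `∂ₜg = 2φh` and `∂ₜh = ∇²φ + φh² - κφg`, each arctangent changes at the rate `s/(s² + λ²)
∇²φ(e, e) - sφ`, where `e` is its unit principal direction. Adding the two rates, `θ` solves a
parabolic equation with reaction term `-2θ` (`fderiv_angleSum_time`). Hence a bound `|θ| < Θ < π/2`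
at time zero persists (`abs_angle_lt`). Since `|(s + ia)(s + ib)| ≥ s²`, it gives `κ - K ≥ κ cos Θ`,
the uniform bound.

Subtracting the two rates, the reaction terms cancel but `∇²φ` enters with both signs. At a spatial
maximum of `α - β` the gradients of `α` and `β` agree. The Codazzi equations control the derivatives
of `b` along `e₁` and of `a` along `e₂`, and the remaining derivatives of connection coefficients
combine into the left side of the Gauss equation (`angle_difference_identity`,
`angle_difference_le`). The outcome is `∂ₜ(α - β) ≤ 2 sin (α - β) cos (α - β)`, hence `v' ≥ -2v` at
a positive spatial minimum of `v` below 1. So `v` stays positive (`cosAngle_pos`), without a bound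
uniform in time.

Both bounds together control `h`: `s |H| cos Θ ≤ κ - K < 2κ` and `|h|² = H² - 2K`.

Three points of regularity shape the argument. Principal curvatures need not be smooth at umbilics,
so `θ` and `v` are written as the smooth functions `angleSum` and `cosAngleDiff` of `H` and `K`; a
principal frame is needed only where `v < 1`, which excludes umbilics. The normal is given
pointwise, and its smoothness is recovered from the time orientation (`exists_isFlowBox`). At `t =
0` the flow is smooth only from one side, so two-sided time derivatives are taken for `t > 0` and
continuity carries the initial condition.

The computations are done for maps between normed spaces (`IsLocalFlow`) and transferred to the
manifolds through charts. -/

theorem two_le_smooth : (2 : WithTop ℕ∞) ≤ ∞ :=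
  WithTop.coe_le_coe.2 (le_top : (2 : ℕ∞) ≤ ⊤)

/-! ### Connections in coordinates and covariant derivatives along maps -/

section Connection

variable {E : Type*} [NormedAddCommGroup E] [NormedSpace ℝ E]

/-- The curvature `R(u, v)w` of a connection with Christoffel symbols `Γ`. -/
def curvatureOf (Γ : E → E →L[ℝ] E →L[ℝ] E) (z u v w : E) : E :=
  fderiv ℝ Γ z u v w - fderiv ℝ Γ z v u w + Γ z u (Γ z v w) - Γ z v (Γ z u w)

/-- `Γ` is the Levi-Civita connection of the metric `B` on the open set `Ω`. -/
structure IsLeviCivita (Ω : Set E) (B : E → E →L[ℝ] E →L[ℝ] ℝ)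
    (Γ : E → E →L[ℝ] E →L[ℝ] E) : Prop where
  isOpen : IsOpen Ω
  smooth_metric : ContDiffOn ℝ ∞ B Ω
  smooth_conn : ContDiffOn ℝ ∞ Γ Ω
  metric_symm : ∀ z ∈ Ω, ∀ u v, B z u v = B z v u
  torsion_free : ∀ z ∈ Ω, ∀ u v, Γ z u v = Γ z v u
  compatible : ∀ z ∈ Ω, ∀ u v w, fderiv ℝ B z u v w = B z (Γ z u v) w + B z v (Γ z u w)

/-- `R(u, v)w = c (B(v, w) u - B(u, w) v)` on `Ω`. -/
def HasConstantCurvature (Ω : Set E) (B : E → E →L[ℝ] E →L[ℝ] ℝ)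
    (Γ : E → E →L[ℝ] E →L[ℝ] E) (c : ℝ) : Prop :=
  ∀ z ∈ Ω, ∀ u v w, curvatureOf Γ z u v w = c • (B z v w • u - B z u w • v)

variable {Ω : Set E} {B : E → E →L[ℝ] E →L[ℝ] ℝ} {Γ : E → E →L[ℝ] E →L[ℝ] E}

theorem IsLeviCivita.differentiableAt_metric (h : IsLeviCivita Ω B Γ) {z : E} (hz : z ∈ Ω) :
    DifferentiableAt ℝ B z :=
  (h.smooth_metric.contDiffAt (h.isOpen.mem_nhds hz)).differentiableAt (by simp)

theorem IsLeviCivita.differentiableAt_conn (h : IsLeviCivita Ω B Γ) {z : E} (hz : z ∈ Ω) :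
    DifferentiableAt ℝ Γ z :=
  (h.smooth_conn.contDiffAt (h.isOpen.mem_nhds hz)).differentiableAt (by simp)

variable {Z : Type*} [NormedAddCommGroup Z] [NormedSpace ℝ Z]

theorem fderiv_clm_apply₂ {X F₁ F₂ F₃ : Type*} [NormedAddCommGroup X] [NormedSpace ℝ X]
    [NormedAddCommGroup F₁] [NormedSpace ℝ F₁] [NormedAddCommGroup F₂] [NormedSpace ℝ F₂]
    [NormedAddCommGroup F₃] [NormedSpace ℝ F₃] {c : X → F₁ →L[ℝ] F₂ →L[ℝ] F₃} {u : X → F₁}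
    {v : X → F₂} {x : X} (hc : DifferentiableAt ℝ c x) (hu : DifferentiableAt ℝ u x)
    (hv : DifferentiableAt ℝ v x) (ξ : X) :
    fderiv ℝ (fun y => c y (u y) (v y)) x ξ =
      fderiv ℝ c x ξ (u x) (v x) + c x (fderiv ℝ u x ξ) (v x) + c x (u x) (fderiv ℝ v x ξ) := by
  have := ((hc.hasFDerivAt.clm_apply hu.hasFDerivAt).clm_apply hv.hasFDerivAt).fderiv
  rw [this]
  simp
  abel

/-- Curvature is skew with respect to the metric. -/
theorem IsLeviCivita.curvatureOf_skew (h : IsLeviCivita Ω B Γ) {z : E} (hz : z ∈ Ω)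
    (u v w x : E) : B z (curvatureOf Γ z u v w) x = -B z (curvatureOf Γ z u v x) w := by
  have hB := h.differentiableAt_metric hz
  have hΓ := h.differentiableAt_conn hz
  -- Differentiating metric compatibility once more expresses `D²B`. Its symmetry in `p`, `q` is
  -- exactly skewness of the curvature.
  have key : ∀ p q : E, fderiv ℝ (fderiv ℝ B) z p q w x =
      fderiv ℝ B z p (Γ z q w) x + B z (fderiv ℝ Γ z p q w) x
      + (fderiv ℝ B z p w (Γ z q x) + B z w (fderiv ℝ Γ z p q x)) := by
    intro p q
    have hd : DifferentiableAt ℝ (fderiv ℝ B) z :=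
      ((h.smooth_metric.contDiffAt (h.isOpen.mem_nhds hz)).fderiv_right
        (m := 1) (by norm_cast)).differentiableAt (by simp)
    have e1 : fderiv ℝ (fun y => fderiv ℝ B y q w x) z p =
        fderiv ℝ (fderiv ℝ B) z p q w x := by
      have := ((hd.hasFDerivAt.clm_apply (hasFDerivAt_const q z)).clm_apply
        (hasFDerivAt_const w z)).clm_apply (hasFDerivAt_const x z)
      rw [this.fderiv]; simp
    have e2 : (fun y => fderiv ℝ B y q w x) =ᶠ[nhds z]
        fun y => B y (Γ y q w) x + B y w (Γ y q x) := by
      filter_upwards [h.isOpen.mem_nhds hz] with y hy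
      exact h.compatible y hy q w x
    have hq : ∀ r : E, DifferentiableAt ℝ (fun y => Γ y q r) z := fun r =>
      (hΓ.clm_apply (differentiableAt_const q)).clm_apply (differentiableAt_const r)
    have hq' : ∀ r : E, fderiv ℝ (fun y => Γ y q r) z p = fderiv ℝ Γ z p q r := by
      intro r
      rw [fderiv_clm_apply₂ hΓ (differentiableAt_const q) (differentiableAt_const r)]
      simp
    rw [← e1, e2.fderiv_eq, fderiv_fun_add
      ((hB.clm_apply (hq w)).clm_apply (differentiableAt_const x))
      ((hB.clm_apply (differentiableAt_const w)).clm_apply (hq x)),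
      add_apply, fderiv_clm_apply₂ hB (hq w) (differentiableAt_const x),
      fderiv_clm_apply₂ hB (differentiableAt_const w) (hq x), hq', hq']
    simp
  have hsymm : fderiv ℝ (fderiv ℝ B) z u v = fderiv ℝ (fderiv ℝ B) z v u :=
    ((h.smooth_metric.contDiffAt (h.isOpen.mem_nhds hz)).isSymmSndFDerivAt (by simpa using two_le_smooth)).eq u v
  have h1 := key u v
  have h2 := key v u
  rw [hsymm, h2] at h1
  simp only [h.compatible z hz] at h1
  simp only [curvatureOf, map_add, map_sub, add_apply, sub_apply]
  rw [h.metric_symm z hz (fderiv ℝ Γ z u v x), h.metric_symm z hz (fderiv ℝ Γ z v u x),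
    h.metric_symm z hz (Γ z u (Γ z v x)), h.metric_symm z hz (Γ z v (Γ z u x))]
  linear_combination -h1

theorem curvatureOf_swap (Γ : E → E →L[ℝ] E →L[ℝ] E) (z u v w : E) :
    curvatureOf Γ z u v w = -curvatureOf Γ z v u w := by
  simp only [curvatureOf]; abel

/-- Absence of torsion makes `Γ` symmetric and its derivative symmetric in the last two slots; the
terms then cancel cyclically. -/
theorem IsLeviCivita.bianchi (h : IsLeviCivita Ω B Γ) {z : E} (hz : z ∈ Ω) (u v w : E) :
    curvatureOf Γ z u v w + curvatureOf Γ z v w u + curvatureOf Γ z w u v = 0 := by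
  have hΓ := h.differentiableAt_conn hz
  have key : ∀ p q r : E, fderiv ℝ Γ z p q r = fderiv ℝ Γ z p r q := by
    intro p q r
    have e : ∀ q r, fderiv ℝ (fun y => Γ y q r) z p = fderiv ℝ Γ z p q r := by
      intro q r
      rw [fderiv_clm_apply₂ hΓ (differentiableAt_const q) (differentiableAt_const r)]
      simp
    rw [← e, ← e]
    congr 1
    refine Filter.EventuallyEq.fderiv_eq ?_
    filter_upwards [h.isOpen.mem_nhds hz] with y hy
    exact h.torsion_free y hy q r
  simp only [curvatureOf]
  rw [key u v w, key v w u, key w u v, h.torsion_free z hz v w, h.torsion_free z hz w u,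
    h.torsion_free z hz u v]
  abel

/-- The covariant derivative `D_ξ W = ∂_ξ W + Γ(∂_ξ f, W)` of a vector field along `f`. -/
def cov (Γ : E → E →L[ℝ] E →L[ℝ] E) (f W : Z → E) (ζ ξ : Z) : E :=
  fderiv ℝ W ζ ξ + Γ (f ζ) (fderiv ℝ f ζ ξ) (W ζ)

theorem cov_add_dir (f W : Z → E) (ζ ξ η : Z) :
    cov Γ f W ζ (ξ + η) = cov Γ f W ζ ξ + cov Γ f W ζ η := by
  simp [cov]; abel

theorem cov_smul_dir (f W : Z → E) (ζ ξ : Z) (c : ℝ) :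
    cov Γ f W ζ (c • ξ) = c • cov Γ f W ζ ξ := by
  simp [cov]

theorem cov_congr {f W W' : Z → E} {ζ : Z} (h : W =ᶠ[nhds ζ] W') (ξ : Z) :
    cov Γ f W ζ ξ = cov Γ f W' ζ ξ := by
  simp [cov, h.fderiv_eq, h.eq_of_nhds]

theorem cov_add {f W W' : Z → E} {ζ : Z} (hW : DifferentiableAt ℝ W ζ)
    (hW' : DifferentiableAt ℝ W' ζ) (ξ : Z) :
    cov Γ f (fun y => W y + W' y) ζ ξ = cov Γ f W ζ ξ + cov Γ f W' ζ ξ := by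
  simp [cov, fderiv_fun_add hW hW']; abel

theorem cov_smul {f W : Z → E} {c : Z → ℝ} {ζ : Z} (hc : DifferentiableAt ℝ c ζ)
    (hW : DifferentiableAt ℝ W ζ) (ξ : Z) :
    cov Γ f (fun y => c y • W y) ζ ξ = fderiv ℝ c ζ ξ • W ζ + c ζ • cov Γ f W ζ ξ := by
  simp [cov, fderiv_fun_smul hc hW]; abel

/-- Metric compatibility pulls back along `f`: the chain rule inserts the direction `fderiv ℝ f ζ
ξ`, and the two Christoffel terms complete the ordinary derivatives to covariant ones. -/
theorem IsLeviCivita.fderiv_inner (h : IsLeviCivita Ω B Γ) {f W W' : Z → E} {ζ : Z}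
    (hζ : f ζ ∈ Ω) (hf : DifferentiableAt ℝ f ζ) (hW : DifferentiableAt ℝ W ζ)
    (hW' : DifferentiableAt ℝ W' ζ) (ξ : Z) :
    fderiv ℝ (fun y => B (f y) (W y) (W' y)) ζ ξ =
      B (f ζ) (cov Γ f W ζ ξ) (W' ζ) + B (f ζ) (W ζ) (cov Γ f W' ζ ξ) := by
  have hB := h.differentiableAt_metric hζ
  have hBf : DifferentiableAt ℝ (fun y => B (f y)) ζ := hB.comp ζ hf
  rw [fderiv_clm_apply₂ hBf hW hW']
  have : fderiv ℝ (fun y => B (f y)) ζ ξ = fderiv ℝ B (f ζ) (fderiv ℝ f ζ ξ) := by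
    rw [show (fun y => B (f y)) = B ∘ f from rfl, fderiv_comp ζ hB hf]; rfl
  rw [this, h.compatible _ hζ]
  simp only [cov, map_add, add_apply]
  ring

/-- The Lie bracket of two vector fields. -/
def bracket (e₁ e₂ : Z → Z) (ζ : Z) : Z := fderiv ℝ e₂ ζ (e₁ ζ) - fderiv ℝ e₁ ζ (e₂ ζ)

variable {O : Set Z} {f W : Z → E} {e e₁ e₂ : Z → Z}

theorem contDiffOn_fderiv_apply {F : Type*} [NormedAddCommGroup F] [NormedSpace ℝ F] {q : Z → F}
    (hO : IsOpen O) (hq : ContDiffOn ℝ ∞ q O) (he : ContDiffOn ℝ ∞ e O) :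
    ContDiffOn ℝ ∞ (fun ζ => fderiv ℝ q ζ (e ζ)) O :=
  (hq.fderiv_of_isOpen hO (by simp)).clm_apply he

theorem fderiv_fderiv_apply {F : Type*} [NormedAddCommGroup F] [NormedSpace ℝ F] {q : Z → F}
    (hO : IsOpen O) (hq : ContDiffOn ℝ ∞ q O) (he : ContDiffOn ℝ ∞ e O) {ζ : Z} (hζ : ζ ∈ O)
    (ξ : Z) : fderiv ℝ (fun y => fderiv ℝ q y (e y)) ζ ξ =
      fderiv ℝ (fderiv ℝ q) ζ ξ (e ζ) + fderiv ℝ q ζ (fderiv ℝ e ζ ξ) := by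
  have h1 : DifferentiableAt ℝ (fderiv ℝ q) ζ :=
    ((hq.fderiv_of_isOpen hO (m := ∞) (by simp)).contDiffAt (hO.mem_nhds hζ)).differentiableAt
      (by simp)
  have h2 : DifferentiableAt ℝ e ζ := (he.contDiffAt (hO.mem_nhds hζ)).differentiableAt (by simp)
  rw [fderiv_clm_apply h1 h2]
  simp
  abel

theorem fderiv_fderiv_comm {F : Type*} [NormedAddCommGroup F] [NormedSpace ℝ F] {q : Z → F}
    (hO : IsOpen O) (hq : ContDiffOn ℝ ∞ q O) {ζ : Z} (hζ : ζ ∈ O) (ξ η : Z) :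
    fderiv ℝ (fderiv ℝ q) ζ ξ η = fderiv ℝ (fderiv ℝ q) ζ η ξ :=
  ((hq.contDiffAt (hO.mem_nhds hζ)).isSymmSndFDerivAt (by simpa using two_le_smooth)).eq ξ η

theorem IsLeviCivita.contDiffOn_cov (h : IsLeviCivita Ω B Γ) (hO : IsOpen O)
    (hf : ContDiffOn ℝ ∞ f O) (hfΩ : ∀ ζ ∈ O, f ζ ∈ Ω) (hW : ContDiffOn ℝ ∞ W O)
    (he : ContDiffOn ℝ ∞ e O) : ContDiffOn ℝ ∞ (fun ζ => cov Γ f W ζ (e ζ)) O :=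
  (contDiffOn_fderiv_apply hO hW he).add
    (((h.smooth_conn.comp hf hfΩ).clm_apply (contDiffOn_fderiv_apply hO hf he)).clm_apply hW)

theorem IsLeviCivita.contDiffOn_inner (h : IsLeviCivita Ω B Γ) {W' : Z → E}
    (hf : ContDiffOn ℝ ∞ f O) (hfΩ : ∀ ζ ∈ O, f ζ ∈ Ω) (hW : ContDiffOn ℝ ∞ W O)
    (hW' : ContDiffOn ℝ ∞ W' O) : ContDiffOn ℝ ∞ (fun ζ => B (f ζ) (W ζ) (W' ζ)) O :=
  ((h.smooth_metric.comp hf hfΩ).clm_apply hW).clm_apply hW'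

/-- The second derivative of `f` and the connection are symmetric, so only the derivatives of the
fields `e₁`, `e₂` survive. -/
theorem IsLeviCivita.cov_torsion (h : IsLeviCivita Ω B Γ) (hO : IsOpen O)
    (hf : ContDiffOn ℝ ∞ f O) (hfΩ : ∀ ζ ∈ O, f ζ ∈ Ω) (he₁ : ContDiffOn ℝ ∞ e₁ O)
    (he₂ : ContDiffOn ℝ ∞ e₂ O) {ζ : Z} (hζ : ζ ∈ O) :
    cov Γ f (fun y => fderiv ℝ f y (e₂ y)) ζ (e₁ ζ) -
      cov Γ f (fun y => fderiv ℝ f y (e₁ y)) ζ (e₂ ζ) = fderiv ℝ f ζ (bracket e₁ e₂ ζ) := by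
  simp only [cov, fderiv_fderiv_apply hO hf he₂ hζ, fderiv_fderiv_apply hO hf he₁ hζ, bracket,
    map_sub]
  rw [fderiv_fderiv_comm hO hf hζ, h.torsion_free _ (hfΩ ζ hζ) (fderiv ℝ f ζ (e₁ ζ))]
  abel

/-- The curvature identity along a map. With `W` the normal it yields Codazzi (two frame fields) and
the evolution of `h` (one time and one space direction); with `W` a tangent frame vector it yields
Gauss. -/
theorem IsLeviCivita.cov_cov_sub (h : IsLeviCivita Ω B Γ) (hO : IsOpen O)
    (hf : ContDiffOn ℝ ∞ f O) (hfΩ : ∀ ζ ∈ O, f ζ ∈ Ω) (hW : ContDiffOn ℝ ∞ W O)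
    (he₁ : ContDiffOn ℝ ∞ e₁ O) (he₂ : ContDiffOn ℝ ∞ e₂ O) {ζ : Z} (hζ : ζ ∈ O) :
    cov Γ f (fun y => cov Γ f W y (e₂ y)) ζ (e₁ ζ) -
      cov Γ f (fun y => cov Γ f W y (e₁ y)) ζ (e₂ ζ) - cov Γ f W ζ (bracket e₁ e₂ ζ) =
      curvatureOf Γ (f ζ) (fderiv ℝ f ζ (e₁ ζ)) (fderiv ℝ f ζ (e₂ ζ)) (W ζ) := by
  have hΓ := h.differentiableAt_conn (hfΩ ζ hζ)
  have dif : ∀ {F : Type _} [NormedAddCommGroup F] [NormedSpace ℝ F] {q : Z → F},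
      ContDiffOn ℝ ∞ q O → DifferentiableAt ℝ q ζ := fun hq =>
    (hq.contDiffAt (hO.mem_nhds hζ)).differentiableAt (by simp)
  have hΓf : fderiv ℝ (fun y => Γ (f y)) ζ = (fderiv ℝ Γ (f ζ)).comp (fderiv ℝ f ζ) :=
    fderiv_comp (g := Γ) ζ hΓ (dif hf)
  have key : ∀ {e : Z → Z} (_ : ContDiffOn ℝ ∞ e O) (ξ : Z),
      fderiv ℝ (fun y => cov Γ f W y (e y)) ζ ξ =
      fderiv ℝ (fderiv ℝ W) ζ ξ (e ζ) + fderiv ℝ W ζ (fderiv ℝ e ζ ξ)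
      + (fderiv ℝ Γ (f ζ) (fderiv ℝ f ζ ξ) (fderiv ℝ f ζ (e ζ)) (W ζ)
        + Γ (f ζ) (fderiv ℝ (fderiv ℝ f) ζ ξ (e ζ) + fderiv ℝ f ζ (fderiv ℝ e ζ ξ)) (W ζ)
        + Γ (f ζ) (fderiv ℝ f ζ (e ζ)) (fderiv ℝ W ζ ξ)) := by
    intro e he ξ
    have d1 := dif (contDiffOn_fderiv_apply hO hW he)
    have d2 := dif (contDiffOn_fderiv_apply hO hf he)
    have d3 : DifferentiableAt ℝ (fun y => Γ (f y)) ζ := hΓ.comp ζ (dif hf)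
    simp only [cov]
    rw [fderiv_fun_add d1 ((d3.clm_apply d2).clm_apply (dif hW)), add_apply,
      fderiv_clm_apply₂ d3 d2 (dif hW), fderiv_fderiv_apply hO hW he hζ,
      fderiv_fderiv_apply hO hf he hζ, hΓf]
    rfl
  have k₁ := key he₁ (e₂ ζ)
  have k₂ := key he₂ (e₁ ζ)
  simp only [cov] at k₁ k₂
  simp only [cov, k₁, k₂, curvatureOf, bracket, map_add, map_sub, add_apply, sub_apply]
  rw [fderiv_fderiv_comm hO hf hζ, fderiv_fderiv_comm hO hW hζ]
  abel

end Connection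

/-! ### Constant sectional curvature determines the curvature tensor -/

/-- A tensor with the symmetries of a curvature tensor vanishes if its sectional values do. -/
theorem curvatureLike_eq_zero {E : Type*} [AddCommGroup E] {S : E → E → E → E → ℝ}
    (add₁ : ∀ u u' v w x, S (u + u') v w x = S u v w x + S u' v w x)
    (skew₁ : ∀ u v w x, S u v w x = -S v u w x)
    (skew₂ : ∀ u v w x, S u v w x = -S u v x w)
    (bianchi : ∀ u v w x, S u v w x + S v w u x + S w u v x = 0)
    (sec : ∀ u v, S u v v u = 0) (u v w x : E) : S u v w x = 0 := by
  -- The pair symmetry is a linear consequence of four Bianchi identities and the two skew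
  -- symmetries.
  have pair : ∀ u v w x, S u v w x = S w x u v := by
    intro u v w x
    linarith [bianchi u v w x, bianchi v w x u, bianchi w x u v, bianchi x u v w,
      skew₁ u v w x, skew₂ u v w x, skew₁ v w u x, skew₂ v w u x, skew₁ w u v x, skew₂ w u v x,
      skew₁ v w x u, skew₁ w x v u, skew₂ w x v u, skew₁ x v w u, skew₂ x v w u,
      skew₁ w x u v, skew₂ w x u v, skew₁ x u w v, skew₂ x u w v, skew₁ u w x v, skew₂ u w x v,
      skew₁ x u v w, skew₁ u v x w, skew₁ v x u w, skew₂ v x u w]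
  have add₃ : ∀ u v w w' x, S u v (w + w') x = S u v w x + S u v w' x := by
    intro u v w w' x
    rw [pair, add₁, pair w, pair w']
  have add₂ : ∀ u v v' w x, S u (v + v') w x = S u v w x + S u v' w x := by
    intro u v v' w x
    rw [skew₁, add₁, skew₁ v, skew₁ v']; ring
  have add₄ : ∀ u v w x x', S u v w (x + x') = S u v w x + S u v w x' := by
    intro u v w x x'
    rw [skew₂, add₃, skew₂ u v x, skew₂ u v x']; ring
  -- Polarise the sectional hypothesis in the outer slots, then `h₂` polarises in the inner ones.
  have h₁ : ∀ u v x, S u v v x = 0 := by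
    intro u v x
    have := sec (u + x) v
    rw [add₁, add₄, add₄, sec, sec] at this
    linarith [pair x v v u, skew₁ v u x v, skew₂ u v x v]
  have h₂ : ∀ u v w x, S u v w x = -S u w v x := by
    intro u v w x
    have := h₁ u (v + w) x
    rw [add₂, add₃, add₃, h₁, h₁] at this
    linarith
  -- Skewness in neighbouring slots makes the three Bianchi terms equal, so `3 S = 0`.
  linarith [bianchi u v w x, h₂ v w u x, skew₁ v u w x, h₂ w u v x, skew₁ w v u x]

/-! ### From sectional curvature on nondegenerate planes to the full curvature tensor. -/

section

variable {E : Type*} [NormedAddCommGroup E] [NormedSpace ℝ E]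

/-- The Gram determinant of `u`, `v` with respect to a bilinear form. -/
def gramDet (b : E →L[ℝ] E →L[ℝ] ℝ) (u v : E) : ℝ := b u u * b v v - b u v ^ 2

/-- Along the line the Gram determinant is a polynomial in `s` with `s⁴`-coefficient `gramDet b u₀
v₀`, so it has finitely many zeros. This carries identities from nondegenerate planes to all planes
by continuity. -/
theorem dense_gramDet_line (b : E →L[ℝ] E →L[ℝ] ℝ) {u₀ v₀ : E} (h₀ : gramDet b u₀ v₀ ≠ 0)
    (hb : ∀ u v, b u v = b v u) (u v : E) :
    Dense {s : ℝ | gramDet b (u + s • u₀) (v + s • v₀) ≠ 0} := by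
  classical
  let P : Polynomial ℝ :=
    (Polynomial.C (b u₀ u₀) * .X ^ 2 + Polynomial.C (2 * b u u₀) * .X + Polynomial.C (b u u)) *
    (Polynomial.C (b v₀ v₀) * .X ^ 2 + Polynomial.C (2 * b v v₀) * .X + Polynomial.C (b v v)) -
    (Polynomial.C (b u₀ v₀) * .X ^ 2 + Polynomial.C (b u v₀ + b u₀ v) * .X +
      Polynomial.C (b u v)) ^ 2
  obtain ⟨c₃, c₂, c₁, c₀, hP⟩ : ∃ c₃ c₂ c₁ c₀, P = Polynomial.C (gramDet b u₀ v₀) * .X ^ 4 +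
      Polynomial.C c₃ * .X ^ 3 + Polynomial.C c₂ * .X ^ 2 + Polynomial.C c₁ * .X +
      Polynomial.C c₀ := by
    refine ⟨b u₀ u₀ * (2 * b v v₀) + 2 * b u u₀ * b v₀ v₀ - 2 * b u₀ v₀ * (b u v₀ + b u₀ v),
      b u₀ u₀ * b v v + 2 * b u u₀ * (2 * b v v₀) + b u u * b v₀ v₀
        - (b u v₀ + b u₀ v) ^ 2 - 2 * b u₀ v₀ * b u v,
      2 * b u u₀ * b v v + b u u * (2 * b v v₀) - 2 * (b u v₀ + b u₀ v) * b u v,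
      b u u * b v v - b u v ^ 2, ?_⟩
    simp only [P, gramDet, map_add, map_sub, map_mul, map_pow, Polynomial.C_ofNat]
    ring
  have hne : P ≠ 0 := by
    intro h
    have := congrArg (fun p => Polynomial.coeff p 4) h
    rw [hP] at this
    simp at this
    exact h₀ this
  have hev : ∀ s, P.eval s = gramDet b (u + s • u₀) (v + s • v₀) := by
    intro s
    simp [P, gramDet]
    rw [hb u₀ u, hb v₀ v]
    ring
  have : {s : ℝ | gramDet b (u + s • u₀) (v + s • v₀) ≠ 0} = (P.roots.toFinset : Set ℝ)ᶜ := by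
    ext s
    simp [← hev, hne]
  rw [this]
  exact (P.roots.toFinset.countable_toSet).dense_compl ℝ

variable {Ω : Set E} {B : E → E →L[ℝ] E →L[ℝ] ℝ} {Γ : E → E →L[ℝ] E →L[ℝ] E}

/-- Constant sectional curvature on nondegenerate planes gives constant curvature. -/
theorem IsLeviCivita.hasConstantCurvature (h : IsLeviCivita Ω B Γ) {c : ℝ}
    (nondeg : ∀ z ∈ Ω, ∀ u, (∀ v, B z u v = 0) → u = 0)
    (plane : ∀ z ∈ Ω, ∃ u v, gramDet (B z) u v ≠ 0)
    (sec : ∀ z ∈ Ω, ∀ u v, gramDet (B z) u v ≠ 0 →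
      B z (curvatureOf Γ z u v v) u = c * gramDet (B z) u v) :
    HasConstantCurvature Ω B Γ c := by
  intro z hz u v w
  rw [← sub_eq_zero]
  refine nondeg z hz _ fun x => ?_
  -- `S` is the defect from constant curvature; it has all symmetries of a curvature tensor, so its
  -- sectional values suffice.
  let S : E → E → E → E → ℝ := fun u v w x =>
    B z (curvatureOf Γ z u v w) x - c * (B z v w * B z u x - B z u w * B z v x)
  have hS : S u v w x = 0 := by
    refine curvatureLike_eq_zero (S := S) ?_ ?_ ?_ ?_ ?_ u v w x
    · intro u u' v w x
      simp only [S, curvatureOf, map_add, map_sub, add_apply, sub_apply]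
      ring
    · intro u v w x
      simp only [S]
      rw [curvatureOf_swap, map_neg, neg_apply]
      ring
    · intro u v w x
      simp only [S]
      rw [h.curvatureOf_skew hz]
      ring
    · intro u v w x
      have := congrArg (fun y => B z y x) (h.bianchi hz u v w)
      simp only [map_add, add_apply, map_zero, zero_apply] at this
      simp only [S]
      rw [h.metric_symm z hz v w, h.metric_symm z hz w u, h.metric_symm z hz u v]
      linear_combination this
    -- A degenerate plane is approached by nondegenerate ones along a line, where `S` vanishes by
    -- hypothesis.
    · intro u v
      obtain ⟨u₀, v₀, h₀⟩ := plane z hz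
      have hd := dense_gramDet_line (B z) h₀ (h.metric_symm z hz) u v
      have hc : Continuous fun s : ℝ => S (u + s • u₀) (v + s • v₀) (v + s • v₀) (u + s • u₀) := by
        simp only [S, curvatureOf]
        fun_prop
      have := hc.ext_on hd (continuous_const (y := (0 : ℝ))) (fun s hs => by
        simp only [S]
        rw [sec z hz _ _ hs, gramDet, h.metric_symm z hz (v + s • v₀) (u + s • u₀)]
        ring)
      simpa using congrFun this 0
  simp only [S] at hS
  simp only [map_sub, map_smul, sub_apply, smul_apply, smul_eq_mul]
  linear_combination hS

end

/-! ### The Levi-Civita connection of a coordinate metric -/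

section Coordinates

variable {m : ℕ} (G : EuclideanSpace ℝ (Fin m) → Matrix (Fin m) (Fin m) ℝ)

/-- The bilinear form with matrix `G z`. -/
def metricOf (z : EuclideanSpace ℝ (Fin m)) :
    EuclideanSpace ℝ (Fin m) →L[ℝ] EuclideanSpace ℝ (Fin m) →L[ℝ] ℝ :=
  ∑ α, ∑ β, G z α β • (EuclideanSpace.proj α : EuclideanSpace ℝ (Fin m) →L[ℝ] ℝ).smulRight
    (EuclideanSpace.proj β : EuclideanSpace ℝ (Fin m) →L[ℝ] ℝ)

/-- The Christoffel symbols of `G` as a bilinear map. -/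
def connOf (z : EuclideanSpace ℝ (Fin m)) :
    EuclideanSpace ℝ (Fin m) →L[ℝ] EuclideanSpace ℝ (Fin m) →L[ℝ] EuclideanSpace ℝ (Fin m) :=
  ∑ α, ∑ β, ∑ γ, christoffel G z α β γ •
    (EuclideanSpace.proj β : EuclideanSpace ℝ (Fin m) →L[ℝ] ℝ).smulRight
      ((EuclideanSpace.proj γ : EuclideanSpace ℝ (Fin m) →L[ℝ] ℝ).smulRight
        (EuclideanSpace.single α (1 : ℝ)))

variable {G}

theorem metricOf_apply (z u v : EuclideanSpace ℝ (Fin m)) :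
    metricOf G z u v = coordInner G z u v := by
  simp [metricOf, coordInner, mul_assoc]

theorem connOf_apply (z u v : EuclideanSpace ℝ (Fin m)) (α : Fin m) :
    connOf G z u v α = ∑ β, ∑ γ, christoffel G z α β γ * u β * v γ := by
  simp [connOf, mul_assoc, Finset.sum_apply, Pi.single_apply, Finset.sum_ite_eq]

theorem fderiv_eq_sum_pd (q : EuclideanSpace ℝ (Fin m) → ℝ) (z u : EuclideanSpace ℝ (Fin m)) :
    fderiv ℝ q z u = ∑ i, pd i q z * u i := by
  conv_lhs => rw [← (EuclideanSpace.basisFun (Fin m) ℝ).sum_repr u]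
  simp [pd, mul_comm]

variable {Ω : Set (EuclideanSpace ℝ (Fin m))}

theorem contDiffOn_metricOf (hG : ∀ α β, ContDiffOn ℝ ∞ (fun z => G z α β) Ω) :
    ContDiffOn ℝ ∞ (metricOf G) Ω := by
  unfold metricOf
  exact ContDiffOn.sum fun α _ => ContDiffOn.sum fun β _ => (hG α β).smul contDiffOn_const

theorem contDiffOn_det {X : Type*} [NormedAddCommGroup X] [NormedSpace ℝ X] {Ω : Set X}
    {A : X → Matrix (Fin m) (Fin m) ℝ} (hA : ∀ α β, ContDiffOn ℝ ∞ (fun z => A z α β) Ω) :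
    ContDiffOn ℝ ∞ (fun z => (A z).det) Ω := by
  simp only [Matrix.det_apply]
  exact ContDiffOn.sum fun σ _ => (contDiffOn_prod fun i _ => hA _ _).const_smul _

/-- Cramer's rule: cofactors divided by the determinant. -/
theorem contDiffOn_matrix_inv {X : Type*} [NormedAddCommGroup X] [NormedSpace ℝ X] {Ω : Set X}
    {A : X → Matrix (Fin m) (Fin m) ℝ} (hA : ∀ α β, ContDiffOn ℝ ∞ (fun z => A z α β) Ω)
    (hdet : ∀ z ∈ Ω, (A z).det ≠ 0) (α β : Fin m) :
    ContDiffOn ℝ ∞ (fun z => (A z)⁻¹ α β) Ω := by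
  have hadj : ContDiffOn ℝ ∞ (fun z => (A z).adjugate α β) Ω := by
    simp only [Matrix.adjugate_apply]
    refine contDiffOn_det fun i j => ?_
    by_cases h : i = β
    · subst h; simpa using contDiffOn_const
    · simpa [Matrix.updateRow_apply, h] using hA i j
  simp only [Matrix.inv_def, Ring.inverse_eq_inv', Matrix.smul_apply, smul_eq_mul]
  exact ((contDiffOn_det hA).inv hdet).mul hadj

theorem contDiffOn_pd (hΩ : IsOpen Ω) {q : EuclideanSpace ℝ (Fin m) → ℝ}
    (hq : ContDiffOn ℝ ∞ q Ω) (i : Fin m) : ContDiffOn ℝ ∞ (pd i q) Ω :=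
  contDiffOn_fderiv_apply hΩ hq contDiffOn_const

theorem contDiffOn_christoffel (hΩ : IsOpen Ω) (hG : ∀ α β, ContDiffOn ℝ ∞ (fun z => G z α β) Ω)
    (hdet : ∀ z ∈ Ω, (G z).det ≠ 0) (α β γ : Fin m) :
    ContDiffOn ℝ ∞ (fun z => christoffel G z α β γ) Ω := by
  unfold christoffel
  refine contDiffOn_const.mul (ContDiffOn.sum fun δ _ =>
    (contDiffOn_matrix_inv hG hdet _ _).mul ?_)
  exact ((contDiffOn_pd hΩ (hG _ _) _).add (contDiffOn_pd hΩ (hG _ _) _)).sub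
    (contDiffOn_pd hΩ (hG _ _) _)

theorem contDiffOn_connOf (hΩ : IsOpen Ω) (hG : ∀ α β, ContDiffOn ℝ ∞ (fun z => G z α β) Ω)
    (hdet : ∀ z ∈ Ω, (G z).det ≠ 0) : ContDiffOn ℝ ∞ (connOf G) Ω := by
  unfold connOf
  exact ContDiffOn.sum fun α _ => ContDiffOn.sum fun β _ => ContDiffOn.sum fun γ _ =>
    (contDiffOn_christoffel hΩ hG hdet α β γ).smul contDiffOn_const

/-- Lowering the upper index contracts `G` with `G⁻¹` and leaves the Christoffel symbols of the
first kind, which no longer involve the inverse. -/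
theorem sum_mul_christoffel {z : EuclideanSpace ℝ (Fin m)} (hdet : (G z).det ≠ 0)
    (μ β γ : Fin m) : ∑ α, G z μ α * christoffel G z α β γ =
      1 / 2 * (pd β (fun w => G w μ γ) z + pd γ (fun w => G w β μ) z
        - pd μ (fun w => G w β γ) z) := by
  have h1 : G z * (G z)⁻¹ = 1 := Matrix.mul_nonsing_inv _ (isUnit_iff_ne_zero.2 hdet)
  have h2 : ∀ δ, ∑ α, G z μ α * (G z)⁻¹ α δ = if μ = δ then 1 else 0 := by
    intro δ
    have := congrFun (congrFun h1 μ) δ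
    rwa [Matrix.mul_apply, Matrix.one_apply] at this
  simp only [christoffel, Finset.mul_sum]
  rw [Finset.sum_comm]
  calc _ = ∑ δ, (∑ α, G z μ α * (G z)⁻¹ α δ) * (1 / 2 * (pd β (fun w => G w δ γ) z +
        pd γ (fun w => G w β δ) z - pd δ (fun w => G w β γ) z)) := by
        refine Finset.sum_congr rfl fun δ _ => ?_
        rw [Finset.sum_mul]
        exact Finset.sum_congr rfl fun α _ => by ring
    _ = _ := by simp [h2]

end Coordinates

/-! ### Levi-Civita property and Riemann components of a three-dimensional coordinate metric. -/

section Coordinates₃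

variable {G : EuclideanSpace ℝ (Fin 3) → Matrix (Fin 3) (Fin 3) ℝ}
  {Ω : Set (EuclideanSpace ℝ (Fin 3))}

theorem pd_congr_of_eqOn {m : ℕ} {Ω : Set (EuclideanSpace ℝ (Fin m))} (hΩ : IsOpen Ω)
    {q q' : EuclideanSpace ℝ (Fin m) → ℝ} (h : Set.EqOn q q' Ω) {z : EuclideanSpace ℝ (Fin m)}
    (hz : z ∈ Ω) (i : Fin m) : pd i q z = pd i q' z := by
  unfold pd
  rw [(h.eventuallyEq_of_mem (hΩ.mem_nhds hz)).fderiv_eq]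

theorem metricOf_connOf (hsymm : ∀ z ∈ Ω, ∀ α β, G z α β = G z β α)
    (hdet : ∀ z ∈ Ω, (G z).det ≠ 0) {z : EuclideanSpace ℝ (Fin 3)} (hz : z ∈ Ω)
    (u v w : EuclideanSpace ℝ (Fin 3)) : metricOf G z (connOf G z u v) w =
      ∑ μ, ∑ β, ∑ γ, 1 / 2 * (pd β (fun w => G w μ γ) z + pd γ (fun w => G w β μ) z
        - pd μ (fun w => G w β γ) z) * u β * v γ * w μ := by
  simp only [← sum_mul_christoffel (hdet z hz)]
  rw [metricOf_apply, coordInner]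
  simp only [connOf_apply, Fin.sum_univ_three]
  rw [hsymm z hz 1 0, hsymm z hz 2 0, hsymm z hz 2 1]
  ring

/-- Compatibility is the classical cancellation: the first-kind symbols for `(u, v, w)` and `(u, w,
v)` add up to a single derivative of the metric. -/
theorem isLeviCivita_connOf (hΩ : IsOpen Ω) (hG : ∀ α β, ContDiffOn ℝ ∞ (fun z => G z α β) Ω)
    (hsymm : ∀ z ∈ Ω, ∀ α β, G z α β = G z β α) (hdet : ∀ z ∈ Ω, (G z).det ≠ 0) :
    IsLeviCivita Ω (metricOf G) (connOf G) where
  isOpen := hΩ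
  smooth_metric := contDiffOn_metricOf hG
  smooth_conn := contDiffOn_connOf hΩ hG hdet
  metric_symm z hz u v := by
    simp only [metricOf_apply, coordInner]
    rw [Finset.sum_comm]
    refine Finset.sum_congr rfl fun β _ => Finset.sum_congr rfl fun α _ => ?_
    rw [hsymm z hz α β]; ring
  torsion_free z hz u v := by
    ext α
    rw [connOf_apply, connOf_apply, Finset.sum_comm]
    refine Finset.sum_congr rfl fun β _ => Finset.sum_congr rfl fun γ _ => ?_
    have : christoffel G z α γ β = christoffel G z α β γ := by
      unfold christoffel
      congr 1
      refine Finset.sum_congr rfl fun δ _ => ?_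
      rw [pd_congr_of_eqOn hΩ (fun w hw => hsymm w hw δ β) hz,
        pd_congr_of_eqOn hΩ (fun w hw => hsymm w hw γ δ) hz,
        pd_congr_of_eqOn hΩ (fun w hw => hsymm w hw γ β) hz]
      ring
    rw [this]; ring
  compatible z hz u v w := by
    have hd : ∀ α β, DifferentiableAt ℝ (fun y => G y α β) z := fun α β =>
      ((hG α β).contDiffAt (hΩ.mem_nhds hz)).differentiableAt (by simp)
    have hm : DifferentiableAt ℝ (metricOf G) z :=
      ((contDiffOn_metricOf hG).contDiffAt (hΩ.mem_nhds hz)).differentiableAt (by simp)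
    have h₁ : fderiv ℝ (metricOf G) z u v w = fderiv ℝ (fun y => metricOf G y v w) z u := by
      rw [fderiv_clm_apply₂ hm (differentiableAt_const v) (differentiableAt_const w)]
      simp
    have h₂ : HasFDerivAt (fun y => ∑ α, ∑ β, G y α β * v α * w β)
        (∑ α, ∑ β, w β • v α • fderiv ℝ (fun y => G y α β) z) z :=
      HasFDerivAt.fun_sum fun α _ => HasFDerivAt.fun_sum fun β _ =>
        ((hd α β).hasFDerivAt.mul_const (v α)).mul_const (w β)
    have h₃ : ∀ v w, metricOf G z v w = metricOf G z w v := fun v w => by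
      simp only [metricOf_apply, coordInner]
      rw [Finset.sum_comm]
      refine Finset.sum_congr rfl fun β _ => Finset.sum_congr rfl fun α _ => ?_
      rw [hsymm z hz α β]; ring
    have hs : ∀ i α β, pd i (fun w => G w α β) z = pd i (fun w => G w β α) z := fun i α β =>
      pd_congr_of_eqOn hΩ (fun w hw => hsymm w hw α β) hz i
    rw [h₁, h₃ v, metricOf_connOf hsymm hdet hz, metricOf_connOf hsymm hdet hz]
    simp only [metricOf_apply, coordInner]
    rw [h₂.fderiv]
    simp only [Fin.sum_univ_three, add_apply, smul_apply, smul_eq_mul, fderiv_eq_sum_pd]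
    rw [hs 0 1 0, hs 0 2 0, hs 0 2 1, hs 1 1 0, hs 1 2 0, hs 1 2 1, hs 2 1 0, hs 2 2 0, hs 2 2 1]
    ring

/-- In `riemannUp` the slot `β` carries the vector acted upon and `γ, δ` carry the plane, whence the
order `w, u, v` on the right. -/
theorem curvatureOf_connOf_apply (hΩ : IsOpen Ω)
    (hG : ∀ α β, ContDiffOn ℝ ∞ (fun z => G z α β) Ω)
    (hdet : ∀ z ∈ Ω, (G z).det ≠ 0) {z : EuclideanSpace ℝ (Fin 3)} (hz : z ∈ Ω)
    (u v w : EuclideanSpace ℝ (Fin 3)) (α : Fin 3) : curvatureOf (connOf G) z u v w α =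
      ∑ β, ∑ γ, ∑ δ, riemannUp G z α β γ δ * w β * u γ * v δ := by
  have hd : ∀ α β γ, DifferentiableAt ℝ (fun y => christoffel G y α β γ) z := fun α β γ =>
    ((contDiffOn_christoffel hΩ hG hdet α β γ).contDiffAt (hΩ.mem_nhds hz)).differentiableAt
      (by simp)
  have hm : DifferentiableAt ℝ (connOf G) z :=
    ((contDiffOn_connOf hΩ hG hdet).contDiffAt (hΩ.mem_nhds hz)).differentiableAt (by simp)
  have hf : ∀ u v w, fderiv ℝ (connOf G) z u v w α =
      ∑ β, ∑ γ, (∑ i, pd i (fun y => christoffel G y α β γ) z * u i) * v β * w γ := by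
    intro u v w
    have h₁ : fderiv ℝ (connOf G) z u v w α = fderiv ℝ (fun y => connOf G y v w α) z u := by
      have h := (hm.hasFDerivAt.clm_apply (hasFDerivAt_const v z)).clm_apply
        (hasFDerivAt_const w z)
      have h' := ((EuclideanSpace.proj α : EuclideanSpace ℝ (Fin 3) →L[ℝ] ℝ).hasFDerivAt.comp z
        h).fderiv
      have h'' : (fun y => connOf G y v w α) =
        (EuclideanSpace.proj α : EuclideanSpace ℝ (Fin 3) →L[ℝ] ℝ) ∘ fun y => connOf G y v w := rfl
      rw [h'', h']
      simp
    have h₂ : HasFDerivAt (fun y => ∑ β, ∑ γ, christoffel G y α β γ * v β * w γ)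
        (∑ β, ∑ γ, w γ • v β • fderiv ℝ (fun y => christoffel G y α β γ) z) z :=
      HasFDerivAt.fun_sum fun β _ => HasFDerivAt.fun_sum fun γ _ =>
        ((hd α β γ).hasFDerivAt.mul_const (v β)).mul_const (w γ)
    rw [h₁]
    simp only [connOf_apply]
    rw [h₂.fderiv]
    simp only [FunLike.coe_sum, Finset.sum_apply, smul_apply, smul_eq_mul, fderiv_eq_sum_pd]
    exact Finset.sum_congr rfl fun β _ => Finset.sum_congr rfl fun γ _ => by ring
  simp only [curvatureOf, PiLp.add_apply, PiLp.sub_apply, hf, connOf_apply, riemannUp,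
    Fin.sum_univ_three]
  ring

theorem metricOf_curvatureOf (hΩ : IsOpen Ω)
    (hG : ∀ α β, ContDiffOn ℝ ∞ (fun z => G z α β) Ω)
    (hsymm : ∀ z ∈ Ω, ∀ α β, G z α β = G z β α)
    (hdet : ∀ z ∈ Ω, (G z).det ≠ 0) {z : EuclideanSpace ℝ (Fin 3)} (hz : z ∈ Ω)
    (u v : EuclideanSpace ℝ (Fin 3)) :
    metricOf G z (curvatureOf (connOf G) z u v v) u = riemannUVVU G z u v := by
  rw [(isLeviCivita_connOf hΩ hG hsymm hdet).metric_symm z hz, metricOf_apply, coordInner,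
    riemannUVVU]
  refine Finset.sum_congr rfl fun α _ => Finset.sum_congr rfl fun μ _ => ?_
  rw [curvatureOf_connOf_apply hΩ hG hdet hz, Finset.mul_sum]
  refine Finset.sum_congr rfl fun β _ => ?_
  rw [Finset.mul_sum]
  refine Finset.sum_congr rfl fun γ _ => ?_
  rw [Finset.mul_sum]
  exact Finset.sum_congr rfl fun δ _ => by ring

theorem gramDet_metricOf (z u v : EuclideanSpace ℝ (Fin 3)) :
    gramDet (metricOf G z) u v = gram G z u v := by
  simp only [gramDet, gram, metricOf_apply]

end Coordinates₃

/-! ### Principal frames of a spacelike surface -/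

section Frames

variable {E : Type*} [NormedAddCommGroup E] [NormedSpace ℝ E]

/-- `x₁, x₂, ν` is an orthonormal frame with timelike last member. -/
structure IsLorentzFrame (b : E →L[ℝ] E →L[ℝ] ℝ) (x₁ x₂ ν : E) : Prop where
  symm : ∀ u v, b u v = b v u
  h₁₁ : b x₁ x₁ = 1
  h₂₂ : b x₂ x₂ = 1
  h₁₂ : b x₁ x₂ = 0
  h₁ν : b x₁ ν = 0
  h₂ν : b x₂ ν = 0
  hνν : b ν ν = -1

/-- Pairing with the frame vectors shows independence, and dimension three makes the frame a basis.
The minus sign reflects `b ν ν = -1`. -/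
theorem IsLorentzFrame.expand {b : E →L[ℝ] E →L[ℝ] ℝ} {x₁ x₂ ν : E}
    (h : IsLorentzFrame b x₁ x₂ ν) (hE : Module.finrank ℝ E = 3) (w : E) :
    w = b w x₁ • x₁ + b w x₂ • x₂ - b w ν • ν := by
  have h₂₁ : b x₂ x₁ = 0 := by rw [h.symm, h.h₁₂]
  have hν₁ : b ν x₁ = 0 := by rw [h.symm, h.h₁ν]
  have hν₂ : b ν x₂ = 0 := by rw [h.symm, h.h₂ν]
  have li : LinearIndependent ℝ ![x₁, x₂, ν] := by
    rw [Fintype.linearIndependent_iff]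
    intro c hc
    simp only [Fin.sum_univ_three, Matrix.cons_val_zero, Matrix.cons_val_one,
      Matrix.cons_val] at hc
    have e₁ := congrArg (fun y => b y x₁) hc
    have e₂ := congrArg (fun y => b y x₂) hc
    have e₃ := congrArg (fun y => b y ν) hc
    simp [h.h₁₁, h.h₂₂, h.h₁₂, h.h₁ν, h.h₂ν, h.hνν, h₂₁, hν₁, hν₂] at e₁ e₂ e₃
    intro i
    fin_cases i
    · exact e₁
    · exact e₂
    · exact e₃
  have hsp := li.span_eq_top_of_card_eq_finrank (by simp [hE])
  have hw : w ∈ Submodule.span ℝ (Set.range ![x₁, x₂, ν]) := by rw [hsp]; trivial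
  obtain ⟨c, hc⟩ := (Submodule.mem_span_range_iff_exists_fun ℝ).1 hw
  simp only [Fin.sum_univ_three, Matrix.cons_val_zero, Matrix.cons_val_one,
      Matrix.cons_val] at hc
  rw [← hc]
  simp [h.h₁₁, h.h₂₂, h.h₁₂, h.h₁ν, h.h₂ν, h.hνν, h₂₁, hν₁, hν₂]

variable {Z : Type*} [NormedAddCommGroup Z] [NormedSpace ℝ Z]

/-- `e₁, e₂` is a smooth orthonormal frame of principal directions, with principal curvatures
`a, b`, of the immersion `f` with unit normal `ν`. -/
structure IsPrincipalFrame (Ω : Set E) (B : E → E →L[ℝ] E →L[ℝ] ℝ)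
    (Γ : E → E →L[ℝ] E →L[ℝ] E) (O : Set Z) (f ν : Z → E) (e₁ e₂ : Z → Z) (a b : Z → ℝ) :
    Prop where
  isOpen : IsOpen O
  maps : ∀ ζ ∈ O, f ζ ∈ Ω
  smooth_f : ContDiffOn ℝ ∞ f O
  smooth_ν : ContDiffOn ℝ ∞ ν O
  smooth_e₁ : ContDiffOn ℝ ∞ e₁ O
  smooth_e₂ : ContDiffOn ℝ ∞ e₂ O
  smooth_a : ContDiffOn ℝ ∞ a O
  smooth_b : ContDiffOn ℝ ∞ b O
  frame : ∀ ζ ∈ O, IsLorentzFrame (B (f ζ)) (fderiv ℝ f ζ (e₁ ζ)) (fderiv ℝ f ζ (e₂ ζ)) (ν ζ)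
  principal₁ : ∀ ζ ∈ O, cov Γ f ν ζ (e₁ ζ) = a ζ • fderiv ℝ f ζ (e₁ ζ)
  principal₂ : ∀ ζ ∈ O, cov Γ f ν ζ (e₂ ζ) = b ζ • fderiv ℝ f ζ (e₂ ζ)
  immersion : ∀ ζ ∈ O, ∀ ξ, fderiv ℝ f ζ ξ = 0 → ξ = 0

/-- The connection form `g(∇ e₁, e₂)` of a frame, in the direction `e`. -/
def rotation (B : E → E →L[ℝ] E →L[ℝ] ℝ) (Γ : E → E →L[ℝ] E →L[ℝ] E) (f : Z → E)
    (e₁ e₂ e : Z → Z) (ζ : Z) : ℝ :=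
  B (f ζ) (cov Γ f (fun y => fderiv ℝ f y (e₁ y)) ζ (e ζ)) (fderiv ℝ f ζ (e₂ ζ))

variable {Ω : Set E} {B : E → E →L[ℝ] E →L[ℝ] ℝ} {Γ : E → E →L[ℝ] E →L[ℝ] E}
  {O : Set Z} {f ν : Z → E} {e₁ e₂ : Z → Z} {a b : Z → ℝ}

/-- The structure equations come from this: frame products are constant, so their derivatives
vanish. -/
theorem IsLeviCivita.inner_cov_of_const (h : IsLeviCivita Ω B Γ) (hO : IsOpen O)
    (hf : ContDiffOn ℝ ∞ f O) (hfΩ : ∀ ζ ∈ O, f ζ ∈ Ω) {W W' : Z → E}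
    (hW : ContDiffOn ℝ ∞ W O) (hW' : ContDiffOn ℝ ∞ W' O) {c : ℝ}
    (hc : ∀ ζ ∈ O, B (f ζ) (W ζ) (W' ζ) = c) {ζ : Z} (hζ : ζ ∈ O) (ξ : Z) :
    B (f ζ) (cov Γ f W ζ ξ) (W' ζ) = -B (f ζ) (W ζ) (cov Γ f W' ζ ξ) := by
  have dif : ∀ {q : Z → E}, ContDiffOn ℝ ∞ q O → DifferentiableAt ℝ q ζ := fun hq =>
    (hq.contDiffAt (hO.mem_nhds hζ)).differentiableAt (by simp)
  have h1 := h.fderiv_inner (hfΩ ζ hζ) (dif hf) (dif hW) (dif hW') ξ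
  have h2 : (fun y => B (f y) (W y) (W' y)) =ᶠ[nhds ζ] fun _ => c := by
    filter_upwards [hO.mem_nhds hζ] with y hy using hc y hy
  rw [h2.fderiv_eq] at h1
  simp at h1
  linarith

namespace IsPrincipalFrame

theorem smooth_X₁ (P : IsPrincipalFrame Ω B Γ O f ν e₁ e₂ a b) :
    ContDiffOn ℝ ∞ (fun ζ => fderiv ℝ f ζ (e₁ ζ)) O :=
  contDiffOn_fderiv_apply P.isOpen P.smooth_f P.smooth_e₁

theorem smooth_X₂ (P : IsPrincipalFrame Ω B Γ O f ν e₁ e₂ a b) :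
    ContDiffOn ℝ ∞ (fun ζ => fderiv ℝ f ζ (e₂ ζ)) O :=
  contDiffOn_fderiv_apply P.isOpen P.smooth_f P.smooth_e₂

theorem smooth_rotation (P : IsPrincipalFrame Ω B Γ O f ν e₁ e₂ a b)
    (h : IsLeviCivita Ω B Γ) {e : Z → Z} (he : ContDiffOn ℝ ∞ e O) :
    ContDiffOn ℝ ∞ (rotation B Γ f e₁ e₂ e) O :=
  h.contDiffOn_inner P.smooth_f P.maps
    (h.contDiffOn_cov P.isOpen P.smooth_f P.maps P.smooth_X₁ he) P.smooth_X₂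

/-- The structure equations of the frame, in an arbitrary direction `ξ` in which the derivative
of the normal is known. -/
theorem cov_frame (P : IsPrincipalFrame Ω B Γ O f ν e₁ e₂ a b) (h : IsLeviCivita Ω B Γ)
    (hE : Module.finrank ℝ E = 3) {ζ : Z} (hζ : ζ ∈ O) (ξ : Z) :
    cov Γ f (fun y => fderiv ℝ f y (e₁ y)) ζ ξ =
        B (f ζ) (cov Γ f (fun y => fderiv ℝ f y (e₁ y)) ζ ξ) (fderiv ℝ f ζ (e₂ ζ)) •
          fderiv ℝ f ζ (e₂ ζ) + B (f ζ) (cov Γ f ν ζ ξ) (fderiv ℝ f ζ (e₁ ζ)) • ν ζ ∧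
    cov Γ f (fun y => fderiv ℝ f y (e₂ y)) ζ ξ =
        -B (f ζ) (cov Γ f (fun y => fderiv ℝ f y (e₁ y)) ζ ξ) (fderiv ℝ f ζ (e₂ ζ)) •
          fderiv ℝ f ζ (e₁ ζ) + B (f ζ) (cov Γ f ν ζ ξ) (fderiv ℝ f ζ (e₂ ζ)) • ν ζ := by
  have F := P.frame ζ hζ
  have i₁₁ := h.inner_cov_of_const P.isOpen P.smooth_f P.maps P.smooth_X₁ P.smooth_X₁
    (fun y hy => (P.frame y hy).h₁₁) hζ ξ
  have i₂₂ := h.inner_cov_of_const P.isOpen P.smooth_f P.maps P.smooth_X₂ P.smooth_X₂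
    (fun y hy => (P.frame y hy).h₂₂) hζ ξ
  have i₁₂ := h.inner_cov_of_const P.isOpen P.smooth_f P.maps P.smooth_X₁ P.smooth_X₂
    (fun y hy => (P.frame y hy).h₁₂) hζ ξ
  have i₁ν := h.inner_cov_of_const P.isOpen P.smooth_f P.maps P.smooth_X₁ P.smooth_ν
    (fun y hy => (P.frame y hy).h₁ν) hζ ξ
  have i₂ν := h.inner_cov_of_const P.isOpen P.smooth_f P.maps P.smooth_X₂ P.smooth_ν
    (fun y hy => (P.frame y hy).h₂ν) hζ ξ
  rw [F.symm (fderiv ℝ f ζ (e₁ ζ))] at i₁₁ i₁₂ i₁ν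
  rw [F.symm (fderiv ℝ f ζ (e₂ ζ))] at i₂₂ i₂ν
  have z₁ : B (f ζ) (cov Γ f (fun y => fderiv ℝ f y (e₁ y)) ζ ξ) (fderiv ℝ f ζ (e₁ ζ)) = 0 := by
    linarith
  have z₂ : B (f ζ) (cov Γ f (fun y => fderiv ℝ f y (e₂ y)) ζ ξ) (fderiv ℝ f ζ (e₂ ζ)) = 0 := by
    linarith
  constructor
  · conv_lhs => rw [F.expand hE (cov Γ f (fun y => fderiv ℝ f y (e₁ y)) ζ ξ)]
    rw [z₁, i₁ν]; module
  · conv_lhs => rw [F.expand hE (cov Γ f (fun y => fderiv ℝ f y (e₂ y)) ζ ξ)]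
    rw [z₂, i₂ν, i₁₂]; module

theorem cov_X₁_e₁ (P : IsPrincipalFrame Ω B Γ O f ν e₁ e₂ a b) (h : IsLeviCivita Ω B Γ)
    (hE : Module.finrank ℝ E = 3) {ζ : Z} (hζ : ζ ∈ O) :
    cov Γ f (fun y => fderiv ℝ f y (e₁ y)) ζ (e₁ ζ) =
      rotation B Γ f e₁ e₂ e₁ ζ • fderiv ℝ f ζ (e₂ ζ) + a ζ • ν ζ := by
  rw [(P.cov_frame h hE hζ (e₁ ζ)).1, P.principal₁ ζ hζ]
  simp [rotation, (P.frame ζ hζ).h₁₁]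

theorem cov_X₁_e₂ (P : IsPrincipalFrame Ω B Γ O f ν e₁ e₂ a b) (h : IsLeviCivita Ω B Γ)
    (hE : Module.finrank ℝ E = 3) {ζ : Z} (hζ : ζ ∈ O) :
    cov Γ f (fun y => fderiv ℝ f y (e₁ y)) ζ (e₂ ζ) =
      rotation B Γ f e₁ e₂ e₂ ζ • fderiv ℝ f ζ (e₂ ζ) := by
  rw [(P.cov_frame h hE hζ (e₂ ζ)).1, P.principal₂ ζ hζ]
  have F := P.frame ζ hζ
  simp [rotation, F.symm (fderiv ℝ f ζ (e₂ ζ)) (fderiv ℝ f ζ (e₁ ζ)), F.h₁₂]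

theorem cov_X₂_e₁ (P : IsPrincipalFrame Ω B Γ O f ν e₁ e₂ a b) (h : IsLeviCivita Ω B Γ)
    (hE : Module.finrank ℝ E = 3) {ζ : Z} (hζ : ζ ∈ O) :
    cov Γ f (fun y => fderiv ℝ f y (e₂ y)) ζ (e₁ ζ) =
      -rotation B Γ f e₁ e₂ e₁ ζ • fderiv ℝ f ζ (e₁ ζ) := by
  rw [(P.cov_frame h hE hζ (e₁ ζ)).2, P.principal₁ ζ hζ]
  simp [rotation, (P.frame ζ hζ).h₁₂]

theorem cov_X₂_e₂ (P : IsPrincipalFrame Ω B Γ O f ν e₁ e₂ a b) (h : IsLeviCivita Ω B Γ)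
    (hE : Module.finrank ℝ E = 3) {ζ : Z} (hζ : ζ ∈ O) :
    cov Γ f (fun y => fderiv ℝ f y (e₂ y)) ζ (e₂ ζ) =
      -rotation B Γ f e₁ e₂ e₂ ζ • fderiv ℝ f ζ (e₁ ζ) + b ζ • ν ζ := by
  rw [(P.cov_frame h hE hζ (e₂ ζ)).2, P.principal₂ ζ hζ]
  simp [rotation, (P.frame ζ hζ).h₂₂]

/-- The bracket is identified after applying the injective differential of `f`, where the torsion
identity and the structure equations compute it. -/
theorem bracket_eq (P : IsPrincipalFrame Ω B Γ O f ν e₁ e₂ a b) (h : IsLeviCivita Ω B Γ)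
    (hE : Module.finrank ℝ E = 3) {ζ : Z} (hζ : ζ ∈ O) :
    bracket e₁ e₂ ζ =
      -rotation B Γ f e₁ e₂ e₁ ζ • e₁ ζ + -rotation B Γ f e₁ e₂ e₂ ζ • e₂ ζ := by
  rw [← sub_eq_zero]
  refine P.immersion ζ hζ _ ?_
  have := h.cov_torsion P.isOpen P.smooth_f P.maps P.smooth_e₁ P.smooth_e₂ hζ
  rw [map_sub, ← this, P.cov_X₂_e₁ h hE hζ, P.cov_X₁_e₂ h hE hζ]
  simp only [map_add, map_smul]
  module

/-- The Codazzi equations. -/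
theorem codazzi (P : IsPrincipalFrame Ω B Γ O f ν e₁ e₂ a b) (h : IsLeviCivita Ω B Γ)
    (hE : Module.finrank ℝ E = 3) {c : ℝ} (hc : HasConstantCurvature Ω B Γ c) {ζ : Z}
    (hζ : ζ ∈ O) :
    fderiv ℝ b ζ (e₁ ζ) = (a ζ - b ζ) * rotation B Γ f e₁ e₂ e₂ ζ ∧
      fderiv ℝ a ζ (e₂ ζ) = (a ζ - b ζ) * rotation B Γ f e₁ e₂ e₁ ζ := by
  have F := P.frame ζ hζ
  have dif : ∀ {F : Type _} [NormedAddCommGroup F] [NormedSpace ℝ F] {q : Z → F},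
      ContDiffOn ℝ ∞ q O → DifferentiableAt ℝ q ζ := fun hq =>
    (hq.contDiffAt (P.isOpen.mem_nhds hζ)).differentiableAt (by simp)
  have difr : ∀ {q : Z → ℝ}, ContDiffOn ℝ ∞ q O → DifferentiableAt ℝ q ζ := fun hq =>
    (hq.contDiffAt (P.isOpen.mem_nhds hζ)).differentiableAt (by simp)
  -- For `W = ν` and constant curvature, the curvature term only involves products of `ν` with
  -- tangent vectors and vanishes.
  have key := h.cov_cov_sub P.isOpen P.smooth_f P.maps P.smooth_ν P.smooth_e₁ P.smooth_e₂ hζ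
  have c₁ : (fun y => cov Γ f ν y (e₁ y)) =ᶠ[nhds ζ] fun y => a y • fderiv ℝ f y (e₁ y) := by
    filter_upwards [P.isOpen.mem_nhds hζ] with y hy using P.principal₁ y hy
  have c₂ : (fun y => cov Γ f ν y (e₂ y)) =ᶠ[nhds ζ] fun y => b y • fderiv ℝ f y (e₂ y) := by
    filter_upwards [P.isOpen.mem_nhds hζ] with y hy using P.principal₂ y hy
  rw [cov_congr c₁, cov_congr c₂, cov_smul (difr P.smooth_a) (dif P.smooth_X₁),
    cov_smul (difr P.smooth_b) (dif P.smooth_X₂), P.bracket_eq h hE hζ, cov_add_dir, cov_smul_dir,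
    cov_smul_dir, P.principal₁ ζ hζ, P.principal₂ ζ hζ, P.cov_X₂_e₁ h hE hζ, P.cov_X₁_e₂ h hE hζ,
    hc _ (P.maps ζ hζ), F.h₁ν, F.h₂ν] at key
  have k₁ := congrArg (fun y => B (f ζ) y (fderiv ℝ f ζ (e₁ ζ))) key
  have k₂ := congrArg (fun y => B (f ζ) y (fderiv ℝ f ζ (e₂ ζ))) key
  simp [F.h₁₁, F.h₂₂, F.h₁₂, F.symm (fderiv ℝ f ζ (e₂ ζ)) (fderiv ℝ f ζ (e₁ ζ))] at k₁ k₂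
  constructor
  · linear_combination k₂
  · linear_combination -k₁

/-- The Gauss equation. -/
theorem gauss (P : IsPrincipalFrame Ω B Γ O f ν e₁ e₂ a b) (h : IsLeviCivita Ω B Γ)
    (hE : Module.finrank ℝ E = 3) {c : ℝ} (hc : HasConstantCurvature Ω B Γ c) {ζ : Z}
    (hζ : ζ ∈ O) :
    fderiv ℝ (rotation B Γ f e₁ e₂ e₂) ζ (e₁ ζ) - fderiv ℝ (rotation B Γ f e₁ e₂ e₁) ζ (e₂ ζ) =
      -c + a ζ * b ζ - rotation B Γ f e₁ e₂ e₁ ζ ^ 2 - rotation B Γ f e₁ e₂ e₂ ζ ^ 2 := by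
  have F := P.frame ζ hζ
  have dif : ∀ {F : Type _} [NormedAddCommGroup F] [NormedSpace ℝ F] {q : Z → F},
      ContDiffOn ℝ ∞ q O → DifferentiableAt ℝ q ζ := fun hq =>
    (hq.contDiffAt (P.isOpen.mem_nhds hζ)).differentiableAt (by simp)
  have difr : ∀ {q : Z → ℝ}, ContDiffOn ℝ ∞ q O → DifferentiableAt ℝ q ζ := fun hq =>
    (hq.contDiffAt (P.isOpen.mem_nhds hζ)).differentiableAt (by simp)
  -- The curvature identity for the first frame vector, later paired with the second. The product `a
  -- b` arises from differentiating the normal part `a • ν` along `e₂`.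
  have key := h.cov_cov_sub P.isOpen P.smooth_f P.maps P.smooth_X₁ P.smooth_e₁ P.smooth_e₂ hζ
  have c₁ : (fun y => cov Γ f (fun y => fderiv ℝ f y (e₁ y)) y (e₁ y)) =ᶠ[nhds ζ]
      fun y => rotation B Γ f e₁ e₂ e₁ y • fderiv ℝ f y (e₂ y) + a y • ν y := by
    filter_upwards [P.isOpen.mem_nhds hζ] with y hy using P.cov_X₁_e₁ h hE hy
  have c₂ : (fun y => cov Γ f (fun y => fderiv ℝ f y (e₁ y)) y (e₂ y)) =ᶠ[nhds ζ]
      fun y => rotation B Γ f e₁ e₂ e₂ y • fderiv ℝ f y (e₂ y) := by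
    filter_upwards [P.isOpen.mem_nhds hζ] with y hy using P.cov_X₁_e₂ h hE hy
  have d₁ := difr (P.smooth_rotation h P.smooth_e₁)
  have d₂ := difr (P.smooth_rotation h P.smooth_e₂)
  have s₁ : DifferentiableAt ℝ
      (fun y => rotation B Γ f e₁ e₂ e₁ y • fderiv ℝ f y (e₂ y)) ζ := d₁.smul (dif P.smooth_X₂)
  have s₂ : DifferentiableAt ℝ (fun y => a y • ν y) ζ :=
    (difr P.smooth_a).smul (dif P.smooth_ν)
  rw [cov_congr c₁, cov_congr c₂, cov_smul d₂ (dif P.smooth_X₂),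
    cov_add s₁ s₂,
    cov_smul d₁ (dif P.smooth_X₂), cov_smul (difr P.smooth_a) (dif P.smooth_ν),
    P.bracket_eq h hE hζ, cov_add_dir, cov_smul_dir, cov_smul_dir, P.cov_X₁_e₁ h hE hζ,
    P.cov_X₁_e₂ h hE hζ, P.cov_X₂_e₁ h hE hζ, P.cov_X₂_e₂ h hE hζ, P.principal₂ ζ hζ,
    hc _ (P.maps ζ hζ), F.h₁₁] at key
  have k₂ := congrArg (fun y => B (f ζ) y (fderiv ℝ f ζ (e₂ ζ))) key
  have hν₂ : B (f ζ) (ν ζ) (fderiv ℝ f ζ (e₂ ζ)) = 0 := by rw [F.symm, F.h₂ν]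
  simp [F.h₂₂, F.h₁₂, F.symm (fderiv ℝ f ζ (e₂ ζ)) (fderiv ℝ f ζ (e₁ ζ)), hν₂] at k₂
  linear_combination k₂

end IsPrincipalFrame

end Frames

/-! ### The angle difference at a spatial maximum -/

section AngleDifference

variable {Z : Type*} [NormedAddCommGroup Z] [NormedSpace ℝ Z]

/-- The second derivative `e (e q)` along a vector field. -/
def secondDirDeriv (q : Z → ℝ) (e : Z → Z) (ζ : Z) : ℝ :=
  fderiv ℝ (fun y => fderiv ℝ q y (e y)) ζ (e ζ)

/-- Were the second derivative positive, `x` would also be a local minimum, `q` would be constant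
near `x`, and the second derivative would be zero. -/
theorem _root_.IsLocalMax.iteratedDeriv_two_nonpos {q : ℝ → ℝ} {x : ℝ} (h : IsLocalMax q x)
    (hq : ContDiffAt ℝ 2 q x) : deriv (deriv q) x ≤ 0 := by
  by_contra! hpos
  have hc : ContinuousAt q x := hq.continuousAt
  have hmin := isLocalMin_of_deriv_deriv_pos hpos h.deriv_eq_zero hc
  have heq : q =ᶠ[nhds x] fun _ => q x := by
    filter_upwards [h, hmin] with y h1 h2 using le_antisymm h1 h2
  have h2 : deriv q =ᶠ[nhds x] fun _ => 0 := by
    have := heq.eventuallyEq_nhds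
    filter_upwards [this] with y hy
    rw [hy.deriv_eq]; simp
  rw [h2.deriv_eq] at hpos
  simp at hpos

/-- Maximality is assumed only along one line, because a spatial maximum of a space-time function
need not be a maximum in time. -/
theorem fderiv_fderiv_nonpos_of_isLocalMax {O : Set Z} (hO : IsOpen O) {q : Z → ℝ}
    (hq : ContDiffOn ℝ ∞ q O) {ζ : Z} (hζ : ζ ∈ O) {ξ : Z}
    (h : IsLocalMax (fun r : ℝ => q (ζ + r • ξ)) 0) :
    fderiv ℝ q ζ ξ = 0 ∧ fderiv ℝ (fderiv ℝ q) ζ ξ ξ ≤ 0 := by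
  let l : ℝ → Z := fun r => ζ + r • ξ
  have hl : ∀ r, HasDerivAt l ξ r := fun r => by
    have := ((hasDerivAt_id r).smul_const ξ).const_add ζ
    rwa [one_smul] at this
  have hlc : ContDiff ℝ ∞ l := contDiff_const.add (contDiff_id.smul contDiff_const)
  have hl0 : l 0 = ζ := by simp [l]
  have hmem : ∀ᶠ r in nhds (0 : ℝ), l r ∈ O :=
    hlc.continuous.continuousAt.eventually_mem (by rw [hl0]; exact hO.mem_nhds hζ)
  have hmax : IsLocalMax (q ∘ l) 0 := h
  have hd : deriv (q ∘ l) =ᶠ[nhds 0] fun r => fderiv ℝ q (l r) ξ := by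
    filter_upwards [hmem] with r hr
    have : DifferentiableAt ℝ q (l r) :=
      (hq.contDiffAt (hO.mem_nhds hr)).differentiableAt (by simp)
    exact (this.hasFDerivAt.comp_hasDerivAt r (hl r)).deriv
  have hdd : DifferentiableAt ℝ (fderiv ℝ q) ζ :=
    ((hq.fderiv_of_isOpen hO (m := ∞) (by simp)).contDiffAt (hO.mem_nhds hζ)).differentiableAt
      (by simp)
  have h2 : HasDerivAt (fun r => fderiv ℝ q (l r) ξ) (fderiv ℝ (fderiv ℝ q) ζ ξ ξ) 0 := by
    have h1 : HasFDerivAt (fderiv ℝ q) (fderiv ℝ (fderiv ℝ q) ζ) (l 0) := by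
      rw [hl0]; exact hdd.hasFDerivAt
    simpa using (h1.comp_hasDerivAt 0 (hl 0)).clm_apply (hasDerivAt_const 0 ξ)
  have hC : ContDiffAt ℝ 2 (q ∘ l) 0 := by
    refine ContDiffAt.comp 0 ?_ (hlc.contDiffAt.of_le two_le_smooth)
    rw [hl0]
    exact (hq.contDiffAt (hO.mem_nhds hζ)).of_le two_le_smooth
  constructor
  · have := hmax.deriv_eq_zero
    rw [hd.self_of_nhds] at this
    simpa only [hl0] using this
  · have := hmax.iteratedDeriv_two_nonpos hC
    rwa [hd.deriv_eq, h2.deriv] at this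

theorem isLocalMax_line {q : Z → ℝ} {ζ : Z} (h : IsLocalMax q ζ) (ξ : Z) :
    IsLocalMax (fun r : ℝ => q (ζ + r • ξ)) 0 := by
  have hc : Continuous fun r : ℝ => ζ + r • ξ := by fun_prop
  have : Filter.Tendsto (fun r : ℝ => ζ + r • ξ) (nhds 0) (nhds ζ) := by
    simpa using hc.tendsto 0
  filter_upwards [this.eventually h] with r hr
  simpa using hr

/-- At a critical point the derivative of the field `e` does not contribute, and only the pure
second derivative remains. -/
theorem secondDirDeriv_nonpos_of_isLocalMax {O : Set Z} (hO : IsOpen O) {q : Z → ℝ} {e : Z → Z}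
    (hq : ContDiffOn ℝ ∞ q O) (he : ContDiffOn ℝ ∞ e O) {ζ : Z} (hζ : ζ ∈ O)
    (h : IsLocalMax q ζ) : secondDirDeriv q e ζ ≤ 0 := by
  rw [secondDirDeriv, fderiv_fderiv_apply hO hq he hζ, h.fderiv_eq_zero]
  simpa using (fderiv_fderiv_nonpos_of_isLocalMax hO hq hζ (isLocalMax_line h (e ζ))).2

theorem contDiff_arctan_div (s : ℝ) : ContDiff ℝ ∞ fun x : ℝ => Real.arctan (x / s) :=
  Real.contDiff_arctan.comp (contDiff_id.div_const s)

/-- Stated without denominators so that, after inserting Codazzi, it can be differentiated once more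
by the product rule. -/
theorem fderiv_arctan_div {q : Z → ℝ} {ζ : Z} (hq : DifferentiableAt ℝ q ζ) {s : ℝ} (hs : 0 < s)
    (ξ : Z) :
    (s ^ 2 + q ζ ^ 2) * fderiv ℝ (fun y => Real.arctan (q y / s)) ζ ξ = s * fderiv ℝ q ζ ξ := by
  have h := (hq.hasFDerivAt.mul_const s⁻¹).arctan
  simp only [← div_eq_mul_inv] at h
  rw [h.fderiv]
  simp only [smul_apply, smul_eq_mul]
  have : 1 + (q ζ / s) ^ 2 ≠ 0 := by positivity
  field_simp

/-- The algebra at the maximum point. Subscripts on curvatures and angles denote frame derivatives,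
and `w₁`, `w₂` are connection coefficients. Codazzi gives `b₁` and `a₂`. Equality of the two angle
gradients (`ha₁`, `hb₂`) determines `a₁` and `b₂`. The hypotheses `hβ₁₁`, `hα₂₂` are the
differentiated Codazzi equations. After substitution `w₂₁` and `w₁₂` occur only through their
difference, which Gauss evaluates. -/
theorem angle_difference_identity {s a b w₁ w₂ w₂₁ w₁₂ a₁ a₂ b₁ b₂ α₂ β₁ α₂₂ β₁₁ : ℝ}
    (hs : 0 < s)
    (gauss : w₂₁ - w₁₂ = s ^ 2 + a * b - w₁ ^ 2 - w₂ ^ 2)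
    (hb₁ : b₁ = (a - b) * w₂) (ha₂ : a₂ = (a - b) * w₁)
    (hβ₁ : (s ^ 2 + b ^ 2) * β₁ = s * b₁) (hα₂ : (s ^ 2 + a ^ 2) * α₂ = s * a₂)
    (ha₁ : (s ^ 2 + a ^ 2) * β₁ = s * a₁) (hb₂ : (s ^ 2 + b ^ 2) * α₂ = s * b₂)
    (hβ₁₁ : 2 * b * b₁ * β₁ + (s ^ 2 + b ^ 2) * β₁₁ = s * ((a₁ - b₁) * w₂ + (a - b) * w₂₁))
    (hα₂₂ : 2 * a * a₂ * α₂ + (s ^ 2 + a ^ 2) * α₂₂ = s * ((a₂ - b₂) * w₁ + (a - b) * w₁₂)) :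
    2 * (β₁₁ - w₁ * α₂) / (s ^ 2 + a ^ 2) - 2 * (α₂₂ + w₂ * β₁) / (s ^ 2 + b ^ 2) =
      2 * s * (a - b) * (s ^ 2 + a * b) / ((s ^ 2 + a ^ 2) * (s ^ 2 + b ^ 2)) *
        (1 - 2 * (w₁ ^ 2 / (s ^ 2 + a ^ 2) + w₂ ^ 2 / (s ^ 2 + b ^ 2))) := by
  have hA : 0 < s ^ 2 + a ^ 2 := by positivity
  have hB : 0 < s ^ 2 + b ^ 2 := by positivity
  have e₁ : β₁ = s * ((a - b) * w₂) / (s ^ 2 + b ^ 2) := by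
    rw [eq_div_iff hB.ne', ← hb₁]; linarith
  have e₂ : α₂ = s * ((a - b) * w₁) / (s ^ 2 + a ^ 2) := by
    rw [eq_div_iff hA.ne', ← ha₂]; linarith
  have e₃ : a₁ = (s ^ 2 + a ^ 2) * ((a - b) * w₂) / (s ^ 2 + b ^ 2) := by
    have : s * a₁ = s * ((s ^ 2 + a ^ 2) * ((a - b) * w₂) / (s ^ 2 + b ^ 2)) := by
      rw [← ha₁, e₁]; ring
    exact mul_left_cancel₀ hs.ne' this
  have e₄ : b₂ = (s ^ 2 + b ^ 2) * ((a - b) * w₁) / (s ^ 2 + a ^ 2) := by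
    have : s * b₂ = s * ((s ^ 2 + b ^ 2) * ((a - b) * w₁) / (s ^ 2 + a ^ 2)) := by
      rw [← hb₂, e₂]; ring
    exact mul_left_cancel₀ hs.ne' this
  have e₅ : β₁₁ = (s * ((a₁ - b₁) * w₂ + (a - b) * w₂₁) - 2 * b * b₁ * β₁) / (s ^ 2 + b ^ 2) := by
    rw [eq_div_iff hB.ne']; linarith
  have e₆ : α₂₂ = (s * ((a₂ - b₂) * w₁ + (a - b) * w₁₂) - 2 * a * a₂ * α₂) / (s ^ 2 + a ^ 2) := by
    rw [eq_div_iff hA.ne']; linarith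
  have e₇ : w₂₁ = w₁₂ + (s ^ 2 + a * b - w₁ ^ 2 - w₂ ^ 2) := by linarith
  rw [e₅, e₆, e₁, e₂, e₃, e₄, hb₁, ha₂, e₇]
  field_simp
  ring

/-- The spatial part of the evolution of `arctan (a / s) - arctan (b / s)` at a maximum. -/
theorem angle_difference_le {O : Set Z} (hO : IsOpen O) {a b w₁ w₂ : Z → ℝ} {e₁ e₂ : Z → Z}
    (ha : ContDiffOn ℝ ∞ a O) (hb : ContDiffOn ℝ ∞ b O) (hw₁ : ContDiffOn ℝ ∞ w₁ O)
    (hw₂ : ContDiffOn ℝ ∞ w₂ O) (he₁ : ContDiffOn ℝ ∞ e₁ O) (he₂ : ContDiffOn ℝ ∞ e₂ O)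
    {s : ℝ} (hs : 0 < s) (codazzi₁ : ∀ ζ ∈ O, fderiv ℝ b ζ (e₁ ζ) = (a ζ - b ζ) * w₂ ζ)
    (codazzi₂ : ∀ ζ ∈ O, fderiv ℝ a ζ (e₂ ζ) = (a ζ - b ζ) * w₁ ζ) {ζ : Z} (hζ : ζ ∈ O)
    (gauss : fderiv ℝ w₂ ζ (e₁ ζ) - fderiv ℝ w₁ ζ (e₂ ζ) =
      s ^ 2 + a ζ * b ζ - w₁ ζ ^ 2 - w₂ ζ ^ 2)
    (hmax : IsLocalMax (fun y => Real.arctan (a y / s) - Real.arctan (b y / s)) ζ)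
    (hab : b ζ ≤ a ζ) (hK : 0 ≤ s ^ 2 + a ζ * b ζ) {φ : Z → ℝ}
    (hφ : ∀ ζ ∈ O, φ ζ = 1 / s * (Real.arctan (a ζ / s) + Real.arctan (b ζ / s))) :
    s / (s ^ 2 + a ζ ^ 2) * (secondDirDeriv φ e₁ ζ - w₁ ζ * fderiv ℝ φ ζ (e₂ ζ)) -
      s / (s ^ 2 + b ζ ^ 2) * (secondDirDeriv φ e₂ ζ + w₂ ζ * fderiv ℝ φ ζ (e₁ ζ)) ≤
    2 * s * (a ζ - b ζ) * (s ^ 2 + a ζ * b ζ) / ((s ^ 2 + a ζ ^ 2) * (s ^ 2 + b ζ ^ 2)) := by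
  have dif : ∀ {q : Z → ℝ}, ContDiffOn ℝ ∞ q O → ∀ {y}, y ∈ O → DifferentiableAt ℝ q y :=
    fun hq y hy => (hq.contDiffAt (hO.mem_nhds hy)).differentiableAt (by simp)
  set α : Z → ℝ := fun y => Real.arctan (a y / s) with hα
  set β : Z → ℝ := fun y => Real.arctan (b y / s) with hβ
  set ψ : Z → ℝ := fun y => Real.arctan (a y / s) - Real.arctan (b y / s) with hψ
  have sα : ContDiffOn ℝ ∞ α O := (contDiff_arctan_div s).comp_contDiffOn ha
  have sβ : ContDiffOn ℝ ∞ β O := (contDiff_arctan_div s).comp_contDiffOn hb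
  have sψ : ContDiffOn ℝ ∞ ψ O := sα.sub sβ
  -- The maximum forces the gradients of the two angles to agree; this supplies the derivatives that
  -- Codazzi leaves undetermined.
  have dψ : ∀ ξ, fderiv ℝ α ζ ξ = fderiv ℝ β ζ ξ := by
    intro ξ
    have h1 : fderiv ℝ ψ ζ = fderiv ℝ α ζ - fderiv ℝ β ζ :=
      fderiv_sub (dif sα hζ) (dif sβ hζ)
    rw [hmax.fderiv_eq_zero] at h1
    have := congrArg (fun L => L ξ) h1
    simp at this
    linarith
  have lin : ∀ {u v : Z → ℝ} {y : Z}, DifferentiableAt ℝ u y → DifferentiableAt ℝ v y → ∀ ξ,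
      fderiv ℝ (fun y => 1 / s * (u y + v y)) y ξ =
        1 / s * (fderiv ℝ u y ξ + fderiv ℝ v y ξ) := by
    intro u v y hu hv ξ
    have := ((hu.hasFDerivAt.fun_add hv.hasFDerivAt).const_mul (1 / s)).fderiv
    rw [this]; simp; ring
  have fφ : ∀ y ∈ O, ∀ ξ, fderiv ℝ φ y ξ = 1 / s * (fderiv ℝ α y ξ + fderiv ℝ β y ξ) := by
    intro y hy ξ
    have h1 : φ =ᶠ[nhds y] fun y => 1 / s * (α y + β y) := by
      filter_upwards [hO.mem_nhds hy] with x hx using hφ x hx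
    rw [h1.fderiv_eq, lin (dif sα hy) (dif sβ hy)]
  have second : ∀ e : Z → Z, ContDiffOn ℝ ∞ e O → secondDirDeriv φ e ζ =
      1 / s * (secondDirDeriv α e ζ + secondDirDeriv β e ζ) ∧
      secondDirDeriv ψ e ζ = secondDirDeriv α e ζ - secondDirDeriv β e ζ := by
    intro e he
    have d₁ := dif (contDiffOn_fderiv_apply hO sα he) hζ
    have d₂ := dif (contDiffOn_fderiv_apply hO sβ he) hζ
    constructor
    · have h1 : (fun y => fderiv ℝ φ y (e y)) =ᶠ[nhds ζ]
          fun y => 1 / s * (fderiv ℝ α y (e y) + fderiv ℝ β y (e y)) := by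
        filter_upwards [hO.mem_nhds hζ] with x hx using fφ x hx _
      rw [secondDirDeriv, h1.fderiv_eq, lin d₁ d₂]
      rfl
    · have h1 : (fun y => fderiv ℝ ψ y (e y)) =ᶠ[nhds ζ]
          fun y => fderiv ℝ α y (e y) - fderiv ℝ β y (e y) := by
        filter_upwards [hO.mem_nhds hζ] with x hx
        rw [show fderiv ℝ ψ x = fderiv ℝ α x - fderiv ℝ β x from
          fderiv_sub (dif sα hx) (dif sβ hx)]
        rfl
      rw [secondDirDeriv, h1.fderiv_eq, fderiv_fun_sub d₁ d₂]
      simp [secondDirDeriv]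
  have n₁ := secondDirDeriv_nonpos_of_isLocalMax hO sψ he₁ hζ hmax
  have n₂ := secondDirDeriv_nonpos_of_isLocalMax hO sψ he₂ hζ hmax
  rw [(second e₁ he₁).2] at n₁
  rw [(second e₂ he₂).2] at n₂
  -- differentiated Codazzi equations
  have diffCod : ∀ {p q w : Z → ℝ} {e : Z → Z}, ContDiffOn ℝ ∞ p O → ContDiffOn ℝ ∞ q O →
      ContDiffOn ℝ ∞ w O → ContDiffOn ℝ ∞ e O →
      (∀ ζ ∈ O, fderiv ℝ q ζ (e ζ) = p ζ * w ζ) →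
      2 * q ζ * fderiv ℝ q ζ (e ζ) * fderiv ℝ (fun y => Real.arctan (q y / s)) ζ (e ζ) +
        (s ^ 2 + q ζ ^ 2) * secondDirDeriv (fun y => Real.arctan (q y / s)) e ζ =
      s * (fderiv ℝ p ζ (e ζ) * w ζ + p ζ * fderiv ℝ w ζ (e ζ)) := by
    intro p q w e hp hq hw he hcod
    have sA : ContDiffOn ℝ ∞ (fun y => Real.arctan (q y / s)) O :=
      (contDiff_arctan_div s).comp_contDiffOn hq
    have h1 : (fun y => (s ^ 2 + q y ^ 2) * fderiv ℝ (fun y => Real.arctan (q y / s)) y (e y))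
        =ᶠ[nhds ζ] fun y => s * (p y * w y) := by
      filter_upwards [hO.mem_nhds hζ] with x hx
      rw [fderiv_arctan_div (dif hq hx) hs, hcod x hx]
    have d₁ := dif (contDiffOn_fderiv_apply hO sA he) hζ
    have H₁ := ((((dif hq hζ).hasFDerivAt.pow 2).const_add (s ^ 2)).mul d₁.hasFDerivAt).fderiv
    have H₂ := (((dif hp hζ).hasFDerivAt.mul (dif hw hζ).hasFDerivAt).const_mul s).fderiv
    have := congrArg (fun L => L (e ζ)) (H₁.symm.trans (h1.fderiv_eq.trans H₂))
    simp at this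
    simp only [secondDirDeriv]
    linear_combination this
  have sab : ContDiffOn ℝ ∞ (fun y => a y - b y) O := ha.sub hb
  have fab : ∀ ξ, fderiv ℝ (fun y => a y - b y) ζ ξ = fderiv ℝ a ζ ξ - fderiv ℝ b ζ ξ := by
    intro ξ
    rw [fderiv_fun_sub (dif ha hζ) (dif hb hζ)]; rfl
  have k₁ := diffCod sab hb hw₂ he₁ codazzi₁
  have k₂ := diffCod sab ha hw₁ he₂ codazzi₂
  rw [fab] at k₁ k₂
  have I := angle_difference_identity hs gauss (codazzi₁ ζ hζ) (codazzi₂ ζ hζ)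
    (fderiv_arctan_div (dif hb hζ) hs (e₁ ζ)) (fderiv_arctan_div (dif ha hζ) hs (e₂ ζ))
    (a₁ := fderiv ℝ a ζ (e₁ ζ)) (b₂ := fderiv ℝ b ζ (e₂ ζ))
    (by rw [← fderiv_arctan_div (dif ha hζ) hs (e₁ ζ)]; exact congrArg _ (dψ _).symm)
    (by rw [← fderiv_arctan_div (dif hb hζ) hs (e₂ ζ)]; exact congrArg _ (dψ _)) k₁ k₂
  rw [(second e₁ he₁).1, (second e₂ he₂).1, fφ ζ hζ, fφ ζ hζ, dψ (e₁ ζ), ← dψ (e₂ ζ)]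
  have hA : 0 < s ^ 2 + a ζ ^ 2 := by positivity
  have hB : 0 < s ^ 2 + b ζ ^ 2 := by positivity
  -- The squares of the connection coefficients enter with a favourable sign and are dropped.
  have hR : 2 * s * (a ζ - b ζ) * (s ^ 2 + a ζ * b ζ) /
      ((s ^ 2 + a ζ ^ 2) * (s ^ 2 + b ζ ^ 2)) *
        (1 - 2 * (w₁ ζ ^ 2 / (s ^ 2 + a ζ ^ 2) + w₂ ζ ^ 2 / (s ^ 2 + b ζ ^ 2))) ≤
      2 * s * (a ζ - b ζ) * (s ^ 2 + a ζ * b ζ) / ((s ^ 2 + a ζ ^ 2) * (s ^ 2 + b ζ ^ 2)) := by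
    refine mul_le_of_le_one_right ?_ ?_
    · have := sub_nonneg.2 hab
      positivity
    · have : 0 ≤ w₁ ζ ^ 2 / (s ^ 2 + a ζ ^ 2) + w₂ ζ ^ 2 / (s ^ 2 + b ζ ^ 2) := by positivity
      linarith
  refine le_trans ?_ hR
  rw [← I]
  -- At the maximum the second derivative of `α` along `e₁` is at most that of `β`, which Codazzi
  -- controls. Along `e₂` it is `α` that Codazzi controls, and the term has the opposite sign, so
  -- the replacement goes the other way (`l₂`).
  have l₁ : s / (s ^ 2 + a ζ ^ 2) * (1 / s * (secondDirDeriv α e₁ ζ + secondDirDeriv β e₁ ζ) -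
      w₁ ζ * (1 / s * (fderiv ℝ α ζ (e₂ ζ) + fderiv ℝ α ζ (e₂ ζ)))) ≤
      2 * (secondDirDeriv β e₁ ζ - w₁ ζ * fderiv ℝ α ζ (e₂ ζ)) / (s ^ 2 + a ζ ^ 2) := by
    rw [div_mul_eq_mul_div, div_le_div_iff_of_pos_right hA]
    field_simp
    linarith
  have l₂ : 2 * (secondDirDeriv α e₂ ζ + w₂ ζ * fderiv ℝ β ζ (e₁ ζ)) / (s ^ 2 + b ζ ^ 2) ≤
      s / (s ^ 2 + b ζ ^ 2) * (1 / s * (secondDirDeriv α e₂ ζ + secondDirDeriv β e₂ ζ) +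
      w₂ ζ * (1 / s * (fderiv ℝ β ζ (e₁ ζ) + fderiv ℝ β ζ (e₁ ζ)))) := by
    rw [div_mul_eq_mul_div, div_le_div_iff_of_pos_right hB]
    field_simp
    linarith
  exact sub_le_sub l₁ l₂

end AngleDifference

/-! ### Trace and determinant of one bilinear form relative to another -/

section RelativeInvariants

variable {V : Type*}

/-- The Gram determinant of `u₁, u₂`, for a not necessarily symmetric form. -/
def pairDet (g : V → V → ℝ) (u₁ u₂ : V) : ℝ := g u₁ u₁ * g u₂ u₂ - g u₁ u₂ * g u₂ u₁

/-- The trace of `g⁻¹ h`, computed in the basis `u₁, u₂`. -/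
def relTrace (g h : V → V → ℝ) (u₁ u₂ : V) : ℝ :=
  (g u₂ u₂ * h u₁ u₁ - g u₁ u₂ * h u₂ u₁ - g u₂ u₁ * h u₁ u₂ + g u₁ u₁ * h u₂ u₂) /
    pairDet g u₁ u₂

/-- The determinant of `g⁻¹ h`, computed in the basis `u₁, u₂`. -/
def relDet (g h : V → V → ℝ) (u₁ u₂ : V) : ℝ := pairDet h u₁ u₂ / pairDet g u₁ u₂

theorem pairDet_comb [AddCommGroup V] [Module ℝ V] (g : V →ₗ[ℝ] V →ₗ[ℝ] ℝ) (u₁ u₂ : V)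
    (p q r s : ℝ) :
    pairDet (fun u v => g u v) (p • u₁ + q • u₂) (r • u₁ + s • u₂) =
      (p * s - q * r) ^ 2 * pairDet (fun u v => g u v) u₁ u₂ := by
  simp only [pairDet, map_add, map_smul, LinearMap.add_apply, LinearMap.smul_apply, smul_eq_mul]
  ring

/-- Both Gram determinants scale by the same squared base-change determinant. Coordinate bases can
therefore be exchanged for principal ones. -/
theorem relDet_comb [AddCommGroup V] [Module ℝ V] (g h : V →ₗ[ℝ] V →ₗ[ℝ] ℝ) (u₁ u₂ : V)
    {p q r s : ℝ} (hd : p * s - q * r ≠ 0) :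
    relDet (fun u v => g u v) (fun u v => h u v) (p • u₁ + q • u₂) (r • u₁ + s • u₂) =
      relDet (fun u v => g u v) (fun u v => h u v) u₁ u₂ := by
  rw [relDet, relDet, pairDet_comb, pairDet_comb, mul_div_mul_left _ _ (pow_ne_zero 2 hd)]

theorem relTrace_comb [AddCommGroup V] [Module ℝ V] (g h : V →ₗ[ℝ] V →ₗ[ℝ] ℝ) (u₁ u₂ : V)
    {p q r s : ℝ} (hd : p * s - q * r ≠ 0) :
    relTrace (fun u v => g u v) (fun u v => h u v) (p • u₁ + q • u₂) (r • u₁ + s • u₂) =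
      relTrace (fun u v => g u v) (fun u v => h u v) u₁ u₂ := by
  rw [relTrace, relTrace, pairDet_comb]
  conv_rhs => rw [← mul_div_mul_left _ _ (pow_ne_zero 2 hd)]
  congr 1
  simp only [map_add, map_smul, LinearMap.add_apply, LinearMap.smul_apply, smul_eq_mul]
  ring

variable {Z : Type*} [NormedAddCommGroup Z] [NormedSpace ℝ Z]

/-- First variation of `tr (g⁻¹ h)` and `det (g⁻¹ h)` in an orthonormal eigenbasis. -/
theorem fderiv_relTrace_relDet {g h : Z → V → V → ℝ} {u₁ u₂ : V} {ζ : Z} {a b : ℝ}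
    (hg : ∀ u v, DifferentiableAt ℝ (fun y => g y u v) ζ)
    (hh : ∀ u v, DifferentiableAt ℝ (fun y => h y u v) ζ)
    (g₁₁ : g ζ u₁ u₁ = 1) (g₂₂ : g ζ u₂ u₂ = 1) (g₁₂ : g ζ u₁ u₂ = 0) (g₂₁ : g ζ u₂ u₁ = 0)
    (h₁₁ : h ζ u₁ u₁ = a) (h₂₂ : h ζ u₂ u₂ = b) (h₁₂ : h ζ u₁ u₂ = 0) (h₂₁ : h ζ u₂ u₁ = 0)
    (ξ : Z) :
    fderiv ℝ (fun y => relTrace (g y) (h y) u₁ u₂) ζ ξ =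
        (fderiv ℝ (fun y => h y u₁ u₁) ζ ξ - a * fderiv ℝ (fun y => g y u₁ u₁) ζ ξ) +
        (fderiv ℝ (fun y => h y u₂ u₂) ζ ξ - b * fderiv ℝ (fun y => g y u₂ u₂) ζ ξ) ∧
    fderiv ℝ (fun y => relDet (g y) (h y) u₁ u₂) ζ ξ =
        b * (fderiv ℝ (fun y => h y u₁ u₁) ζ ξ - a * fderiv ℝ (fun y => g y u₁ u₁) ζ ξ) +
        a * (fderiv ℝ (fun y => h y u₂ u₂) ζ ξ - b * fderiv ℝ (fun y => g y u₂ u₂) ζ ξ) := by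
  have H := fun u v => (hh u v).hasFDerivAt
  have K := fun u v => (hg u v).hasFDerivAt
  have D := ((K u₁ u₁).fun_mul (K u₂ u₂)).fun_sub ((K u₁ u₂).fun_mul (K u₂ u₁))
  have hD : g ζ u₁ u₁ * g ζ u₂ u₂ - g ζ u₁ u₂ * g ζ u₂ u₁ = 1 := by
    rw [g₁₁, g₂₂, g₁₂]; ring
  have hD0 : g ζ u₁ u₁ * g ζ u₂ u₂ - g ζ u₁ u₂ * g ζ u₂ u₁ ≠ 0 := by rw [hD]; exact one_ne_zero
  have I := (hasDerivAt_inv hD0).comp_hasFDerivAt ζ D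
  have T := (((K u₂ u₂).fun_mul (H u₁ u₁)).fun_sub ((K u₁ u₂).fun_mul (H u₂ u₁))).fun_sub
    ((K u₂ u₁).fun_mul (H u₁ u₂)) |>.fun_add ((K u₁ u₁).fun_mul (H u₂ u₂))
  have S := ((H u₁ u₁).fun_mul (H u₂ u₂)).fun_sub ((H u₁ u₂).fun_mul (H u₂ u₁))
  have RT := (T.fun_mul I).fderiv
  have RS := (S.fun_mul I).fderiv
  constructor
  · rw [show (fun y => relTrace (g y) (h y) u₁ u₂) = _ from
      funext fun y => div_eq_mul_inv _ _]
    refine (congrArg (fun L => L ξ) RT).trans ?_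
    simp [g₁₁, g₂₂, g₁₂, g₂₁, h₁₁, h₂₂, h₁₂, h₂₁]
    ring
  · rw [show (fun y => relDet (g y) (h y) u₁ u₂) = _ from
      funext fun y => div_eq_mul_inv _ _]
    refine (congrArg (fun L => L ξ) RS).trans ?_
    simp [g₁₁, g₂₂, g₁₂, g₂₁, h₁₁, h₂₂, h₁₂, h₂₁]
    ring

end RelativeInvariants

/-! ### Normal motion in coordinates -/

section LocalFlow

variable {E : Type*} [NormedAddCommGroup E] [NormedSpace ℝ E]
  {V : Type*} [NormedAddCommGroup V] [NormedSpace ℝ V]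

/-- `f` moves with velocity `φ ν`, where `ν` is a timelike unit normal of the spacelike immersions
`f(·, t)`, and all data are smooth on the open set `O` of space-time. -/
structure IsLocalFlow (Ω : Set E) (B : E → E →L[ℝ] E →L[ℝ] ℝ) (O : Set (V × ℝ))
    (f ν : V × ℝ → E) (φ : V × ℝ → ℝ) : Prop where
  isOpen : IsOpen O
  maps : ∀ ζ ∈ O, f ζ ∈ Ω
  smooth_f : ContDiffOn ℝ ∞ f O
  smooth_ν : ContDiffOn ℝ ∞ ν O
  smooth_φ : ContDiffOn ℝ ∞ φ O
  spacelike : ∀ ζ ∈ O, ∀ u : V, u ≠ 0 → 0 < B (f ζ) (fderiv ℝ f ζ (u, 0)) (fderiv ℝ f ζ (u, 0))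
  normal : ∀ ζ ∈ O, ∀ u : V, B (f ζ) (fderiv ℝ f ζ (u, 0)) (ν ζ) = 0
  unit : ∀ ζ ∈ O, B (f ζ) (ν ζ) (ν ζ) = -1
  evolution : ∀ ζ ∈ O, fderiv ℝ f ζ (0, 1) = φ ζ • ν ζ

/-- The first fundamental form of `f(·, t)`. -/
def fstForm (B : E → E →L[ℝ] E →L[ℝ] ℝ) (f : V × ℝ → E) (ζ : V × ℝ) (u v : V) : ℝ :=
  B (f ζ) (fderiv ℝ f ζ (u, 0)) (fderiv ℝ f ζ (v, 0))

/-- The second fundamental form of `f(·, t)`. -/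
def sndForm (B : E → E →L[ℝ] E →L[ℝ] ℝ) (Γ : E → E →L[ℝ] E →L[ℝ] E) (f ν : V × ℝ → E)
    (ζ : V × ℝ) (u v : V) : ℝ :=
  B (f ζ) (cov Γ f ν ζ (u, 0)) (fderiv ℝ f ζ (v, 0))

variable {Ω : Set E} {B : E → E →L[ℝ] E →L[ℝ] ℝ} {Γ : E → E →L[ℝ] E →L[ℝ] E}
  {O : Set (V × ℝ)} {f ν : V × ℝ → E} {φ : V × ℝ → ℝ}

namespace IsLocalFlow

theorem smooth_dir (F : IsLocalFlow Ω B O f ν φ) (ξ : V × ℝ) :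
    ContDiffOn ℝ ∞ (fun ζ => fderiv ℝ f ζ ξ) O :=
  contDiffOn_fderiv_apply F.isOpen F.smooth_f contDiffOn_const

theorem differentiableAt (F : IsLocalFlow Ω B O f ν φ) {X : Type*} [NormedAddCommGroup X]
    [NormedSpace ℝ X] {q : V × ℝ → X} (hq : ContDiffOn ℝ ∞ q O) {ζ : V × ℝ} (hζ : ζ ∈ O) :
    DifferentiableAt ℝ q ζ :=
  (hq.contDiffAt (F.isOpen.mem_nhds hζ)).differentiableAt (by simp)

theorem smooth_fstForm (F : IsLocalFlow Ω B O f ν φ) (h : IsLeviCivita Ω B Γ) (u v : V) :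
    ContDiffOn ℝ ∞ (fun ζ => fstForm B f ζ u v) O :=
  h.contDiffOn_inner F.smooth_f F.maps (F.smooth_dir _) (F.smooth_dir _)

theorem smooth_sndForm (F : IsLocalFlow Ω B O f ν φ) (h : IsLeviCivita Ω B Γ) (u v : V) :
    ContDiffOn ℝ ∞ (fun ζ => sndForm B Γ f ν ζ u v) O :=
  h.contDiffOn_inner F.smooth_f F.maps
    (h.contDiffOn_cov F.isOpen F.smooth_f F.maps F.smooth_ν contDiffOn_const) (F.smooth_dir _)

/-- Constant fields have zero bracket, so the torsion identity is a symmetry. -/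
theorem cov_comm (F : IsLocalFlow Ω B O f ν φ) (h : IsLeviCivita Ω B Γ) {ζ : V × ℝ}
    (hζ : ζ ∈ O) (ξ η : V × ℝ) :
    cov Γ f (fun y => fderiv ℝ f y η) ζ ξ = cov Γ f (fun y => fderiv ℝ f y ξ) ζ η := by
  have := h.cov_torsion F.isOpen F.smooth_f F.maps (contDiffOn_const (c := ξ))
    (contDiffOn_const (c := η)) hζ
  simpa [bracket, sub_eq_zero] using this

theorem cov_normal_inner (F : IsLocalFlow Ω B O f ν φ) (h : IsLeviCivita Ω B Γ) {ζ : V × ℝ}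
    (hζ : ζ ∈ O) (ξ : V × ℝ) : B (f ζ) (cov Γ f ν ζ ξ) (ν ζ) = 0 := by
  have := h.inner_cov_of_const F.isOpen F.smooth_f F.maps F.smooth_ν F.smooth_ν F.unit hζ ξ
  rw [h.metric_symm _ (F.maps ζ hζ) (ν ζ)] at this
  linarith

/-- Space and time directions commute, and the velocity `φ ν` is differentiated by the Leibniz rule.
-/
theorem cov_dir_time (F : IsLocalFlow Ω B O f ν φ) (h : IsLeviCivita Ω B Γ) {ζ : V × ℝ}
    (hζ : ζ ∈ O) (u : V) :
    cov Γ f (fun y => fderiv ℝ f y (u, 0)) ζ (0, 1) =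
      fderiv ℝ φ ζ (u, 0) • ν ζ + φ ζ • cov Γ f ν ζ (u, 0) := by
  rw [F.cov_comm h hζ]
  have : (fun y => fderiv ℝ f y (0, 1)) =ᶠ[nhds ζ] fun y => φ y • ν y := by
    filter_upwards [F.isOpen.mem_nhds hζ] with y hy using F.evolution y hy
  rw [cov_congr this, cov_smul (F.differentiableAt F.smooth_φ hζ)
    (F.differentiableAt F.smooth_ν hζ)]

theorem sndForm_eq (F : IsLocalFlow Ω B O f ν φ) (h : IsLeviCivita Ω B Γ) {ζ : V × ℝ}
    (hζ : ζ ∈ O) (u v : V) : sndForm B Γ f ν ζ u v =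
      -B (f ζ) (cov Γ f (fun y => fderiv ℝ f y (v, 0)) ζ (u, 0)) (ν ζ) := by
  have := h.inner_cov_of_const F.isOpen F.smooth_f F.maps (F.smooth_dir (v, 0)) F.smooth_ν
    (fun y hy => F.normal y hy v) hζ (u, 0)
  rw [this, neg_neg, h.metric_symm _ (F.maps ζ hζ), sndForm]

theorem sndForm_symm (F : IsLocalFlow Ω B O f ν φ) (h : IsLeviCivita Ω B Γ) {ζ : V × ℝ}
    (hζ : ζ ∈ O) (u v : V) : sndForm B Γ f ν ζ u v = sndForm B Γ f ν ζ v u := by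
  rw [F.sndForm_eq h hζ, F.sndForm_eq h hζ, F.cov_comm h hζ]

/-- `∂_t g = 2 φ h`. -/
theorem fderiv_fstForm (F : IsLocalFlow Ω B O f ν φ) (h : IsLeviCivita Ω B Γ) {ζ : V × ℝ}
    (hζ : ζ ∈ O) (u v : V) :
    fderiv ℝ (fun y => fstForm B f y u v) ζ (0, 1) = 2 * φ ζ * sndForm B Γ f ν ζ u v := by
  have := h.fderiv_inner (F.maps ζ hζ) (F.differentiableAt F.smooth_f hζ)
    (F.differentiableAt (F.smooth_dir (u, 0)) hζ) (F.differentiableAt (F.smooth_dir (v, 0)) hζ)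
    (0, 1)
  have hn := h.metric_symm _ (F.maps ζ hζ)
  unfold fstForm
  rw [this, F.cov_dir_time h hζ, F.cov_dir_time h hζ]
  simp only [map_add, map_smul, add_apply, smul_apply, smul_eq_mul]
  rw [hn (ν ζ), F.normal ζ hζ, F.normal ζ hζ, hn (fderiv ℝ f ζ (u, 0))]
  have := F.sndForm_symm h hζ u v
  simp only [sndForm] at this ⊢
  linear_combination -φ ζ * this

/-- `D_t ν` is the spatial gradient of `φ`. -/
theorem inner_cov_time_normal (F : IsLocalFlow Ω B O f ν φ) (h : IsLeviCivita Ω B Γ)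
    {ζ : V × ℝ} (hζ : ζ ∈ O) (u : V) :
    B (f ζ) (cov Γ f ν ζ (0, 1)) (fderiv ℝ f ζ (u, 0)) = fderiv ℝ φ ζ (u, 0) := by
  have := h.inner_cov_of_const F.isOpen F.smooth_f F.maps (F.smooth_dir (u, 0)) F.smooth_ν
    (fun y hy => F.normal y hy u) hζ (0, 1)
  rw [F.cov_dir_time h hζ] at this
  simp only [map_add, map_smul, add_apply, smul_apply, smul_eq_mul, F.unit ζ hζ,
    F.cov_normal_inner h hζ] at this
  rw [h.metric_symm _ (F.maps ζ hζ)]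
  linarith

/-- The spatial Hessian `∇²φ(u, u)` of `φ` with respect to the induced metric. -/
def hessian (B : E → E →L[ℝ] E →L[ℝ] ℝ) (Γ : E → E →L[ℝ] E →L[ℝ] E) (f ν : V × ℝ → E)
    (φ : V × ℝ → ℝ) (ζ : V × ℝ) (u : V) : ℝ :=
  fderiv ℝ (fderiv ℝ φ) ζ (u, 0) (u, 0) -
    B (f ζ) (cov Γ f ν ζ (0, 1)) (cov Γ f (fun y => fderiv ℝ f y (u, 0)) ζ (u, 0))

/-- `∂_t h = ∇²φ + φ h² + c φ g`. -/
theorem fderiv_sndForm (F : IsLocalFlow Ω B O f ν φ) (h : IsLeviCivita Ω B Γ) {c : ℝ}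
    (hc : HasConstantCurvature Ω B Γ c) {ζ : V × ℝ} (hζ : ζ ∈ O) (u : V) :
    fderiv ℝ (fun y => sndForm B Γ f ν y u u) ζ (0, 1) = hessian B Γ f ν φ ζ u +
      φ ζ * B (f ζ) (cov Γ f ν ζ (u, 0)) (cov Γ f ν ζ (u, 0)) + c * φ ζ * fstForm B f ζ u u := by
  have sN : ∀ ξ : V × ℝ, ContDiffOn ℝ ∞ (fun y => cov Γ f ν y ξ) O := fun ξ =>
    h.contDiffOn_cov F.isOpen F.smooth_f F.maps F.smooth_ν contDiffOn_const
  have k₁ := h.fderiv_inner (F.maps ζ hζ) (F.differentiableAt F.smooth_f hζ)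
    (F.differentiableAt (sN (u, 0)) hζ) (F.differentiableAt (F.smooth_dir (u, 0)) hζ) (0, 1)
  have k₂ := h.cov_cov_sub F.isOpen F.smooth_f F.maps F.smooth_ν
    (contDiffOn_const (c := ((0, 1) : V × ℝ))) (contDiffOn_const (c := ((u, 0) : V × ℝ))) hζ
  have hb : bracket (fun _ : V × ℝ => ((0, 1) : V × ℝ)) (fun _ => (u, 0)) ζ = 0 := by
    simp [bracket]
  have hz : cov Γ f ν ζ 0 = 0 := by simp [cov]
  -- The normal is orthogonal to the tangent vector, so of the curvature term only `-c B(φν, ν)`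
  -- times the tangent vector, that is `c φ` times it, survives.
  rw [hb, hz, sub_zero, hc _ (F.maps ζ hζ), F.normal ζ hζ, F.evolution ζ hζ] at k₂
  simp only [map_smul, smul_apply, smul_eq_mul, F.unit ζ hζ] at k₂
  have k₃ := h.fderiv_inner (F.maps ζ hζ) (F.differentiableAt F.smooth_f hζ)
    (F.differentiableAt (sN (0, 1)) hζ) (F.differentiableAt (F.smooth_dir (u, 0)) hζ) (u, 0)
  -- Differentiating `⟨Dₜν, ∂ᵤf⟩ = ∂ᵤφ` along `u` is what produces the Hessian of `φ`.
  have k₄ : (fun y => B (f y) (cov Γ f ν y (0, 1)) (fderiv ℝ f y (u, 0))) =ᶠ[nhds ζ]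
      fun y => fderiv ℝ φ y (u, 0) := by
    filter_upwards [F.isOpen.mem_nhds hζ] with y hy using F.inner_cov_time_normal h hy u
  rw [k₄.fderiv_eq, fderiv_fderiv_apply F.isOpen F.smooth_φ contDiffOn_const hζ] at k₃
  unfold sndForm
  rw [k₁, sub_eq_iff_eq_add.1 k₂, F.cov_dir_time h hζ]
  simp only [hessian, fstForm, map_add, map_smul, map_sub, add_apply, smul_apply, sub_apply,
    smul_eq_mul, F.cov_normal_inner h hζ, fderiv_fun_const, Pi.zero_apply, zero_apply,
    map_zero] at k₃ ⊢
  linear_combination -k₃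

end IsLocalFlow

end LocalFlow

/-! ### The angle functions of the principal curvatures -/

section AngleFunctions

/-- `arctan (a / s) + arctan (b / s)` in terms of `H = a + b` and `K = a b`. -/
def angleSum (s H K : ℝ) : ℝ := (Complex.log (⟨s ^ 2 - K, s * H⟩ : ℂ)).im

/-- `cos (arctan (a / s) - arctan (b / s))` in terms of `H = a + b` and `K = a b`. -/
def cosAngleDiff (s H K : ℝ) : ℝ := (s ^ 2 + K) / √((s ^ 2 - K) ^ 2 + s ^ 2 * H ^ 2)

/-- Off the slit unless `H = 0`, and then `K ≤ 0` makes the real part positive. The hypothesis is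
non-negativity of the discriminant, true for real principal curvatures. -/
theorem mem_slitPlane_of_le {s H K : ℝ} (hs : 0 < s) (h : 4 * K ≤ H ^ 2) :
    (⟨s ^ 2 - K, s * H⟩ : ℂ) ∈ Complex.slitPlane := by
  rw [Complex.mem_slitPlane_iff]
  by_cases hH : H = 0
  · left
    simp only [hH] at h ⊢
    nlinarith [sq_nonneg s, pow_pos hs 2]
  · right
    exact mul_ne_zero hs.ne' hH

/-- The complex number is `(s + ia)(s + ib)`, a positive multiple of `exp (i(α + β))`. A sum of two
arctangents lies in `(-π, π)`, so its principal argument is that sum. -/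
theorem angleSum_eq {s : ℝ} (hs : 0 < s) (a b : ℝ) :
    angleSum s (a + b) (a * b) = Real.arctan (a / s) + Real.arctan (b / s) := by
  set α := Real.arctan (a / s)
  set β := Real.arctan (b / s)
  have hα := Real.cos_arctan_pos (a / s)
  have hβ := Real.cos_arctan_pos (b / s)
  have e₁ : Real.sin α * s = a * Real.cos α := by
    have : Real.tan α = a / s := Real.tan_arctan _
    rw [Real.tan_eq_sin_div_cos, div_eq_div_iff hα.ne' hs.ne'] at this
    exact this
  have e₂ : Real.sin β * s = b * Real.cos β := by
    have : Real.tan β = b / s := Real.tan_arctan _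
    rw [Real.tan_eq_sin_div_cos, div_eq_div_iff hβ.ne' hs.ne'] at this
    exact this
  have hr : 0 < s ^ 2 / (Real.cos α * Real.cos β) := by positivity
  have hz : (⟨s ^ 2 - a * b, s * (a + b)⟩ : ℂ) =
      ((s ^ 2 / (Real.cos α * Real.cos β) : ℝ) : ℂ) *
        (Complex.cos (α + β : ℝ) + Complex.sin (α + β : ℝ) * Complex.I) := by
    rw [← Complex.ofReal_cos, ← Complex.ofReal_sin]
    have hcα : Real.cos α ≠ 0 := hα.ne'
    have hcβ : Real.cos β ≠ 0 := hβ.ne'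
    apply Complex.ext
    · simp only [Complex.mul_re, Complex.add_re, Complex.ofReal_re, Complex.ofReal_im,
        Complex.I_re, Complex.I_im, Complex.add_im, Complex.mul_im]
      rw [Real.cos_add]
      field_simp
      linear_combination Real.sin β * s * e₁ + a * Real.cos α * e₂
    · simp only [Complex.mul_im, Complex.add_re, Complex.ofReal_re, Complex.ofReal_im,
        Complex.I_re, Complex.I_im, Complex.add_im, Complex.mul_re]
      rw [Real.sin_add]
      field_simp
      linear_combination -s * Real.cos β * e₁ - s * Real.cos α * e₂
  rw [angleSum, Complex.log_im, hz, Complex.arg_mul_cos_add_sin_mul_I hr]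
  have b₁ := Real.neg_pi_div_two_lt_arctan (a / s)
  have b₂ := Real.neg_pi_div_two_lt_arctan (b / s)
  have b₃ := Real.arctan_lt_pi_div_two (a / s)
  have b₄ := Real.arctan_lt_pi_div_two (b / s)
  exact ⟨by linarith, by linarith⟩

/-- The squared modulus of `(s + ia)(s + ib)`, computed in two ways. -/
theorem cosAngleDiff_radicand (s a b : ℝ) :
    (s ^ 2 - a * b) ^ 2 + s ^ 2 * (a + b) ^ 2 = (s ^ 2 + a ^ 2) * (s ^ 2 + b ^ 2) := by ring

theorem cosAngleDiff_eq {s : ℝ} (hs : 0 < s) (a b : ℝ) :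
    cosAngleDiff s (a + b) (a * b) =
      Real.cos (Real.arctan (a / s) - Real.arctan (b / s)) := by
  rw [cosAngleDiff, cosAngleDiff_radicand, Real.cos_sub, Real.cos_arctan, Real.cos_arctan,
    Real.sin_arctan, Real.sin_arctan]
  have h : ∀ x : ℝ, √(1 + (x / s) ^ 2) = √(s ^ 2 + x ^ 2) / s := fun x => by
    rw [show 1 + (x / s) ^ 2 = (s ^ 2 + x ^ 2) / s ^ 2 by field_simp,
      Real.sqrt_div (by positivity), Real.sqrt_sq hs.le]
  rw [h, h, Real.sqrt_mul (by positivity)]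
  have : 0 < √(s ^ 2 + a ^ 2) := Real.sqrt_pos.2 (by positivity)
  have : 0 < √(s ^ 2 + b ^ 2) := Real.sqrt_pos.2 (by positivity)
  field_simp

variable {Z : Type*} [NormedAddCommGroup Z] [NormedSpace ℝ Z] {O : Set Z} {H K : Z → ℝ}

theorem contDiffOn_angleSum {s : ℝ} (hs : 0 < s) (hH : ContDiffOn ℝ ∞ H O)
    (hK : ContDiffOn ℝ ∞ K O) (hHK : ∀ ζ ∈ O, 4 * K ζ ≤ H ζ ^ 2) :
    ContDiffOn ℝ ∞ (fun ζ => angleSum s (H ζ) (K ζ)) O := by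
  have hz : ContDiffOn ℝ ∞ (fun ζ => (⟨s ^ 2 - K ζ, s * H ζ⟩ : ℂ)) O :=
    Complex.equivRealProdCLM.symm.contDiff.comp_contDiffOn
      ((contDiffOn_const.sub hK).prodMk (contDiffOn_const.mul hH))
  intro ζ hζ
  have h1 : ContDiffAt ℝ ∞ Complex.log (⟨s ^ 2 - K ζ, s * H ζ⟩ : ℂ) :=
    (Complex.contDiffAt_log (mem_slitPlane_of_le hs (hHK ζ hζ))).restrict_scalars ℝ
  exact Complex.imCLM.contDiff.contDiffAt.comp_contDiffWithinAt ζ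
    (h1.comp_contDiffWithinAt ζ (hz ζ hζ))

theorem contDiffOn_cosAngleDiff {s : ℝ} (hs : 0 < s) (hH : ContDiffOn ℝ ∞ H O)
    (hK : ContDiffOn ℝ ∞ K O) (hHK : ∀ ζ ∈ O, 4 * K ζ ≤ H ζ ^ 2) :
    ContDiffOn ℝ ∞ (fun ζ => cosAngleDiff s (H ζ) (K ζ)) O := by
  have hpos : ∀ ζ ∈ O, 0 < (s ^ 2 - K ζ) ^ 2 + s ^ 2 * H ζ ^ 2 := fun ζ hζ => by
    have := hHK ζ hζ
    nlinarith [sq_nonneg (s ^ 2 + K ζ), pow_pos hs 2, pow_pos hs 4, mul_le_mul_of_nonneg_left this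
      (sq_nonneg s), sq_nonneg (s ^ 2 - K ζ), mul_nonneg (sq_nonneg s) (sq_nonneg (H ζ))]
  refine (contDiffOn_const.add hK).div ?_ fun ζ hζ => (Real.sqrt_pos.2 (hpos ζ hζ)).ne'
  exact (((contDiffOn_const.sub hK).pow 2).add (contDiffOn_const.mul (hH.pow 2))).sqrt
    fun ζ hζ => (hpos ζ hζ).ne'

theorem fderiv_angleSum {s : ℝ} (hs : 0 < s) {ζ : Z} (hH : DifferentiableAt ℝ H ζ)
    (hK : DifferentiableAt ℝ K ζ) (hHK : 4 * K ζ ≤ H ζ ^ 2) (ξ : Z) :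
    fderiv ℝ (fun y => angleSum s (H y) (K y)) ζ ξ =
      (s * (s ^ 2 - K ζ) * fderiv ℝ H ζ ξ + s * H ζ * fderiv ℝ K ζ ξ) /
        ((s ^ 2 - K ζ) ^ 2 + s ^ 2 * H ζ ^ 2) := by
  have hz := Complex.equivRealProdCLM.symm.hasFDerivAt.comp ζ
    ((hK.hasFDerivAt.const_sub (s ^ 2)).prodMk (hH.hasFDerivAt.const_mul s))
  have hl := (Complex.hasStrictFDerivAt_log_real (mem_slitPlane_of_le hs hHK)).hasFDerivAt
  have := Complex.imCLM.hasFDerivAt.comp ζ (hl.comp ζ hz)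
  refine (congrArg (fun L => L ξ) this.fderiv).trans ?_
  have he : ∀ p : ℝ × ℝ, Complex.equivRealProdCLM.symm p = ⟨p.1, p.2⟩ := fun _ => rfl
  simp [Complex.inv_im, Complex.inv_re, Complex.normSq_apply, he]
  ring

theorem fderiv_cosAngleDiff {s : ℝ} {ζ : Z} (hH : DifferentiableAt ℝ H ζ)
    (hK : DifferentiableAt ℝ K ζ) (hpos : 0 < (s ^ 2 - K ζ) ^ 2 + s ^ 2 * H ζ ^ 2) (ξ : Z) :
    √((s ^ 2 - K ζ) ^ 2 + s ^ 2 * H ζ ^ 2) ^ 3 *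
      fderiv ℝ (fun y => cosAngleDiff s (H y) (K y)) ζ ξ =
      ((s ^ 2 - K ζ) ^ 2 + s ^ 2 * H ζ ^ 2) * fderiv ℝ K ζ ξ +
        (s ^ 2 + K ζ) * ((s ^ 2 - K ζ) * fderiv ℝ K ζ ξ - s ^ 2 * H ζ * fderiv ℝ H ζ ξ) := by
  have h₁ := hK.hasFDerivAt.const_add (s ^ 2)
  have h₂ := (((hK.hasFDerivAt.const_sub (s ^ 2)).pow 2).fun_add
    ((hH.hasFDerivAt.pow 2).const_mul (s ^ 2))).sqrt hpos.ne'
  have hne : √((s ^ 2 - K ζ) ^ 2 + s ^ 2 * H ζ ^ 2) ≠ 0 := (Real.sqrt_pos.2 hpos).ne'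
  have h₃ := (hasDerivAt_inv hne).comp_hasFDerivAt ζ h₂
  have h₄ := (h₁.fun_mul h₃).fderiv
  rw [show (fun y => cosAngleDiff s (H y) (K y)) = _ from funext fun y => div_eq_mul_inv _ _]
  have h₅ : fderiv ℝ (fun y => (s ^ 2 + K y) * (√((s ^ 2 - K y) ^ 2 + s ^ 2 * H y ^ 2))⁻¹) ζ ξ =
    _ := congrArg (fun L => L ξ) h₄
  rw [h₅]
  simp
  set r := √((s ^ 2 - K ζ) ^ 2 + s ^ 2 * H ζ ^ 2) with hr
  have hr2 : (s ^ 2 - K ζ) ^ 2 + s ^ 2 * H ζ ^ 2 = r ^ 2 := (Real.sq_sqrt hpos.le).symm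
  rw [hr2]
  field_simp
  ring

end AngleFunctions

/-! ### Principal bases at a point -/

section PrincipalBasis

/-- The standard basis vectors of the plane. -/
abbrev stdVec (i : Fin 2) : EuclideanSpace ℝ (Fin 2) := EuclideanSpace.single i 1

theorem eq_stdVec_comb (u : EuclideanSpace ℝ (Fin 2)) :
    u = u 0 • stdVec 0 + u 1 • stdVec 1 := by
  ext i
  fin_cases i <;> simp [stdVec]

/-- Gram-Schmidt for `g`, then a rotation by half the argument of `(h₁₁ - h₂₂) + 2i h₁₂`. The
rotated diagonal entries differ by the modulus of that number, which gives their order. -/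
theorem exists_orthonormal_diagonal
    (g h : EuclideanSpace ℝ (Fin 2) →ₗ[ℝ] EuclideanSpace ℝ (Fin 2) →ₗ[ℝ] ℝ)
    (gsymm : ∀ u v, g u v = g v u) (hsymm : ∀ u v, h u v = h v u)
    (gpos : ∀ u, u ≠ 0 → 0 < g u u) :
    ∃ u₁ u₂, g u₁ u₁ = 1 ∧ g u₂ u₂ = 1 ∧ g u₁ u₂ = 0 ∧ h u₁ u₂ = 0 ∧ h u₂ u₂ ≤ h u₁ u₁ := by
  obtain ⟨v₁, v₂, n₁, n₂, n₁₂⟩ : ∃ v₁ v₂, g v₁ v₁ = 1 ∧ g v₂ v₂ = 1 ∧ g v₁ v₂ = 0 := by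
    have p₁ : 0 < g (stdVec 0) (stdVec 0) := gpos _ (by simp [stdVec])
    set w := stdVec 1 - (g (stdVec 0) (stdVec 1) / g (stdVec 0) (stdVec 0)) • stdVec 0 with hw
    have p₂ : 0 < g w w := gpos w fun h0 => by
      have := congrArg (fun x : EuclideanSpace ℝ (Fin 2) => x 1) h0
      simp [hw, stdVec] at this
    have o : g (stdVec 0) w = 0 := by
      simp only [hw, map_sub, map_smul, smul_eq_mul]
      field_simp
      ring
    have key : ∀ x, 0 < x → (√x)⁻¹ * ((√x)⁻¹ * x) = 1 := fun x hx => by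
      have := Real.sqrt_pos.2 hx
      field_simp
      exact (Real.sq_sqrt hx.le).symm
    refine ⟨(√(g (stdVec 0) (stdVec 0)))⁻¹ • stdVec 0, (√(g w w))⁻¹ • w, ?_, ?_, ?_⟩
    · simpa only [map_smul, LinearMap.smul_apply, smul_eq_mul] using key _ p₁
    · simpa only [map_smul, LinearMap.smul_apply, smul_eq_mul] using key _ p₂
    · simp [o]
  set z : ℂ := ⟨h v₁ v₁ - h v₂ v₂, 2 * h v₁ v₂⟩ with hz
  set τ := z.arg / 2 with hτ
  have hc : ‖z‖ * (Real.cos τ ^ 2 - Real.sin τ ^ 2) = h v₁ v₁ - h v₂ v₂ := by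
    have := Complex.norm_mul_cos_arg z
    rwa [show z.arg = 2 * τ by rw [hτ]; ring, Real.cos_two_mul'] at this
  have hs : ‖z‖ * (2 * Real.sin τ * Real.cos τ) = 2 * h v₁ v₂ := by
    have := Complex.norm_mul_sin_arg z
    rwa [show z.arg = 2 * τ by rw [hτ]; ring, Real.sin_two_mul] at this
  have hcs := Real.sin_sq_add_cos_sq τ
  refine ⟨Real.cos τ • v₁ + Real.sin τ • v₂, -Real.sin τ • v₁ + Real.cos τ • v₂,
    ?_, ?_, ?_, ?_, ?_⟩
  all_goals
    simp only [map_add, map_smul, LinearMap.add_apply, LinearMap.smul_apply, smul_eq_mul, n₁, n₂,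
      n₁₂, gsymm v₂ v₁, hsymm v₂ v₁]
  · linear_combination hcs
  · linear_combination hcs
  · ring
  · linear_combination (Real.cos τ * Real.sin τ) * hc -
      (Real.cos τ ^ 2 - Real.sin τ ^ 2) / 2 * hs
  · have e : (Real.cos τ * (Real.cos τ * h v₁ v₁ + Real.sin τ * h v₁ v₂) +
        Real.sin τ * (Real.cos τ * h v₁ v₂ + Real.sin τ * h v₂ v₂)) -
        (-Real.sin τ * (-Real.sin τ * h v₁ v₁ + Real.cos τ * h v₁ v₂) +
        Real.cos τ * (-Real.sin τ * h v₁ v₂ + Real.cos τ * h v₂ v₂)) = ‖z‖ := by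
      linear_combination -(Real.cos τ ^ 2 - Real.sin τ ^ 2) * hc -
        (2 * Real.sin τ * Real.cos τ) * hs +
        ‖z‖ * (Real.sin τ ^ 2 + Real.cos τ ^ 2 + 1) * hcs
    have := norm_nonneg z
    linarith

end PrincipalBasis

/-! ### Evolution of the angles along a local flow -/

section LocalEvolution

variable {E : Type*} [NormedAddCommGroup E] [NormedSpace ℝ E]
  {Ω : Set E} {B : E → E →L[ℝ] E →L[ℝ] ℝ} {Γ : E → E →L[ℝ] E →L[ℝ] E}
  {O : Set (EuclideanSpace ℝ (Fin 2) × ℝ)} {f ν : EuclideanSpace ℝ (Fin 2) × ℝ → E}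
  {φ : EuclideanSpace ℝ (Fin 2) × ℝ → ℝ}

/-- The mean curvature `tr (g⁻¹ h)`. -/
def meanCurv (B : E → E →L[ℝ] E →L[ℝ] ℝ) (Γ : E → E →L[ℝ] E →L[ℝ] E)
    (f ν : EuclideanSpace ℝ (Fin 2) × ℝ → E) (ζ : EuclideanSpace ℝ (Fin 2) × ℝ) : ℝ :=
  relTrace (fstForm B f ζ) (sndForm B Γ f ν ζ) (stdVec 0) (stdVec 1)

/-- The Gauss curvature `det (g⁻¹ h)`. -/
def gaussCurv (B : E → E →L[ℝ] E →L[ℝ] ℝ) (Γ : E → E →L[ℝ] E →L[ℝ] E)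
    (f ν : EuclideanSpace ℝ (Fin 2) × ℝ → E) (ζ : EuclideanSpace ℝ (Fin 2) × ℝ) : ℝ :=
  relDet (fstForm B f ζ) (sndForm B Γ f ν ζ) (stdVec 0) (stdVec 1)

section Bilinear

variable {V : Type*} [NormedAddCommGroup V] [NormedSpace ℝ V]

/-- `fstForm` as a bilinear map. -/
def fstFormL (B : E → E →L[ℝ] E →L[ℝ] ℝ) (f : V × ℝ → E) (ζ : V × ℝ) : V →ₗ[ℝ] V →ₗ[ℝ] ℝ :=
  LinearMap.mk₂ ℝ (fstForm B f ζ)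
    (fun u u' v => by
      rw [fstForm, show ((u + u', 0) : V × ℝ) = (u, 0) + (u', 0) by simp]
      simp only [fstForm, map_add, add_apply])
    (fun c u v => by
      rw [fstForm, show ((c • u, 0) : V × ℝ) = c • (u, 0) by simp]
      simp only [fstForm, map_smul, smul_apply])
    (fun u v v' => by
      rw [fstForm, show ((v + v', 0) : V × ℝ) = (v, 0) + (v', 0) by simp]
      simp only [fstForm, map_add])
    (fun c u v => by
      rw [fstForm, show ((c • v, 0) : V × ℝ) = c • (v, 0) by simp]
      simp only [fstForm, map_smul])

/-- `sndForm` as a bilinear map. -/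
def sndFormL (B : E → E →L[ℝ] E →L[ℝ] ℝ) (Γ : E → E →L[ℝ] E →L[ℝ] E) (f ν : V × ℝ → E)
    (ζ : V × ℝ) : V →ₗ[ℝ] V →ₗ[ℝ] ℝ :=
  LinearMap.mk₂ ℝ (sndForm B Γ f ν ζ)
    (fun u u' v => by
      rw [sndForm, show ((u + u', 0) : V × ℝ) = (u, 0) + (u', 0) by simp, cov_add_dir]
      simp only [sndForm, map_add, add_apply])
    (fun c u v => by
      rw [sndForm, show ((c • u, 0) : V × ℝ) = c • (u, 0) by simp, cov_smul_dir]
      simp only [sndForm, map_smul, smul_apply])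
    (fun u v v' => by
      rw [sndForm, show ((v + v', 0) : V × ℝ) = (v, 0) + (v', 0) by simp]
      simp only [sndForm, map_add])
    (fun c u v => by
      rw [sndForm, show ((c • v, 0) : V × ℝ) = c • (v, 0) by simp]
      simp only [sndForm, map_smul])

end Bilinear

theorem meanCurv_comb (ζ : EuclideanSpace ℝ (Fin 2) × ℝ) {p q r s : ℝ}
    (hd : p * s - q * r ≠ 0) : relTrace (fstForm B f ζ) (sndForm B Γ f ν ζ)
      (p • stdVec 0 + q • stdVec 1) (r • stdVec 0 + s • stdVec 1) = meanCurv B Γ f ν ζ :=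
  relTrace_comb (fstFormL B f ζ) (sndFormL B Γ f ν ζ) _ _ hd

theorem gaussCurv_comb (ζ : EuclideanSpace ℝ (Fin 2) × ℝ) {p q r s : ℝ}
    (hd : p * s - q * r ≠ 0) : relDet (fstForm B f ζ) (sndForm B Γ f ν ζ)
      (p • stdVec 0 + q • stdVec 1) (r • stdVec 0 + s • stdVec 1) = gaussCurv B Γ f ν ζ :=
  relDet_comb (fstFormL B f ζ) (sndFormL B Γ f ν ζ) _ _ hd

/-- `u₁, u₂` is a basis of orthonormal principal directions at `ζ` with principal curvatures
`a, b`. -/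
structure IsPrincipalBasis (B : E → E →L[ℝ] E →L[ℝ] ℝ) (Γ : E → E →L[ℝ] E →L[ℝ] E)
    (f ν : EuclideanSpace ℝ (Fin 2) × ℝ → E) (ζ : EuclideanSpace ℝ (Fin 2) × ℝ)
    (u₁ u₂ : EuclideanSpace ℝ (Fin 2)) (a b : ℝ) : Prop where
  frame : IsLorentzFrame (B (f ζ)) (fderiv ℝ f ζ (u₁, 0)) (fderiv ℝ f ζ (u₂, 0)) (ν ζ)
  principal₁ : cov Γ f ν ζ (u₁, 0) = a • fderiv ℝ f ζ (u₁, 0)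
  principal₂ : cov Γ f ν ζ (u₂, 0) = b • fderiv ℝ f ζ (u₂, 0)

namespace IsLocalFlow

theorem pairDet_pos (F : IsLocalFlow Ω B O f ν φ) (h : IsLeviCivita Ω B Γ)
    {ζ : EuclideanSpace ℝ (Fin 2) × ℝ} (hζ : ζ ∈ O) :
    0 < pairDet (fstForm B f ζ) (stdVec 0) (stdVec 1) := by
  have gs : ∀ u v, fstFormL B f ζ u v = fstFormL B f ζ v u := fun u v =>
    h.metric_symm _ (F.maps ζ hζ) _ _
  have p₀ : 0 < fstFormL B f ζ (stdVec 0) (stdVec 0) := F.spacelike ζ hζ _ (by simp [stdVec])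
  set t := fstFormL B f ζ (stdVec 0) (stdVec 1) / fstFormL B f ζ (stdVec 0) (stdVec 0) with ht
  have p₁ : 0 < fstFormL B f ζ (stdVec 1 - t • stdVec 0) (stdVec 1 - t • stdVec 0) :=
    F.spacelike ζ hζ _ fun h0 => by
      have := congrArg (fun x : EuclideanSpace ℝ (Fin 2) => x 1) h0
      simp [stdVec] at this
  have e : pairDet (fstForm B f ζ) (stdVec 0) (stdVec 1) =
      fstFormL B f ζ (stdVec 0) (stdVec 0) *
        fstFormL B f ζ (stdVec 1 - t • stdVec 0) (stdVec 1 - t • stdVec 0) := by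
    simp only [map_sub, map_smul, LinearMap.sub_apply, LinearMap.smul_apply, smul_eq_mul]
    rw [gs (stdVec 1) (stdVec 0), ht]
    change fstFormL B f ζ (stdVec 0) (stdVec 0) * fstFormL B f ζ (stdVec 1) (stdVec 1) -
      fstFormL B f ζ (stdVec 0) (stdVec 1) * fstFormL B f ζ (stdVec 1) (stdVec 0) = _
    rw [gs (stdVec 1) (stdVec 0)]
    field_simp
    ring
  rw [e]
  exact mul_pos p₀ p₁

theorem smooth_meanCurv (F : IsLocalFlow Ω B O f ν φ) (h : IsLeviCivita Ω B Γ) :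
    ContDiffOn ℝ ∞ (meanCurv B Γ f ν) O := by
  have g := F.smooth_fstForm h
  have k := F.smooth_sndForm h
  refine ContDiffOn.div ?_ (((g _ _).mul (g _ _)).sub ((g _ _).mul (g _ _)))
    fun ζ hζ => (F.pairDet_pos h hζ).ne'
  exact ((((g _ _).mul (k _ _)).sub ((g _ _).mul (k _ _))).sub ((g _ _).mul (k _ _))).add
    ((g _ _).mul (k _ _))

theorem smooth_gaussCurv (F : IsLocalFlow Ω B O f ν φ) (h : IsLeviCivita Ω B Γ) :
    ContDiffOn ℝ ∞ (gaussCurv B Γ f ν) O := by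
  have g := F.smooth_fstForm h
  have k := F.smooth_sndForm h
  exact ContDiffOn.div (((k _ _).mul (k _ _)).sub ((k _ _).mul (k _ _)))
    (((g _ _).mul (g _ _)).sub ((g _ _).mul (g _ _))) fun ζ hζ => (F.pairDet_pos h hζ).ne'

/-- Orthonormal eigenvectors of the second fundamental form are principal directions. -/
theorem isPrincipalBasis (F : IsLocalFlow Ω B O f ν φ) (h : IsLeviCivita Ω B Γ)
    (hE : Module.finrank ℝ E = 3) {ζ : EuclideanSpace ℝ (Fin 2) × ℝ} (hζ : ζ ∈ O)
    {u₁ u₂ : EuclideanSpace ℝ (Fin 2)} (g₁₁ : fstForm B f ζ u₁ u₁ = 1)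
    (g₂₂ : fstForm B f ζ u₂ u₂ = 1) (g₁₂ : fstForm B f ζ u₁ u₂ = 0)
    (h₁₂ : sndForm B Γ f ν ζ u₁ u₂ = 0) :
    IsPrincipalBasis B Γ f ν ζ u₁ u₂ (sndForm B Γ f ν ζ u₁ u₁) (sndForm B Γ f ν ζ u₂ u₂) := by
  have L : IsLorentzFrame (B (f ζ)) (fderiv ℝ f ζ (u₁, 0)) (fderiv ℝ f ζ (u₂, 0)) (ν ζ) :=
    ⟨h.metric_symm _ (F.maps ζ hζ), g₁₁, g₂₂, g₁₂, F.normal ζ hζ _, F.normal ζ hζ _, F.unit ζ hζ⟩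
  refine ⟨L, ?_, ?_⟩
  · conv_lhs => rw [L.expand hE (cov Γ f ν ζ (u₁, 0))]
    rw [F.cov_normal_inner h hζ, show B (f ζ) (cov Γ f ν ζ (u₁, 0)) (fderiv ℝ f ζ (u₂, 0)) = 0
      from h₁₂, sndForm]
    module
  · conv_lhs => rw [L.expand hE (cov Γ f ν ζ (u₂, 0))]
    rw [F.cov_normal_inner h hζ, show B (f ζ) (cov Γ f ν ζ (u₂, 0)) (fderiv ℝ f ζ (u₁, 0)) = 0
      from (F.sndForm_symm h hζ u₂ u₁).trans h₁₂, sndForm]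
    module

theorem exists_isPrincipalBasis (F : IsLocalFlow Ω B O f ν φ) (h : IsLeviCivita Ω B Γ)
    (hE : Module.finrank ℝ E = 3) {ζ : EuclideanSpace ℝ (Fin 2) × ℝ} (hζ : ζ ∈ O) :
    ∃ u₁ u₂ a b, b ≤ a ∧ IsPrincipalBasis B Γ f ν ζ u₁ u₂ a b := by
  obtain ⟨u₁, u₂, g₁₁, g₂₂, g₁₂, h₁₂, hle⟩ := exists_orthonormal_diagonal (fstFormL B f ζ)
    (sndFormL B Γ f ν ζ) (fun u v => h.metric_symm _ (F.maps ζ hζ) _ _)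
    (fun u v => F.sndForm_symm h hζ u v) (fun u hu => F.spacelike ζ hζ u hu)
  exact ⟨u₁, u₂, _, _, hle, F.isPrincipalBasis h hE hζ g₁₁ g₂₂ g₁₂ h₁₂⟩

/-- The values and the first variation of the curvatures in a principal basis. -/
theorem evolution_curv (F : IsLocalFlow Ω B O f ν φ) (h : IsLeviCivita Ω B Γ) {c : ℝ}
    (hc : HasConstantCurvature Ω B Γ c) {ζ : EuclideanSpace ℝ (Fin 2) × ℝ} (hζ : ζ ∈ O)
    {u₁ u₂ : EuclideanSpace ℝ (Fin 2)} {a b : ℝ} (P : IsPrincipalBasis B Γ f ν ζ u₁ u₂ a b) :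
    meanCurv B Γ f ν ζ = a + b ∧ gaussCurv B Γ f ν ζ = a * b ∧
    fderiv ℝ (meanCurv B Γ f ν) ζ (0, 1) =
      (hessian B Γ f ν φ ζ u₁ + φ ζ * (c - a ^ 2)) +
        (hessian B Γ f ν φ ζ u₂ + φ ζ * (c - b ^ 2)) ∧
    fderiv ℝ (gaussCurv B Γ f ν) ζ (0, 1) =
      b * (hessian B Γ f ν φ ζ u₁ + φ ζ * (c - a ^ 2)) +
        a * (hessian B Γ f ν φ ζ u₂ + φ ζ * (c - b ^ 2)) := by
  have L := P.frame
  have g₂₁ : fstForm B f ζ u₂ u₁ = 0 := (L.symm _ _).trans L.h₁₂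
  have h₁₁ : sndForm B Γ f ν ζ u₁ u₁ = a := by simp [sndForm, P.principal₁, L.h₁₁]
  have h₂₂ : sndForm B Γ f ν ζ u₂ u₂ = b := by simp [sndForm, P.principal₂, L.h₂₂]
  have h₁₂ : sndForm B Γ f ν ζ u₁ u₂ = 0 := by simp [sndForm, P.principal₁, L.h₁₂]
  have h₂₁ : sndForm B Γ f ν ζ u₂ u₁ = 0 := (F.sndForm_symm h hζ _ _).trans h₁₂
  have g₁₁ : fstForm B f ζ u₁ u₁ = 1 := L.h₁₁
  have g₂₂ : fstForm B f ζ u₂ u₂ = 1 := L.h₂₂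
  have g₁₂ : fstForm B f ζ u₁ u₂ = 0 := L.h₁₂
  -- The Gram determinant of the pair is 1, so the vectors are independent.
  have hd : u₁ 0 * u₂ 1 - u₁ 1 * u₂ 0 ≠ 0 := by
    intro h0
    have := pairDet_comb (fstFormL B f ζ) (stdVec 0) (stdVec 1) (u₁ 0) (u₁ 1) (u₂ 0) (u₂ 1)
    rw [h0, ← eq_stdVec_comb u₁, ← eq_stdVec_comb u₂] at this
    change fstForm B f ζ u₁ u₁ * fstForm B f ζ u₂ u₂ - fstForm B f ζ u₁ u₂ * fstForm B f ζ u₂ u₁ =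
      _ at this
    rw [g₁₁, g₂₂, g₁₂, g₂₁] at this
    norm_num at this
  -- The basis `u₁, u₂` stays fixed while `y` varies. It is orthonormal and principal at `ζ`, which
  -- suffices for the first variation there.
  have eH : ∀ y, meanCurv B Γ f ν y = relTrace (fstForm B f y) (sndForm B Γ f ν y) u₁ u₂ := by
    intro y
    rw [← meanCurv_comb y hd, ← eq_stdVec_comb u₁, ← eq_stdVec_comb u₂]
  have eK : ∀ y, gaussCurv B Γ f ν y = relDet (fstForm B f y) (sndForm B Γ f ν y) u₁ u₂ := by
    intro y
    rw [← gaussCurv_comb y hd, ← eq_stdVec_comb u₁, ← eq_stdVec_comb u₂]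
  have D := fderiv_relTrace_relDet (g := fstForm B f) (h := sndForm B Γ f ν) (ζ := ζ)
    (fun u v => F.differentiableAt (F.smooth_fstForm h u v) hζ)
    (fun u v => F.differentiableAt (F.smooth_sndForm h u v) hζ) g₁₁ g₂₂ g₁₂ g₂₁ h₁₁ h₂₂ h₁₂ h₂₁
    (0, 1)
  have d₁ := F.fderiv_sndForm h hc hζ u₁
  have d₂ := F.fderiv_sndForm h hc hζ u₂
  rw [P.principal₁, g₁₁] at d₁
  rw [P.principal₂, g₂₂] at d₂
  simp only [map_smul, smul_apply, smul_eq_mul, L.h₁₁, L.h₂₂] at d₁ d₂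
  rw [F.fderiv_fstForm h hζ, F.fderiv_fstForm h hζ, d₁, d₂, h₁₁, h₂₂] at D
  refine ⟨?_, ?_, ?_, ?_⟩
  · rw [eH, relTrace, pairDet, g₁₁, g₂₂, g₁₂, g₂₁, h₁₁, h₂₂]; ring
  · rw [eK, relDet, pairDet, pairDet, g₁₁, g₂₂, g₁₂, g₂₁, h₁₁, h₂₂, h₁₂]; ring
  · rw [funext eH, D.1]; ring
  · rw [funext eK, D.2]; ring

theorem four_gaussCurv_le (F : IsLocalFlow Ω B O f ν φ) (h : IsLeviCivita Ω B Γ) {c : ℝ}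
    (hc : HasConstantCurvature Ω B Γ c)
    (hE : Module.finrank ℝ E = 3) {ζ : EuclideanSpace ℝ (Fin 2) × ℝ} (hζ : ζ ∈ O) :
    4 * gaussCurv B Γ f ν ζ ≤ meanCurv B Γ f ν ζ ^ 2 := by
  obtain ⟨u₁, u₂, a, b, -, P⟩ := F.exists_isPrincipalBasis h hE hζ
  obtain ⟨hH, hK, -⟩ := F.evolution_curv h hc hζ P
  rw [hH, hK]
  nlinarith [sq_nonneg (a - b)]

/-- The tangential part of `Dₜν` is the gradient of `φ` and its normal part is zero, so `Dₜν`
vanishes at a critical point and the connection term disappears. -/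
theorem hessian_of_critical (F : IsLocalFlow Ω B O f ν φ) (h : IsLeviCivita Ω B Γ)
    (hE : Module.finrank ℝ E = 3) {ζ : EuclideanSpace ℝ (Fin 2) × ℝ} (hζ : ζ ∈ O)
    {u₁ u₂ : EuclideanSpace ℝ (Fin 2)} {a b : ℝ} (P : IsPrincipalBasis B Γ f ν ζ u₁ u₂ a b)
    (crit : ∀ u, fderiv ℝ φ ζ (u, 0) = 0) (u : EuclideanSpace ℝ (Fin 2)) :
    hessian B Γ f ν φ ζ u = fderiv ℝ (fderiv ℝ φ) ζ (u, 0) (u, 0) := by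
  have : cov Γ f ν ζ (0, 1) = 0 := by
    rw [P.frame.expand hE (cov Γ f ν ζ (0, 1)), F.inner_cov_time_normal h hζ,
      F.inner_cov_time_normal h hζ, F.cov_normal_inner h hζ, crit, crit]
    simp
  rw [hessian, this]
  simp

/-- The first variation of the angle `θ = s φ` in a principal basis. -/
theorem fderiv_angleSum_time (F : IsLocalFlow Ω B O f ν φ) (h : IsLeviCivita Ω B Γ) {s : ℝ}
    (hs : 0 < s) (hc : HasConstantCurvature Ω B Γ (-s ^ 2))
    {ζ : EuclideanSpace ℝ (Fin 2) × ℝ} (hζ : ζ ∈ O)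
    {u₁ u₂ : EuclideanSpace ℝ (Fin 2)} {a b : ℝ} (P : IsPrincipalBasis B Γ f ν ζ u₁ u₂ a b) :
    fderiv ℝ (fun y => angleSum s (meanCurv B Γ f ν y) (gaussCurv B Γ f ν y)) ζ (0, 1) =
      s / (s ^ 2 + a ^ 2) * hessian B Γ f ν φ ζ u₁ +
        s / (s ^ 2 + b ^ 2) * hessian B Γ f ν φ ζ u₂ - 2 * (s * φ ζ) := by
  obtain ⟨hH, hK, dH, dK⟩ := F.evolution_curv h hc hζ P
  rw [fderiv_angleSum hs (F.differentiableAt (F.smooth_meanCurv h) hζ)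
    (F.differentiableAt (F.smooth_gaussCurv h) hζ)
    (by rw [hH, hK]; nlinarith [sq_nonneg (a - b)]), dH, dK, hH, hK, cosAngleDiff_radicand]
  have hA : 0 < s ^ 2 + a ^ 2 := by positivity
  have hB : 0 < s ^ 2 + b ^ 2 := by positivity
  -- With `c = -s²` the reaction `φ (c - λ²)` cancels the denominator of its weight `s / (s² + λ²)`;
  -- each direction contributes `-s φ`.
  field_simp
  ring

/-- At a spatial maximum the angle is a subsolution of `θ' = -2θ`. -/
theorem fderiv_angleSum_le_of_isLocalMax (F : IsLocalFlow Ω B O f ν φ) (h : IsLeviCivita Ω B Γ)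
    (hE : Module.finrank ℝ E = 3) {s : ℝ}
    (hs : 0 < s) (hc : HasConstantCurvature Ω B Γ (-s ^ 2))
    {ζ : EuclideanSpace ℝ (Fin 2) × ℝ} (hζ : ζ ∈ O)
    (hmax : ∀ u, IsLocalMax (fun r : ℝ => φ (ζ + r • (u, (0 : ℝ)))) 0) :
    fderiv ℝ (fun y => angleSum s (meanCurv B Γ f ν y) (gaussCurv B Γ f ν y)) ζ (0, 1) ≤
      -2 * (s * φ ζ) := by
  obtain ⟨u₁, u₂, a, b, -, P⟩ := F.exists_isPrincipalBasis h hE hζ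
  have m := fun u => fderiv_fderiv_nonpos_of_isLocalMax F.isOpen F.smooth_φ hζ (hmax u)
  rw [F.fderiv_angleSum_time h hs hc hζ P,
    F.hessian_of_critical h hE hζ P (fun u => (m u).1),
    F.hessian_of_critical h hE hζ P (fun u => (m u).1)]
  have k₁ : s / (s ^ 2 + a ^ 2) * fderiv ℝ (fderiv ℝ φ) ζ (u₁, 0) (u₁, 0) ≤ 0 :=
    mul_nonpos_of_nonneg_of_nonpos (by positivity) (m u₁).2
  have k₂ : s / (s ^ 2 + b ^ 2) * fderiv ℝ (fderiv ℝ φ) ζ (u₂, 0) (u₂, 0) ≤ 0 :=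
    mul_nonpos_of_nonneg_of_nonpos (by positivity) (m u₂).2
  linarith

/-- At a spatial minimum the angle is a supersolution of `θ' = -2θ`. -/
theorem le_fderiv_angleSum_of_isLocalMin (F : IsLocalFlow Ω B O f ν φ) (h : IsLeviCivita Ω B Γ)
    (hE : Module.finrank ℝ E = 3) {s : ℝ}
    (hs : 0 < s) (hc : HasConstantCurvature Ω B Γ (-s ^ 2))
    {ζ : EuclideanSpace ℝ (Fin 2) × ℝ} (hζ : ζ ∈ O)
    (hmin : ∀ u, IsLocalMin (fun r : ℝ => φ (ζ + r • (u, (0 : ℝ)))) 0) :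
    -2 * (s * φ ζ) ≤
      fderiv ℝ (fun y => angleSum s (meanCurv B Γ f ν y) (gaussCurv B Γ f ν y)) ζ (0, 1) := by
  obtain ⟨u₁, u₂, a, b, -, P⟩ := F.exists_isPrincipalBasis h hE hζ
  have m := fun u => fderiv_fderiv_nonpos_of_isLocalMax F.isOpen F.smooth_φ.neg hζ (hmin u).neg
  have f₂ : fderiv ℝ (fun y => -φ y) = fun y => -fderiv ℝ φ y := funext fun y => fderiv_fun_neg
  have m₁ : ∀ u, fderiv ℝ φ ζ (u, 0) = 0 := fun u => by
    have := (m u).1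
    rw [f₂] at this
    simpa using this
  have m₂ : ∀ u, 0 ≤ fderiv ℝ (fderiv ℝ φ) ζ (u, 0) (u, 0) := fun u => by
    have := (m u).2
    rw [f₂, fderiv_fun_neg] at this
    simpa using this
  rw [F.fderiv_angleSum_time h hs hc hζ P, F.hessian_of_critical h hE hζ P m₁,
    F.hessian_of_critical h hE hζ P m₁]
  have k₁ : 0 ≤ s / (s ^ 2 + a ^ 2) * fderiv ℝ (fderiv ℝ φ) ζ (u₁, 0) (u₁, 0) :=
    mul_nonneg (by positivity) (m₂ u₁)
  have k₂ : 0 ≤ s / (s ^ 2 + b ^ 2) * fderiv ℝ (fderiv ℝ φ) ζ (u₂, 0) (u₂, 0) :=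
    mul_nonneg (by positivity) (m₂ u₂)
  linarith

end IsLocalFlow

end LocalEvolution

/-! ### Time slices -/

section Slices

variable {V : Type*} [NormedAddCommGroup V] [NormedSpace ℝ V]
  {X : Type*} [NormedAddCommGroup X] [NormedSpace ℝ X]

theorem fderiv_slice {q : V × ℝ → X} {z : V} {t : ℝ} (hq : DifferentiableAt ℝ q (z, t)) (u : V) :
    fderiv ℝ (fun y => q (y, t)) z u = fderiv ℝ q (z, t) (u, 0) := by
  have := HasFDerivAt.comp (g := q) (f := fun y : V => (y, t)) z hq.hasFDerivAt
    (hasFDerivAt_prodMk_left z t)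
  refine (congrArg (fun L => L u) this.fderiv).trans ?_
  simp

theorem isOpen_slice {V : Type*} [TopologicalSpace V] {O : Set (V × ℝ)} (hO : IsOpen O) (t : ℝ) :
    IsOpen {z | (z, t) ∈ O} :=
  hO.preimage (by fun_prop)

theorem contDiffOn_slice {O : Set (V × ℝ)} {q : V × ℝ → X} (hq : ContDiffOn ℝ ∞ q O) (t : ℝ) :
    ContDiffOn ℝ ∞ (fun z => q (z, t)) {z | (z, t) ∈ O} :=
  hq.comp (contDiff_id.prodMk contDiff_const).contDiffOn fun _ hz => hz

theorem fderiv_fderiv_slice {O : Set (V × ℝ)} (hO : IsOpen O) {q : V × ℝ → X}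
    (hq : ContDiffOn ℝ ∞ q O) {z : V} {t : ℝ} (hz : (z, t) ∈ O) (u v : V) :
    fderiv ℝ (fderiv ℝ (fun y => q (y, t))) z u v =
      fderiv ℝ (fderiv ℝ q) (z, t) (u, 0) (v, 0) := by
  have h₁ := fderiv_fderiv_apply (isOpen_slice hO t) (contDiffOn_slice hq t)
    (contDiffOn_const (c := v)) hz u
  have h₂ := fderiv_fderiv_apply hO hq (contDiffOn_const (c := ((v, 0) : V × ℝ))) hz (u, 0)
  simp only [fderiv_fun_const, Pi.zero_apply, zero_apply, map_zero, add_zero] at h₁ h₂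
  rw [← h₁, ← h₂, ← fderiv_slice]
  · have : (fun y => fderiv ℝ (fun y => q (y, t)) y v) =ᶠ[nhds z]
        fun y => fderiv ℝ q (y, t) (v, 0) := by
      filter_upwards [(isOpen_slice hO t).mem_nhds hz] with y hy
      exact fderiv_slice ((hq.contDiffAt (hO.mem_nhds hy)).differentiableAt (by simp)) v
    rw [this.fderiv_eq]
  · exact ((contDiffOn_fderiv_apply hO hq contDiffOn_const).contDiffAt
      (hO.mem_nhds hz)).differentiableAt (by simp)

theorem cov_slice {Γ : X → X →L[ℝ] X →L[ℝ] X} {f W : V × ℝ → X} {z : V} {t : ℝ}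
    (hf : DifferentiableAt ℝ f (z, t)) (hW : DifferentiableAt ℝ W (z, t)) (u : V) :
    cov Γ (fun y => f (y, t)) (fun y => W (y, t)) z u = cov Γ f W (z, t) (u, 0) := by
  simp only [cov, fderiv_slice hf, fderiv_slice hW]

end Slices

/-! ### Smooth principal frames away from umbilics. -/

section LocalEvolution

variable {E : Type*} [NormedAddCommGroup E] [NormedSpace ℝ E]
  {Ω : Set E} {B : E → E →L[ℝ] E →L[ℝ] ℝ} {Γ : E → E →L[ℝ] E →L[ℝ] E}
  {O : Set (EuclideanSpace ℝ (Fin 2) × ℝ)} {f ν : EuclideanSpace ℝ (Fin 2) × ℝ → E}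
  {φ : EuclideanSpace ℝ (Fin 2) × ℝ → ℝ}

/-- An explicit kernel vector of a degenerate symmetric bilinear form on the plane. -/
theorem kernel_of_pairDet_eq_zero
    (m : EuclideanSpace ℝ (Fin 2) →ₗ[ℝ] EuclideanSpace ℝ (Fin 2) →ₗ[ℝ] ℝ)
    (hm : ∀ u v, m u v = m v u) (hdet : pairDet (fun u v => m u v) (stdVec 0) (stdVec 1) = 0)
    (w v : EuclideanSpace ℝ (Fin 2)) :
    m (-m (stdVec 1) w • stdVec 0 + m (stdVec 0) w • stdVec 1) v = 0 := by
  rw [pairDet, hm (stdVec 1) (stdVec 0)] at hdet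
  rw [eq_stdVec_comb w, eq_stdVec_comb v]
  simp only [map_add, map_smul, LinearMap.add_apply, LinearMap.smul_apply, smul_eq_mul]
  rw [hm (stdVec 1) (stdVec 0)]
  linear_combination (w 0 * v 1 - w 1 * v 0) * hdet

namespace IsLocalFlow

/-- The form `h - l g` is degenerate but nonzero at `z₀`. Its explicit kernel vector depends
smoothly on the point and is nonzero near `z₀`, so it can be normalised. -/
theorem exists_smooth_eigenvector (F : IsLocalFlow Ω B O f ν φ) (h : IsLeviCivita Ω B Γ)
    {t : ℝ} {U : Set (EuclideanSpace ℝ (Fin 2))} (hU : IsOpen U) (hUO : ∀ z ∈ U, (z, t) ∈ O)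
    {l : EuclideanSpace ℝ (Fin 2) → ℝ} (hl : ContDiffOn ℝ ∞ l U)
    (hdet : ∀ z ∈ U, pairDet (fun u v => sndForm B Γ f ν (z, t) u v
      - l z * fstForm B f (z, t) u v) (stdVec 0) (stdVec 1) = 0)
    {z₀ : EuclideanSpace ℝ (Fin 2)} (hz₀ : z₀ ∈ U)
    (hne : ∃ u v, sndForm B Γ f ν (z₀, t) u v - l z₀ * fstForm B f (z₀, t) u v ≠ 0) :
    ∃ U' ⊆ U, IsOpen U' ∧ z₀ ∈ U' ∧
      ∃ e : EuclideanSpace ℝ (Fin 2) → EuclideanSpace ℝ (Fin 2), ContDiffOn ℝ ∞ e U' ∧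
      ∀ z ∈ U', fstForm B f (z, t) (e z) (e z) = 1 ∧
        ∀ v, sndForm B Γ f ν (z, t) (e z) v = l z * fstForm B f (z, t) (e z) v := by
  let m : EuclideanSpace ℝ (Fin 2) →
      EuclideanSpace ℝ (Fin 2) →ₗ[ℝ] EuclideanSpace ℝ (Fin 2) →ₗ[ℝ] ℝ := fun z =>
    sndFormL B Γ f ν (z, t) - l z • fstFormL B f (z, t)
  have hm : ∀ z u v, m z u v = sndForm B Γ f ν (z, t) u v - l z * fstForm B f (z, t) u v :=
    fun z u v => rfl
  obtain ⟨u, w, huw⟩ := hne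
  let n : EuclideanSpace ℝ (Fin 2) → EuclideanSpace ℝ (Fin 2) := fun z =>
    -m z (stdVec 1) w • stdVec 0 + m z (stdVec 0) w • stdVec 1
  have hn0 : n z₀ ≠ 0 := by
    intro h0
    have c₀ : m z₀ (stdVec 1) w = 0 := by
      have := congrArg (fun x : EuclideanSpace ℝ (Fin 2) => x 0) h0
      simpa [n, stdVec] using this
    have c₁ : m z₀ (stdVec 0) w = 0 := by
      have := congrArg (fun x : EuclideanSpace ℝ (Fin 2) => x 1) h0
      simpa [n, stdVec] using this
    refine huw ?_
    rw [← hm, eq_stdVec_comb u, map_add, map_smul, map_smul, LinearMap.add_apply,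
      LinearMap.smul_apply, LinearMap.smul_apply, c₀, c₁]
    simp
  have sm : ∀ u v, ContDiffOn ℝ ∞ (fun z => m z u v) U := fun u v =>
    ((contDiffOn_slice (F.smooth_sndForm h u v) t).mono hUO).sub
      (hl.mul ((contDiffOn_slice (F.smooth_fstForm h u v) t).mono hUO))
  have sn : ContDiffOn ℝ ∞ n U :=
    ((sm _ _).neg.smul contDiffOn_const).add ((sm _ _).smul contDiffOn_const)
  have sX : ContDiffOn ℝ ∞ (fun z => fderiv ℝ f (z, t) (n z, 0)) U :=
    ((contDiffOn_slice (F.smooth_f.fderiv_of_isOpen F.isOpen (m := ∞) (by simp)) t).mono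
      hUO).clm_apply (sn.prodMk contDiffOn_const)
  have sg : ContDiffOn ℝ ∞ (fun z => fstForm B f (z, t) (n z) (n z)) U :=
    h.contDiffOn_inner ((contDiffOn_slice F.smooth_f t).mono hUO)
      (fun z hz => F.maps _ (hUO z hz)) sX sX
  have gpos : ∀ z ∈ U, n z ≠ 0 → 0 < fstForm B f (z, t) (n z) (n z) := fun z hz hnz =>
    F.spacelike _ (hUO z hz) _ hnz
  refine ⟨U ∩ n ⁻¹' {0}ᶜ, Set.inter_subset_left,
    sn.continuousOn.isOpen_inter_preimage hU isOpen_compl_singleton, ⟨hz₀, hn0⟩,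
    fun z => (√(fstForm B f (z, t) (n z) (n z)))⁻¹ • n z, ?_, ?_⟩
  · refine ContDiffOn.smul (ContDiffOn.inv ((sg.mono Set.inter_subset_left).sqrt ?_) ?_)
      (sn.mono Set.inter_subset_left)
    · exact fun z hz => (gpos z hz.1 hz.2).ne'
    · exact fun z hz => (Real.sqrt_pos.2 (gpos z hz.1 hz.2)).ne'
  · rintro z ⟨hz, hnz⟩
    have hp := gpos z hz hnz
    constructor
    · change fstFormL B f (z, t) _ _ = 1
      simp only [map_smul, LinearMap.smul_apply, smul_eq_mul]
      change _ * (_ * fstForm B f (z, t) (n z) (n z)) = 1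
      have := Real.sqrt_pos.2 hp
      field_simp
      exact (Real.sq_sqrt hp.le).symm
    · intro v
      have hk := kernel_of_pairDet_eq_zero (m z)
        (fun u v => by
          rw [hm, hm, F.sndForm_symm h (hUO z hz) u v]
          rw [show fstForm B f (z, t) u v = fstForm B f (z, t) v u from
            h.metric_symm _ (F.maps _ (hUO z hz)) _ _]) (hdet z hz) w v
      change sndFormL B Γ f ν (z, t) _ _ = _ * fstFormL B f (z, t) _ _
      have hk' : sndFormL B Γ f ν (z, t) (n z) v = l z * fstFormL B f (z, t) (n z) v :=
        sub_eq_zero.1 hk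
      simp only [map_smul, LinearMap.smul_apply, smul_eq_mul, hk']
      ring

/-- Away from umbilics, a time slice has a smooth principal frame. -/
theorem exists_isPrincipalFrame (F : IsLocalFlow Ω B O f ν φ) (h : IsLeviCivita Ω B Γ)
    (hE : Module.finrank ℝ E = 3) {t : ℝ} {z₀ : EuclideanSpace ℝ (Fin 2)} (hz₀ : (z₀, t) ∈ O)
    (hdisc : 4 * gaussCurv B Γ f ν (z₀, t) < meanCurv B Γ f ν (z₀, t) ^ 2) :
    ∃ U : Set (EuclideanSpace ℝ (Fin 2)), z₀ ∈ U ∧ (∀ z ∈ U, (z, t) ∈ O) ∧ ∃ e₁ e₂ a b,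
      IsPrincipalFrame Ω B Γ U (fun z => f (z, t)) (fun z => ν (z, t)) e₁ e₂ a b ∧
      ∀ z ∈ U, b z < a z ∧ meanCurv B Γ f ν (z, t) = a z + b z ∧
        gaussCurv B Γ f ν (z, t) = a z * b z := by
  set H : EuclideanSpace ℝ (Fin 2) → ℝ := fun z => meanCurv B Γ f ν (z, t) with hH
  set K : EuclideanSpace ℝ (Fin 2) → ℝ := fun z => gaussCurv B Γ f ν (z, t) with hK
  have sH : ContDiffOn ℝ ∞ H {z | (z, t) ∈ O} := contDiffOn_slice (F.smooth_meanCurv h) t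
  have sK : ContDiffOn ℝ ∞ K {z | (z, t) ∈ O} := contDiffOn_slice (F.smooth_gaussCurv h) t
  have sD : ContDiffOn ℝ ∞ (fun z => H z ^ 2 - 4 * K z) {z | (z, t) ∈ O} :=
    (sH.pow 2).sub (contDiffOn_const.mul sK)
  let U : Set (EuclideanSpace ℝ (Fin 2)) :=
    {z | (z, t) ∈ O} ∩ (fun z => H z ^ 2 - 4 * K z) ⁻¹' Set.Ioi 0
  have hU : IsOpen U :=
    sD.continuousOn.isOpen_inter_preimage (isOpen_slice F.isOpen t) isOpen_Ioi
  have hUO : ∀ z ∈ U, (z, t) ∈ O := fun z hz => hz.1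
  have hz₀U : z₀ ∈ U := ⟨hz₀, by simpa [hH, hK] using hdisc⟩
  have sR : ContDiffOn ℝ ∞ (fun z => √(H z ^ 2 - 4 * K z)) U :=
    (sD.mono Set.inter_subset_left).sqrt fun z hz => (ne_of_gt hz.2)
  -- The roots of `λ² - Hλ + K`, smooth because the discriminant is positive on `U`.
  let a : EuclideanSpace ℝ (Fin 2) → ℝ := fun z => (H z + √(H z ^ 2 - 4 * K z)) / 2
  let b : EuclideanSpace ℝ (Fin 2) → ℝ := fun z => (H z - √(H z ^ 2 - 4 * K z)) / 2
  have sa : ContDiffOn ℝ ∞ a U := ((sH.mono Set.inter_subset_left).add sR).div_const 2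
  have sb : ContDiffOn ℝ ∞ b U := ((sH.mono Set.inter_subset_left).sub sR).div_const 2
  have hab : ∀ z ∈ U, b z < a z := fun z hz => by
    have : 0 < √(H z ^ 2 - 4 * K z) := Real.sqrt_pos.2 hz.2
    simp only [a, b]
    linarith
  have hsum : ∀ z, H z = a z + b z := fun z => by simp only [a, b]; ring
  have hprod : ∀ z ∈ U, K z = a z * b z := fun z hz => by
    have := Real.sq_sqrt (le_of_lt hz.2)
    simp only [a, b]
    simp only at this
    linear_combination this / 4
  have pd0 : ∀ z ∈ U, pairDet (fstForm B f (z, t)) (stdVec 0) (stdVec 1) ≠ 0 := fun z hz =>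
    (F.pairDet_pos h (hUO z hz)).ne'
  have hdet : ∀ l : ℝ, ∀ z ∈ U, l ^ 2 - H z * l + K z = 0 →
      pairDet (fun u v => sndForm B Γ f ν (z, t) u v - l * fstForm B f (z, t) u v)
        (stdVec 0) (stdVec 1) = 0 := by
    intro l z hz hl
    have e₁ := (div_eq_iff (pd0 z hz)).1 (show relTrace _ _ _ _ = H z from rfl)
    have e₂ := (div_eq_iff (pd0 z hz)).1 (show relDet _ _ _ _ = K z from rfl)
    simp only [pairDet] at e₁ e₂ ⊢
    linear_combination (fstForm B f (z, t) (stdVec 0) (stdVec 0) *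
      fstForm B f (z, t) (stdVec 1) (stdVec 1) - fstForm B f (z, t) (stdVec 0) (stdVec 1) *
      fstForm B f (z, t) (stdVec 1) (stdVec 0)) * hl + e₂ - l * e₁
  -- If `h = l g` at `z₀`, the trace is `2l`; neither of two distinct roots satisfies this.
  have hne : ∀ l : ℝ, H z₀ ≠ 2 * l →
      ∃ u v, sndForm B Γ f ν (z₀, t) u v - l * fstForm B f (z₀, t) u v ≠ 0 := by
    intro l hl
    by_contra! h0
    refine hl ?_
    have e : ∀ u v, sndForm B Γ f ν (z₀, t) u v = l * fstForm B f (z₀, t) u v := fun u v =>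
      sub_eq_zero.1 (h0 u v)
    change relTrace _ _ _ _ = _
    rw [relTrace, div_eq_iff (pd0 z₀ hz₀U), pairDet, e, e, e, e]
    ring
  have hab₀ := hab z₀ hz₀U
  obtain ⟨U₁, hU₁, oU₁, m₁, e₁, se₁, pe₁⟩ := F.exists_smooth_eigenvector h hU hUO sa
    (fun z hz => hdet _ z hz (by rw [hsum, hprod z hz]; ring)) hz₀U
    (hne _ (by rw [hsum]; intro h0; linarith))
  obtain ⟨U₂, hU₂, oU₂, m₂, e₂, se₂, pe₂⟩ := F.exists_smooth_eigenvector h hU hUO sb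
    (fun z hz => hdet _ z hz (by rw [hsum, hprod z hz]; ring)) hz₀U
    (hne _ (by rw [hsum]; intro h0; linarith))
  have PB : ∀ z ∈ U₁ ∩ U₂, IsPrincipalBasis B Γ f ν (z, t) (e₁ z) (e₂ z) (a z) (b z) := by
    rintro z ⟨hz₁, hz₂⟩
    have hzO := hUO z (hU₁ hz₁)
    have gs : fstForm B f (z, t) (e₂ z) (e₁ z) = fstForm B f (z, t) (e₁ z) (e₂ z) :=
      h.metric_symm _ (F.maps _ hzO) _ _
    have k₁ := (pe₁ z hz₁).2 (e₂ z)
    have k₂ := (pe₂ z hz₂).2 (e₁ z)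
    rw [F.sndForm_symm h hzO, k₁, gs] at k₂
    -- Principal directions of distinct principal curvatures are orthogonal.
    have g₁₂ : fstForm B f (z, t) (e₁ z) (e₂ z) = 0 := by
      have : (a z - b z) * fstForm B f (z, t) (e₁ z) (e₂ z) = 0 := by linarith
      exact (mul_eq_zero.1 this).resolve_left (sub_pos.2 (hab z (hU₁ hz₁))).ne'
    have := F.isPrincipalBasis h hE hzO (pe₁ z hz₁).1 (pe₂ z hz₂).1 g₁₂ (by rw [k₁, g₁₂, mul_zero])
    rwa [(pe₁ z hz₁).2, (pe₂ z hz₂).2, (pe₁ z hz₁).1, (pe₂ z hz₂).1, mul_one, mul_one] at this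
  have df : ∀ z ∈ U₁ ∩ U₂, ∀ u, fderiv ℝ (fun z => f (z, t)) z u = fderiv ℝ f (z, t) (u, 0) :=
    fun z hz u => fderiv_slice (F.differentiableAt F.smooth_f (hUO z (hU₁ hz.1))) u
  have dν : ∀ z ∈ U₁ ∩ U₂, ∀ u, cov Γ (fun z => f (z, t)) (fun z => ν (z, t)) z u =
      cov Γ f ν (z, t) (u, 0) := fun z hz u =>
    cov_slice (F.differentiableAt F.smooth_f (hUO z (hU₁ hz.1)))
      (F.differentiableAt F.smooth_ν (hUO z (hU₁ hz.1))) u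
  refine ⟨U₁ ∩ U₂, ⟨m₁, m₂⟩, fun z hz => hUO z (hU₁ hz.1), e₁, e₂, a, b, ?_,
    fun z hz => ⟨hab z (hU₁ hz.1), hsum z, hprod z (hU₁ hz.1)⟩⟩
  exact
    { isOpen := oU₁.inter oU₂
      maps := fun z hz => F.maps _ (hUO z (hU₁ hz.1))
      smooth_f := (contDiffOn_slice F.smooth_f t).mono fun z hz => hUO z (hU₁ hz.1)
      smooth_ν := (contDiffOn_slice F.smooth_ν t).mono fun z hz => hUO z (hU₁ hz.1)
      smooth_e₁ := se₁.mono Set.inter_subset_left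
      smooth_e₂ := se₂.mono Set.inter_subset_right
      smooth_a := sa.mono fun z hz => hU₁ hz.1
      smooth_b := sb.mono fun z hz => hU₁ hz.1
      frame := fun z hz => by simpa only [df z hz] using (PB z hz).frame
      principal₁ := fun z hz => by rw [dν z hz, df z hz]; exact (PB z hz).principal₁
      principal₂ := fun z hz => by rw [dν z hz, df z hz]; exact (PB z hz).principal₂
      immersion := fun z hz u hu => by
        by_contra hne
        have := F.spacelike _ (hUO z (hU₁ hz.1)) u hne
        rw [← df z hz, hu] at this
        simp at this }

end IsLocalFlow

end LocalEvolution

/-! ### Evolution of the angle difference at a spatial minimum of its cosine -/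

section AngleDifferenceEvolution

variable {E : Type*} [NormedAddCommGroup E] [NormedSpace ℝ E]
  {Ω : Set E} {B : E → E →L[ℝ] E →L[ℝ] ℝ} {Γ : E → E →L[ℝ] E →L[ℝ] E}
  {O : Set (EuclideanSpace ℝ (Fin 2) × ℝ)} {f ν : EuclideanSpace ℝ (Fin 2) × ℝ → E}
  {φ : EuclideanSpace ℝ (Fin 2) × ℝ → ℝ}

namespace IsLocalFlow

/-- The Hessian of `φ` in terms of the covariant derivative of a vector field on a time slice. -/
theorem hessian_eq_secondDirDeriv (F : IsLocalFlow Ω B O f ν φ)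
    {t : ℝ} {U : Set (EuclideanSpace ℝ (Fin 2))} (hU : IsOpen U) (hUO : ∀ z ∈ U, (z, t) ∈ O)
    {e : EuclideanSpace ℝ (Fin 2) → EuclideanSpace ℝ (Fin 2)} (he : ContDiffOn ℝ ∞ e U)
    (h : IsLeviCivita Ω B Γ) {z : EuclideanSpace ℝ (Fin 2)} (hz : z ∈ U) :
    hessian B Γ f ν φ (z, t) (e z) = secondDirDeriv (fun y => φ (y, t)) e z -
      B (f (z, t)) (cov Γ f ν (z, t) (0, 1))
        (cov Γ (fun y => f (y, t)) (fun y => fderiv ℝ (fun y => f (y, t)) y (e y)) z (e z)) := by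
  have hzO := hUO z hz
  have sf := (contDiffOn_slice F.smooth_f t).mono hUO
  have sφ := (contDiffOn_slice F.smooth_φ t).mono hUO
  have df := F.differentiableAt F.smooth_f hzO
  have e₁ : cov Γ (fun y => f (y, t)) (fun y => fderiv ℝ (fun y => f (y, t)) y (e y)) z (e z) =
      cov Γ f (fun y => fderiv ℝ f y (e z, 0)) (z, t) (e z, 0) +
        fderiv ℝ f (z, t) (fderiv ℝ e z (e z), 0) := by
    rw [cov, cov, fderiv_fderiv_apply hU sf he hz, fderiv_fderiv_slice F.isOpen F.smooth_f hzO,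
      fderiv_slice df, fderiv_slice df,
      fderiv_fderiv_apply F.isOpen F.smooth_f contDiffOn_const hzO]
    simp only [fderiv_fun_const, Pi.zero_apply, zero_apply, map_zero, add_zero]
    abel
  rw [e₁, map_add, F.inner_cov_time_normal h hzO, hessian, secondDirDeriv,
    fderiv_fderiv_apply hU sφ he hz, fderiv_fderiv_slice F.isOpen F.smooth_φ hzO,
    fderiv_slice (F.differentiableAt F.smooth_φ hzO)]
  ring

/-- The correction for a non-constant field is the pairing of `Dₜν` with its covariant derivative.
By the structure equations that derivative is a connection coefficient times the other frame vector
plus a normal part, and `Dₜν` is orthogonal to `ν`. -/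
theorem hessian_frame (F : IsLocalFlow Ω B O f ν φ) (h : IsLeviCivita Ω B Γ)
    (hE : Module.finrank ℝ E = 3) {t : ℝ} {U : Set (EuclideanSpace ℝ (Fin 2))}
    (hUO : ∀ z ∈ U, (z, t) ∈ O)
    {e₁ e₂ : EuclideanSpace ℝ (Fin 2) → EuclideanSpace ℝ (Fin 2)}
    {a b : EuclideanSpace ℝ (Fin 2) → ℝ}
    (P : IsPrincipalFrame Ω B Γ U (fun z => f (z, t)) (fun z => ν (z, t)) e₁ e₂ a b)
    {z : EuclideanSpace ℝ (Fin 2)} (hz : z ∈ U) :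
    hessian B Γ f ν φ (z, t) (e₁ z) = secondDirDeriv (fun y => φ (y, t)) e₁ z -
      rotation B Γ (fun z => f (z, t)) e₁ e₂ e₁ z * fderiv ℝ (fun y => φ (y, t)) z (e₂ z) ∧
    hessian B Γ f ν φ (z, t) (e₂ z) = secondDirDeriv (fun y => φ (y, t)) e₂ z +
      rotation B Γ (fun z => f (z, t)) e₁ e₂ e₂ z * fderiv ℝ (fun y => φ (y, t)) z (e₁ z) := by
  have hzO := hUO z hz
  have df := F.differentiableAt F.smooth_f hzO
  have dφ := F.differentiableAt F.smooth_φ hzO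
  rw [F.hessian_eq_secondDirDeriv P.isOpen hUO P.smooth_e₁ h hz,
    F.hessian_eq_secondDirDeriv P.isOpen hUO P.smooth_e₂ h hz, P.cov_X₁_e₁ h hE hz,
    P.cov_X₂_e₂ h hE hz]
  simp only [map_add, map_smul, smul_eq_mul, fderiv_slice df, fderiv_slice dφ,
    F.inner_cov_time_normal h hzO, F.cov_normal_inner h hzO]
  constructor <;> ring

/-- At a spatial minimum of `v = cos (α₁ - α₂)` with `0 < v < 1` one has `v' ≥ -2 v`. -/
theorem le_fderiv_cosAngleDiff_of_isLocalMin (F : IsLocalFlow Ω B O f ν φ)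
    (h : IsLeviCivita Ω B Γ) (hE : Module.finrank ℝ E = 3) {s : ℝ} (hs : 0 < s)
    (hc : HasConstantCurvature Ω B Γ (-s ^ 2))
    (hφ : ∀ ζ ∈ O, φ ζ = 1 / s * angleSum s (meanCurv B Γ f ν ζ) (gaussCurv B Γ f ν ζ))
    {z₀ : EuclideanSpace ℝ (Fin 2)} {t : ℝ} (hζ : (z₀, t) ∈ O)
    (hmin : IsLocalMin (fun z => cosAngleDiff s (meanCurv B Γ f ν (z, t))
      (gaussCurv B Γ f ν (z, t))) z₀)
    (h0 : 0 < cosAngleDiff s (meanCurv B Γ f ν (z₀, t)) (gaussCurv B Γ f ν (z₀, t)))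
    (h1 : cosAngleDiff s (meanCurv B Γ f ν (z₀, t)) (gaussCurv B Γ f ν (z₀, t)) < 1) :
    -2 * cosAngleDiff s (meanCurv B Γ f ν (z₀, t)) (gaussCurv B Γ f ν (z₀, t)) ≤
      fderiv ℝ (fun y => cosAngleDiff s (meanCurv B Γ f ν y) (gaussCurv B Γ f ν y))
        (z₀, t) (0, 1) := by
  -- At an umbilic the two angles coincide and the cosine is 1, excluded by `h1`.
  have hdisc : 4 * gaussCurv B Γ f ν (z₀, t) < meanCurv B Γ f ν (z₀, t) ^ 2 := by
    refine lt_of_le_of_ne (F.four_gaussCurv_le h hc hE hζ) fun heq => ?_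
    obtain ⟨u₁, u₂, a, b, -, P⟩ := F.exists_isPrincipalBasis h hE hζ
    obtain ⟨hH, hK, -⟩ := F.evolution_curv h hc hζ P
    rw [hH, hK] at heq h1
    have hab : a = b := by
      have : (a - b) ^ 2 = 0 := by linarith
      exact sub_eq_zero.1 (pow_eq_zero_iff two_ne_zero |>.1 this)
    rw [cosAngleDiff_eq hs, hab, sub_self, Real.cos_zero] at h1
    exact lt_irrefl _ h1
  obtain ⟨U, hz₀, hUO, e₁, e₂, a, b, P, hab⟩ := F.exists_isPrincipalFrame h hE hζ hdisc
  have hv : ∀ z ∈ U, cosAngleDiff s (meanCurv B Γ f ν (z, t)) (gaussCurv B Γ f ν (z, t)) =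
      Real.cos (Real.arctan (a z / s) - Real.arctan (b z / s)) := fun z hz => by
    rw [(hab z hz).2.1, (hab z hz).2.2, cosAngleDiff_eq hs]
  have hψ : ∀ z ∈ U, Real.arctan (a z / s) - Real.arctan (b z / s) ∈ Set.Icc 0 Real.pi := by
    intro z hz
    have : Real.arctan (b z / s) ≤ Real.arctan (a z / s) :=
      Real.arctan_mono (by gcongr; exact (hab z hz).1.le)
    have b₁ := Real.neg_pi_div_two_lt_arctan (b z / s)
    have b₂ := Real.arctan_lt_pi_div_two (a z / s)
    exact ⟨by linarith, by linarith⟩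
  -- The cosine is strictly decreasing on `[0, π]`, which contains the angle difference.
  have hmax : IsLocalMax (fun y => Real.arctan (a y / s) - Real.arctan (b y / s)) z₀ := by
    filter_upwards [hmin, P.isOpen.mem_nhds hz₀] with z hz hzU
    rw [hv z hzU, hv z₀ hz₀] at hz
    exact (Real.strictAntiOn_cos.le_iff_ge (hψ z₀ hz₀) (hψ z hzU)).1 hz
  obtain ⟨hlt, hH, hK⟩ := hab z₀ hz₀
  have hA : 0 < s ^ 2 + a z₀ ^ 2 := by positivity
  have hB : 0 < s ^ 2 + b z₀ ^ 2 := by positivity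
  have hQ : 0 < (s ^ 2 + a z₀ ^ 2) * (s ^ 2 + b z₀ ^ 2) := mul_pos hA hB
  have hK0 : 0 < s ^ 2 + a z₀ * b z₀ := by
    rw [hH, hK, cosAngleDiff, cosAngleDiff_radicand] at h0
    exact (div_pos_iff_of_pos_right (Real.sqrt_pos.2 hQ)).1 h0
  have cod := fun z hz => P.codazzi h hE hc (ζ := z) hz
  have I := angle_difference_le P.isOpen P.smooth_a P.smooth_b
    (P.smooth_rotation h P.smooth_e₁) (P.smooth_rotation h P.smooth_e₂) P.smooth_e₁ P.smooth_e₂ hs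
    (fun z hz => (cod z hz).1) (fun z hz => (cod z hz).2) hz₀
    (by rw [P.gauss h hE hc hz₀]; ring) hmax hlt.le hK0.le (φ := fun y => φ (y, t))
    (fun z hz => by
      rw [hφ _ (hUO z hz), (hab z hz).2.1, (hab z hz).2.2, angleSum_eq hs])
  rw [← (F.hessian_frame h hE hUO P hz₀).1, ← (F.hessian_frame h hE hUO P hz₀).2] at I
  have PB : IsPrincipalBasis B Γ f ν (z₀, t) (e₁ z₀) (e₂ z₀) (a z₀) (b z₀) := by
    have df := F.differentiableAt F.smooth_f hζ
    have dν := F.differentiableAt F.smooth_ν hζ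
    have k₀ := P.frame z₀ hz₀
    have k₁ := P.principal₁ z₀ hz₀
    have k₂ := P.principal₂ z₀ hz₀
    rw [cov_slice df dν, fderiv_slice df] at k₁ k₂
    rw [fderiv_slice df, fderiv_slice df] at k₀
    exact ⟨k₀, k₁, k₂⟩
  obtain ⟨-, -, dH, dK⟩ := F.evolution_curv h hc hζ PB
  have D := fderiv_cosAngleDiff (s := s) (F.differentiableAt (F.smooth_meanCurv h) hζ)
    (F.differentiableAt (F.smooth_gaussCurv h) hζ)
    (by rw [hH, hK, cosAngleDiff_radicand]; exact hQ) (0, 1)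
  rw [dH, dK, hH, hK, cosAngleDiff_radicand] at D
  rw [hH, hK, cosAngleDiff, cosAngleDiff_radicand]
  set Q := (s ^ 2 + a z₀ ^ 2) * (s ^ 2 + b z₀ ^ 2) with hQdef
  have hr : 0 < √Q := Real.sqrt_pos.2 hQ
  have hr2 : √Q ^ 2 = Q := Real.sq_sqrt hQ.le
  set X := hessian B Γ f ν φ (z₀, t) (e₁ z₀)
  set Y := hessian B Γ f ν φ (z₀, t) (e₂ z₀)
  have I' : X * (s ^ 2 + b z₀ ^ 2) - Y * (s ^ 2 + a z₀ ^ 2) ≤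
      2 * (a z₀ - b z₀) * (s ^ 2 + a z₀ * b z₀) := by
    rw [le_div_iff₀ hQ, hQdef] at I
    have e : (s / (s ^ 2 + a z₀ ^ 2) * X - s / (s ^ 2 + b z₀ ^ 2) * Y) *
        ((s ^ 2 + a z₀ ^ 2) * (s ^ 2 + b z₀ ^ 2)) =
        s * (X * (s ^ 2 + b z₀ ^ 2) - Y * (s ^ 2 + a z₀ ^ 2)) := by
      field_simp
    rw [e, show 2 * s * (a z₀ - b z₀) * (s ^ 2 + a z₀ * b z₀) =
      s * (2 * (a z₀ - b z₀) * (s ^ 2 + a z₀ * b z₀)) by ring] at I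
    exact le_of_mul_le_mul_left I hs
  -- The reaction terms shift both angles equally and cancel in the difference, leaving only Hessian
  -- terms.
  have D' : √Q ^ 3 * fderiv ℝ (fun y => cosAngleDiff s (meanCurv B Γ f ν y)
      (gaussCurv B Γ f ν y)) (z₀, t) (0, 1) =
      -s ^ 2 * (a z₀ - b z₀) * (X * (s ^ 2 + b z₀ ^ 2) - Y * (s ^ 2 + a z₀ ^ 2)) := by
    rw [D, hQdef]; ring
  have k₁ : -s ^ 2 * (a z₀ - b z₀) * (2 * (a z₀ - b z₀) * (s ^ 2 + a z₀ * b z₀)) ≤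
      √Q ^ 3 * fderiv ℝ (fun y => cosAngleDiff s (meanCurv B Γ f ν y)
        (gaussCurv B Γ f ν y)) (z₀, t) (0, 1) := by
    rw [D']
    refine mul_le_mul_of_nonpos_left I' ?_
    have := sub_pos.2 hlt
    have : 0 ≤ s ^ 2 * (a z₀ - b z₀) := by positivity
    linarith
  have k₂ : √Q ^ 3 * (-2 * ((s ^ 2 + a z₀ * b z₀) / √Q)) =
      -2 * (s ^ 2 + a z₀ * b z₀) * Q := by
    have : √Q ^ 3 * (-2 * ((s ^ 2 + a z₀ * b z₀) / √Q)) =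
        -2 * (s ^ 2 + a z₀ * b z₀) * √Q ^ 2 := by field_simp
    rw [this, hr2]
  have k₃ : -2 * (s ^ 2 + a z₀ * b z₀) * Q ≤
      -s ^ 2 * (a z₀ - b z₀) * (2 * (a z₀ - b z₀) * (s ^ 2 + a z₀ * b z₀)) := by
    -- This is `sin² + cos² = 1` for the angle difference, multiplied by `Q`; it gives `s² (a - b)²
    -- ≤ Q`.
    have e : Q = s ^ 2 * (a z₀ - b z₀) ^ 2 + (s ^ 2 + a z₀ * b z₀) ^ 2 := by rw [hQdef]; ring
    rw [e]
    have := pow_pos hK0 3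
    nlinarith
  exact le_of_mul_le_mul_left ((k₂.trans_le k₃).trans k₁) (pow_pos hr 3)

end IsLocalFlow

end AngleDifferenceEvolution

/-! ### Fundamental forms of a single map and their invariance -/

section Slice

variable {V E E' : Type*} [NormedAddCommGroup V] [NormedSpace ℝ V] [NormedAddCommGroup E]
  [NormedSpace ℝ E] [NormedAddCommGroup E'] [NormedSpace ℝ E']
  {V' : Type*} [NormedAddCommGroup V'] [NormedSpace ℝ V']

/-- The first fundamental form of `q` at `z`. -/
def sliceFst (B : E → E →L[ℝ] E →L[ℝ] ℝ) (q : V → E) (z : V) : V →L[ℝ] V →L[ℝ] ℝ :=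
  (B (q z)).bilinearComp (fderiv ℝ q z) (fderiv ℝ q z)

/-- The second fundamental form of `q` at `z` with respect to the normal vector `n`. -/
def sliceSnd (B : E → E →L[ℝ] E →L[ℝ] ℝ) (Γ : E → E →L[ℝ] E →L[ℝ] E) (q : V → E) (n : E) (z : V) :
    V →L[ℝ] V →L[ℝ] ℝ :=
  -(ContinuousLinearMap.compL ℝ V E ℝ (B (q z) n)).comp
    (fderiv ℝ (fderiv ℝ q) z + (Γ (q z)).bilinearComp (fderiv ℝ q z) (fderiv ℝ q z))

theorem sliceFst_apply (B : E → E →L[ℝ] E →L[ℝ] ℝ) (q : V → E) (z u v : V) :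
    sliceFst B q z u v = B (q z) (fderiv ℝ q z u) (fderiv ℝ q z v) := rfl

theorem sliceSnd_apply (B : E → E →L[ℝ] E →L[ℝ] ℝ) (Γ : E → E →L[ℝ] E →L[ℝ] E) (q : V → E) (n : E)
    (z u v : V) : sliceSnd B Γ q n z u v =
      -B (q z) n (fderiv ℝ (fderiv ℝ q) z u v + Γ (q z) (fderiv ℝ q z u) (fderiv ℝ q z v)) := by
  simp [sliceSnd]

theorem sliceFst_congr {B : E → E →L[ℝ] E →L[ℝ] ℝ} {q q' : V → E} {z : V} (h : q =ᶠ[nhds z] q') :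
    sliceFst B q z = sliceFst B q' z := by
  rw [sliceFst, sliceFst, h.fderiv_eq, h.eq_of_nhds]

theorem sliceSnd_congr {B : E → E →L[ℝ] E →L[ℝ] ℝ} {Γ : E → E →L[ℝ] E →L[ℝ] E} {q q' : V → E}
    {n : E} {z : V} (h : q =ᶠ[nhds z] q') : sliceSnd B Γ q n z = sliceSnd B Γ q' n z := by
  rw [sliceSnd, sliceSnd, h.fderiv_eq, h.fderiv.fderiv_eq, h.eq_of_nhds]

theorem eventually_differentiableAt {q : V → E} {z : V} (hq : ContDiffAt ℝ ∞ q z) :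
    ∀ᶠ y in nhds z, DifferentiableAt ℝ q y :=
  ((hq.of_le (m := 1) (by simp)).eventually (by simp)).mono
    fun _ hy => hy.differentiableAt (by simp)

theorem differentiableAt_fderiv {q : V → E} {z : V} (hq : ContDiffAt ℝ ∞ q z) :
    DifferentiableAt ℝ (fderiv ℝ q) z :=
  (hq.fderiv_right (m := 1) (by rw [one_add_one_eq_two]; exact two_le_smooth)).differentiableAt (by simp)

theorem fderiv_fderiv_comp {ψ : E → E'} {q : V → E} {z : V} (hψ : ContDiffAt ℝ ∞ ψ (q z))
    (hq : ContDiffAt ℝ ∞ q z) (u v : V) :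
    fderiv ℝ (fderiv ℝ (ψ ∘ q)) z u v =
      fderiv ℝ (fderiv ℝ ψ) (q z) (fderiv ℝ q z u) (fderiv ℝ q z v) +
        fderiv ℝ ψ (q z) (fderiv ℝ (fderiv ℝ q) z u v) := by
  have e : fderiv ℝ (ψ ∘ q) =ᶠ[nhds z] fun y => (fderiv ℝ ψ (q y)).comp (fderiv ℝ q y) := by
    filter_upwards [eventually_differentiableAt hq,
      hq.continuousAt.eventually (eventually_differentiableAt hψ)] with y h₁ h₂
    exact fderiv_comp y h₂ h₁
  rw [e.fderiv_eq]
  have h₁ : HasFDerivAt (fun y => fderiv ℝ ψ (q y))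
      ((fderiv ℝ (fderiv ℝ ψ) (q z)).comp (fderiv ℝ q z)) z :=
    (differentiableAt_fderiv hψ).hasFDerivAt.comp z
      (hq.differentiableAt (by simp)).hasFDerivAt
  rw [(h₁.clm_comp (differentiableAt_fderiv hq).hasFDerivAt).fderiv]
  simp [add_comm]

/-- A local isometry intertwines the Levi-Civita connections. -/
theorem IsLeviCivita.inner_conn_of_isometry {Ω₁ Ω : Set E} {Ω₂ : Set E'}
    {B₁ : E → E →L[ℝ] E →L[ℝ] ℝ} {Γ₁ : E → E →L[ℝ] E →L[ℝ] E}
    {B₂ : E' → E' →L[ℝ] E' →L[ℝ] ℝ} {Γ₂ : E' → E' →L[ℝ] E' →L[ℝ] E'}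
    (h₁ : IsLeviCivita Ω₁ B₁ Γ₁) (h₂ : IsLeviCivita Ω₂ B₂ Γ₂) {ψ : E → E'} (hΩ : IsOpen Ω)
    (hsub : Ω ⊆ Ω₁) (hψ : ContDiffOn ℝ ∞ ψ Ω) (hmaps : ∀ z ∈ Ω, ψ z ∈ Ω₂)
    (iso : ∀ z ∈ Ω, ∀ u v, B₂ (ψ z) (fderiv ℝ ψ z u) (fderiv ℝ ψ z v) = B₁ z u v)
    {z : E} (hz : z ∈ Ω) (u v w : E) :
    B₂ (ψ z) (fderiv ℝ ψ z w)
      (fderiv ℝ (fderiv ℝ ψ) z u v + Γ₂ (ψ z) (fderiv ℝ ψ z u) (fderiv ℝ ψ z v)) =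
      B₁ z w (Γ₁ z u v) := by
  have hd : DifferentiableAt ℝ (fderiv ℝ ψ) z :=
    differentiableAt_fderiv (hψ.contDiffAt (hΩ.mem_nhds hz))
  have hψz : DifferentiableAt ℝ ψ z :=
    (hψ.contDiffAt (hΩ.mem_nhds hz)).differentiableAt (by simp)
  -- `A` is the connection of the target along `ψ`. It is symmetric and compatible with the
  -- pulled-back metric, so the Koszul combination of three compatibility identities identifies it.
  set A : E → E → E' := fun u v =>
    fderiv ℝ (fderiv ℝ ψ) z u v + Γ₂ (ψ z) (fderiv ℝ ψ z u) (fderiv ℝ ψ z v) with hA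
  have Asymm : ∀ u v, A u v = A v u := fun u v => by
    simp only [hA]
    rw [h₂.torsion_free _ (hmaps z hz)]
    congr 1
    have := (hψ.contDiffAt (hΩ.mem_nhds hz)).isSymmSndFDerivAt
      (by simpa using two_le_smooth)
    exact this u v
  have hcov : ∀ u v, cov Γ₂ ψ (fun y => fderiv ℝ ψ y v) z u = A u v := fun u v => by
    simp only [cov, hA]
    congr 1
    rw [fderiv_clm_apply hd (differentiableAt_const v)]
    simp
  have key : ∀ u v w, B₁ z (Γ₁ z u v) w + B₁ z v (Γ₁ z u w) =
      B₂ (ψ z) (A u v) (fderiv ℝ ψ z w) + B₂ (ψ z) (fderiv ℝ ψ z v) (A u w) := fun u v w => by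
    rw [← h₁.compatible z (hsub hz), ← hcov, ← hcov,
      ← h₂.fderiv_inner (hmaps z hz) hψz (hd.clm_apply (differentiableAt_const v))
      (hd.clm_apply (differentiableAt_const w)) u]
    have e : (fun y => B₂ (ψ y) (fderiv ℝ ψ y v) (fderiv ℝ ψ y w)) =ᶠ[nhds z]
        fun y => B₁ y v w := by
      filter_upwards [hΩ.mem_nhds hz] with y hy using iso y hy v w
    rw [e.fderiv_eq]
    have hB := h₁.differentiableAt_metric (hsub hz)
    rw [fderiv_clm_apply (hB.clm_apply (differentiableAt_const v)) (differentiableAt_const w),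
      fderiv_clm_apply hB (differentiableAt_const v)]
    simp
  have s₁ := h₁.metric_symm z (hsub hz)
  have s₂ := h₂.metric_symm _ (hmaps z hz)
  have t₁ := h₁.torsion_free z (hsub hz)
  have k₁ := key u v w
  have k₂ := key v w u
  have k₃ := key w u v
  rw [t₁ v u, Asymm v u, s₁ w, s₂ _ (A u v)] at k₂
  rw [t₁ w u, t₁ w v, Asymm w u, Asymm w v] at k₃
  rw [s₁ v, s₂ _ (A u w)] at k₁
  rw [s₁ u, s₂ _ (A v w)] at k₃
  rw [s₁ w, s₂ _ (A u v)]
  linarith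

/-- Meant for `ψ` a transition map between ambient charts, which is an isometry of coordinate
metrics. -/
theorem slice_comp_isometry {Ω₁ Ω : Set E} {Ω₂ : Set E'}
    {B₁ : E → E →L[ℝ] E →L[ℝ] ℝ} {Γ₁ : E → E →L[ℝ] E →L[ℝ] E}
    {B₂ : E' → E' →L[ℝ] E' →L[ℝ] ℝ} {Γ₂ : E' → E' →L[ℝ] E' →L[ℝ] E'}
    (h₁ : IsLeviCivita Ω₁ B₁ Γ₁) (h₂ : IsLeviCivita Ω₂ B₂ Γ₂) {ψ : E → E'} (hΩ : IsOpen Ω)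
    (hsub : Ω ⊆ Ω₁) (hψ : ContDiffOn ℝ ∞ ψ Ω) (hmaps : ∀ z ∈ Ω, ψ z ∈ Ω₂)
    (iso : ∀ z ∈ Ω, ∀ u v, B₂ (ψ z) (fderiv ℝ ψ z u) (fderiv ℝ ψ z v) = B₁ z u v)
    {q : V → E} {z : V} (hq : ContDiffAt ℝ ∞ q z) (hz : q z ∈ Ω) (n : E) :
    sliceFst B₂ (ψ ∘ q) z = sliceFst B₁ q z ∧
      sliceSnd B₂ Γ₂ (ψ ∘ q) (fderiv ℝ ψ (q z) n) z = sliceSnd B₁ Γ₁ q n z := by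
  have hψz := hψ.contDiffAt (hΩ.mem_nhds hz)
  have hD : ∀ u, fderiv ℝ (ψ ∘ q) z u = fderiv ℝ ψ (q z) (fderiv ℝ q z u) := fun u => by
    rw [fderiv_comp z (hψz.differentiableAt (by simp)) (hq.differentiableAt (by simp))]; rfl
  constructor
  · ext u v
    rw [sliceFst_apply, sliceFst_apply, hD, hD]
    exact iso _ hz _ _
  · ext u v
    rw [sliceSnd_apply, sliceSnd_apply, hD, hD, fderiv_fderiv_comp hψz hq, Function.comp_apply,
      add_right_comm, map_add, h₁.inner_conn_of_isometry h₂ hΩ hsub hψ hmaps iso hz, iso _ hz,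
      map_add, add_comm]

theorem sliceFst_comp_right (B : E → E →L[ℝ] E →L[ℝ] ℝ) {q : V → E} {P : V' → V} {z : V'}
    (hq : ContDiffAt ℝ ∞ q (P z)) (hP : ContDiffAt ℝ ∞ P z) (u v : V') :
    sliceFst B (q ∘ P) z u v = sliceFst B q (P z) (fderiv ℝ P z u) (fderiv ℝ P z v) := by
  rw [sliceFst_apply, sliceFst_apply,
    fderiv_comp z (hq.differentiableAt (by simp)) (hP.differentiableAt (by simp))]
  rfl

/-- Reparametrisation adds a term with the second derivative of `P`; it is tangent to the surface
and therefore invisible to `n`. -/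
theorem sliceSnd_comp_right (B : E → E →L[ℝ] E →L[ℝ] ℝ) (Γ : E → E →L[ℝ] E →L[ℝ] E)
    {q : V → E} {P : V' → V} {z : V'}
    (hq : ContDiffAt ℝ ∞ q (P z)) (hP : ContDiffAt ℝ ∞ P z) {n : E}
    (hn : ∀ w, B (q (P z)) n (fderiv ℝ q (P z) w) = 0) (u v : V') :
    sliceSnd B Γ (q ∘ P) n z u v = sliceSnd B Γ q n (P z) (fderiv ℝ P z u) (fderiv ℝ P z v) := by
  rw [sliceSnd_apply, sliceSnd_apply, fderiv_fderiv_comp hq hP,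
    fderiv_comp z (hq.differentiableAt (by simp)) (hP.differentiableAt (by simp))]
  simp [hn]

end Slice

/-! ### Mean and Gauss curvature under a change of parameters. -/

section SliceCurvature

variable {E E' : Type*} [NormedAddCommGroup E] [NormedSpace ℝ E]
  [NormedAddCommGroup E'] [NormedSpace ℝ E']

/-- The mean curvature of `q` at `z` with respect to the normal vector `n`. -/
def sliceMean (B : E → E →L[ℝ] E →L[ℝ] ℝ) (Γ : E → E →L[ℝ] E →L[ℝ] E)
    (q : EuclideanSpace ℝ (Fin 2) → E) (n : E) (z : EuclideanSpace ℝ (Fin 2)) : ℝ :=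
  relTrace (fun u v => sliceFst B q z u v) (fun u v => sliceSnd B Γ q n z u v)
    (stdVec 0) (stdVec 1)

/-- The Gauss curvature of `q` at `z` with respect to the normal vector `n`. -/
def sliceGauss (B : E → E →L[ℝ] E →L[ℝ] ℝ) (Γ : E → E →L[ℝ] E →L[ℝ] E)
    (q : EuclideanSpace ℝ (Fin 2) → E) (n : E) (z : EuclideanSpace ℝ (Fin 2)) : ℝ :=
  relDet (fun u v => sliceFst B q z u v) (fun u v => sliceSnd B Γ q n z u v)
    (stdVec 0) (stdVec 1)

/-- Pulling back by `L` means evaluating the invariants on the images of the standard basis, again a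
basis by injectivity. -/
theorem rel_pullback (g h : EuclideanSpace ℝ (Fin 2) →L[ℝ] EuclideanSpace ℝ (Fin 2) →L[ℝ] ℝ)
    (L : EuclideanSpace ℝ (Fin 2) →L[ℝ] EuclideanSpace ℝ (Fin 2)) (hL : Function.Injective L) :
    relTrace (fun u v => g (L u) (L v)) (fun u v => h (L u) (L v)) (stdVec 0) (stdVec 1) =
        relTrace (fun u v => g u v) (fun u v => h u v) (stdVec 0) (stdVec 1) ∧
      relDet (fun u v => g (L u) (L v)) (fun u v => h (L u) (L v)) (stdVec 0) (stdVec 1) =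
        relDet (fun u v => g u v) (fun u v => h u v) (stdVec 0) (stdVec 1) := by
  have hd : L (stdVec 0) 0 * L (stdVec 1) 1 - L (stdVec 0) 1 * L (stdVec 1) 0 ≠ 0 := by
    intro h0
    have e₀ := eq_stdVec_comb (L (stdVec 0))
    have e₁ := eq_stdVec_comb (L (stdVec 1))
    have z₁ : L (L (stdVec 1) 1 • stdVec 0 - L (stdVec 0) 1 • stdVec 1) = L 0 := by
      rw [map_sub, map_smul, map_smul, map_zero]
      ext i
      fin_cases i
      · simp only [Fin.zero_eta, PiLp.sub_apply, PiLp.smul_apply, smul_eq_mul, PiLp.zero_apply]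
        linarith
      · simp only [Fin.mk_one, PiLp.sub_apply, PiLp.smul_apply, smul_eq_mul, PiLp.zero_apply]
        ring
    have z₂ : L (L (stdVec 1) 0 • stdVec 0 - L (stdVec 0) 0 • stdVec 1) = L 0 := by
      rw [map_sub, map_smul, map_smul, map_zero]
      ext i
      fin_cases i
      · simp only [Fin.zero_eta, PiLp.sub_apply, PiLp.smul_apply, smul_eq_mul, PiLp.zero_apply]
        ring
      · simp only [Fin.mk_one, PiLp.sub_apply, PiLp.smul_apply, smul_eq_mul, PiLp.zero_apply]
        linarith
    have c₁ := hL z₁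
    have c₂ := hL z₂
    have a₁ := congrArg (fun x : EuclideanSpace ℝ (Fin 2) => x 1) c₁
    have a₂ := congrArg (fun x : EuclideanSpace ℝ (Fin 2) => x 1) c₂
    simp [stdVec] at a₁ a₂
    have : L (stdVec 0) = L 0 := by
      rw [e₀, map_zero]
      simp [stdVec, a₁, a₂]
    have := congrArg (fun x : EuclideanSpace ℝ (Fin 2) => x 0) (hL this)
    simp [stdVec] at this
  let b : (EuclideanSpace ℝ (Fin 2) →L[ℝ] EuclideanSpace ℝ (Fin 2) →L[ℝ] ℝ) →
      EuclideanSpace ℝ (Fin 2) →ₗ[ℝ] EuclideanSpace ℝ (Fin 2) →ₗ[ℝ] ℝ :=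
    fun g => (ContinuousLinearMap.coeLM ℝ).comp (g : EuclideanSpace ℝ (Fin 2) →ₗ[ℝ] _)
  have t := relTrace_comb (b g) (b h) (stdVec 0) (stdVec 1) hd
  have d := relDet_comb (b g) (b h) (stdVec 0) (stdVec 1) hd
  rw [← eq_stdVec_comb, ← eq_stdVec_comb] at t d
  exact ⟨t, d⟩

theorem sliceCurv_comp_right (B : E → E →L[ℝ] E →L[ℝ] ℝ) (Γ : E → E →L[ℝ] E →L[ℝ] E)
    {q : EuclideanSpace ℝ (Fin 2) → E} {P : EuclideanSpace ℝ (Fin 2) → EuclideanSpace ℝ (Fin 2)}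
    {z : EuclideanSpace ℝ (Fin 2)}
    (hq : ContDiffAt ℝ ∞ q (P z)) (hP : ContDiffAt ℝ ∞ P z) {n : E}
    (hn : ∀ w, B (q (P z)) n (fderiv ℝ q (P z) w) = 0)
    (hinj : Function.Injective (fderiv ℝ P z)) :
    sliceMean B Γ (q ∘ P) n z = sliceMean B Γ q n (P z) ∧
      sliceGauss B Γ (q ∘ P) n z = sliceGauss B Γ q n (P z) := by
  simp only [sliceMean, sliceGauss, sliceFst_comp_right B hq hP,
    sliceSnd_comp_right B Γ hq hP hn]
  exact rel_pullback _ _ _ hinj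

end SliceCurvature

/-! ### Lorentzian forms -/

section LorentzianForm

variable {E : Type*} [NormedAddCommGroup E] [NormedSpace ℝ E]

/-- The signature condition on a bilinear form. -/
def IsLorentzian (b : E →L[ℝ] E →L[ℝ] ℝ) : Prop :=
  ∃ v, b v v < 0 ∧ ∀ w, w ≠ 0 → b v w = 0 → 0 < b w w

/-- Remove from `u` its component along the timelike `v`. The remainder is null and orthogonal to
`v`, hence zero, and pairing `u` with `v` then kills the component. -/
theorem IsLorentzian.nondegenerate {b : E →L[ℝ] E →L[ℝ] ℝ} (h : IsLorentzian b) {u : E}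
    (hu : ∀ v, b u v = 0) : u = 0 := by
  obtain ⟨v, hv, hpos⟩ := h
  set c := b v u / b v v with hc
  have ho : b v (u - c • v) = 0 := by
    rw [map_sub, map_smul, smul_eq_mul, hc, div_mul_cancel₀ _ hv.ne, sub_self]
  have hw : u - c • v = 0 := by
    by_contra hne
    have := hpos _ hne ho
    rw [map_sub b, sub_apply, map_smul b, smul_apply, hu, ho] at this
    simp at this
  have hu' := sub_eq_zero.1 hw
  have := hu v
  rw [hu', map_smul, smul_apply, smul_eq_mul, mul_eq_zero] at this
  rw [hu', this.resolve_right hv.ne, zero_smul]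

/-- A timelike vector and a nonzero vector orthogonal to it span a plane with negative Gram
determinant. -/
theorem IsLorentzian.exists_gramDet_ne_zero [FiniteDimensional ℝ E] {b : E →L[ℝ] E →L[ℝ] ℝ}
    (h : IsLorentzian b) (hE : 1 < Module.finrank ℝ E) : ∃ u v, gramDet b u v ≠ 0 := by
  obtain ⟨v, hv, hpos⟩ := h
  have hker : LinearMap.ker (b v : E →ₗ[ℝ] ℝ) ≠ ⊥ :=
    LinearMap.ker_ne_bot_of_finrank_lt (by simpa using hE)
  obtain ⟨w, hw, hw0⟩ := (Submodule.ne_bot_iff _).1 hker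
  have hw' : b v w = 0 := hw
  refine ⟨v, w, ?_⟩
  rw [gramDet, hw']
  have := mul_neg_of_neg_of_pos hv (hpos w hw0 hw')
  intro h0
  simp at h0
  rcases h0 with h0 | h0
  · exact hv.ne h0
  · exact (hpos w hw0 hw').ne' h0

/-- Two timelike vectors on the same side as a third one are on the same side. -/
theorem IsLorentzFrame.inner_neg_of_timelike {b : E →L[ℝ] E →L[ℝ] ℝ} {x₁ x₂ ν : E}
    (h : IsLorentzFrame b x₁ x₂ ν) (hE : Module.finrank ℝ E = 3) {v τ : E}
    (hv : b v v < 0) (hτ : b τ τ < 0) (hντ : b ν τ < 0) (hvτ : b v τ < 0) : b v ν < 0 := by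
  have exp : ∀ w w', b w w' = b w x₁ * b w' x₁ + b w x₂ * b w' x₂ - b w ν * b w' ν := by
    intro w w'
    have := congrArg (b w) (h.expand hE w')
    rw [map_sub, map_add, map_smul, map_smul, map_smul] at this
    rw [this]
    simp only [smul_eq_mul]
    ring
  rw [h.symm] at hντ
  rw [exp] at hv hτ hvτ
  by_contra! hn
  -- Otherwise the spacelike parts of `v` and `τ` would have a product larger than Cauchy-Schwarz
  -- permits for timelike vectors. The first square is the Lagrange defect.
  nlinarith [sq_nonneg (b v x₁ * b τ x₂ - b v x₂ * b τ x₁),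
    mul_nonneg hn (neg_nonneg.2 hντ.le), sq_nonneg (b v x₁), sq_nonneg (b v x₂)]

end LorentzianForm

/-! ### The metric in a chart -/

section ChartMetric

variable {m : ℕ} {N : Type*} [TopologicalSpace N] [ChartedSpace (EuclideanSpace ℝ (Fin m)) N]
  {y : OpenPartialHomeomorph N (EuclideanSpace ℝ (Fin m))}

theorem mdifferentiable_of_mem_maximalAtlas (hy : y ∈ IsManifold.maximalAtlas (𝓡 m) ∞ N) :
    y.MDifferentiable (𝓡 m) (𝓡 m) :=
  ⟨(contMDiffOn_of_mem_maximalAtlas hy).mdifferentiableOn (by simp),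
    (contMDiffOn_symm_of_mem_maximalAtlas hy).mdifferentiableOn (by simp)⟩

theorem LorentzMetric.form_congr (g : LorentzMetric m N) {q q' : N} (h : q = q')
    (u v : EuclideanSpace ℝ (Fin m)) :
    g.form q (show TangentSpace (𝓡 m) q from u) (show TangentSpace (𝓡 m) q from v) =
      g.form q' (show TangentSpace (𝓡 m) q' from u) (show TangentSpace (𝓡 m) q' from v) := by
  subst h; rfl

theorem metricOf_coordMetric (g : LorentzMetric m N) (z u v : EuclideanSpace ℝ (Fin m)) :
    metricOf (coordMetric g.form y) z u v =
      g.form (y.symm z) (mfderiv (𝓡 m) (𝓡 m) y.symm z u) (mfderiv (𝓡 m) (𝓡 m) y.symm z v) := by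
  rw [metricOf_apply, coordInner]
  let L : EuclideanSpace ℝ (Fin m) →L[ℝ] EuclideanSpace ℝ (Fin m) :=
    mfderiv (𝓡 m) (𝓡 m) y.symm z
  let b : EuclideanSpace ℝ (Fin m) →L[ℝ] EuclideanSpace ℝ (Fin m) →L[ℝ] ℝ := g.form (y.symm z)
  change _ = b (L u) (L v)
  conv_rhs => rw [← (EuclideanSpace.basisFun (Fin m) ℝ).sum_repr u,
    ← (EuclideanSpace.basisFun (Fin m) ℝ).sum_repr v]
  rw [Finset.sum_comm]
  simp only [map_sum, map_smul, sum_apply, smul_apply, smul_eq_mul,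
    EuclideanSpace.basisFun_apply, EuclideanSpace.basisFun_repr]
  refine Finset.sum_congr rfl fun α _ => ?_
  rw [Finset.mul_sum]
  refine Finset.sum_congr rfl fun β _ => ?_
  change b (L _) (L _) * _ * _ = _
  ring

theorem metricOf_components (g : LorentzMetric m N)
    (hy : y ∈ IsManifold.maximalAtlas (𝓡 m) ∞ N) {q : N} (hq : q ∈ y.source)
    (v w : TangentSpace (𝓡 m) q) :
    metricOf (coordMetric g.form y) (y q) (components y v) (components y w) = g.form q v w := by
  rw [metricOf_coordMetric]
  have h := (mdifferentiable_of_mem_maximalAtlas hy).symm_comp_deriv hq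
  have e : ∀ v : TangentSpace (𝓡 m) q,
      mfderiv (𝓡 m) (𝓡 m) y.symm (y q) (components y v) = v := fun v =>
    congrArg (fun L => L v) h
  refine (g.form_congr (y.left_inv hq) _ _).trans ?_
  exact congrArg₂ (fun a b => g.form q a b) (e v) (e w)

theorem components_surjective (hy : y ∈ IsManifold.maximalAtlas (𝓡 m) ∞ N) {q : N}
    (hq : q ∈ y.source) (u : EuclideanSpace ℝ (Fin m)) :
    ∃ v : TangentSpace (𝓡 m) q, components y v = u :=
  ((mdifferentiable_of_mem_maximalAtlas hy).mfderiv_bijective hq).2 u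

theorem components_injective (hy : y ∈ IsManifold.maximalAtlas (𝓡 m) ∞ N) {q : N}
    (hq : q ∈ y.source) : Function.Injective fun v : TangentSpace (𝓡 m) q => components y v :=
  ((mdifferentiable_of_mem_maximalAtlas hy).mfderiv_bijective hq).1

theorem isLorentzian_metricOf (g : LorentzMetric m N)
    (hy : y ∈ IsManifold.maximalAtlas (𝓡 m) ∞ N) {z : EuclideanSpace ℝ (Fin m)}
    (hz : z ∈ y.target) : IsLorentzian (metricOf (coordMetric g.form y) z) := by
  obtain ⟨q, hq, rfl⟩ : ∃ q ∈ y.source, y q = z := ⟨y.symm z, y.map_target hz, y.right_inv hz⟩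
  obtain ⟨v, hv, hpos⟩ := g.lorentzian q
  refine ⟨components y v, by rwa [metricOf_components g hy hq], fun w hw h0 => ?_⟩
  obtain ⟨w, rfl⟩ := components_surjective hy hq w
  rw [metricOf_components g hy hq] at h0 ⊢
  refine hpos w (fun h => hw ?_) h0
  rw [h]
  exact map_zero _

theorem coordMetric_symm (g : LorentzMetric m N) (z : EuclideanSpace ℝ (Fin m)) (α β : Fin m) :
    coordMetric g.form y z α β = coordMetric g.form y z β α := g.symm _ _ _

/-- A kernel vector of the matrix would be orthogonal to everything, against nondegeneracy. -/
theorem det_coordMetric_ne_zero (g : LorentzMetric m N)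
    (hy : y ∈ IsManifold.maximalAtlas (𝓡 m) ∞ N) {z : EuclideanSpace ℝ (Fin m)}
    (hz : z ∈ y.target) : (coordMetric g.form y z).det ≠ 0 := by
  intro h0
  obtain ⟨v, hv, hv0⟩ := Matrix.exists_vecMul_eq_zero_iff.2 h0
  refine hv ?_
  have : WithLp.toLp 2 v = (0 : EuclideanSpace ℝ (Fin m)) := by
    refine (isLorentzian_metricOf g hy hz).nondegenerate fun w => ?_
    rw [metricOf_apply, coordInner, Finset.sum_comm]
    refine Finset.sum_eq_zero fun β _ => ?_
    rw [← Finset.sum_mul]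
    have := congrFun hv0 β
    simp only [Matrix.vecMul, dotProduct, Pi.zero_apply] at this
    have e : ∑ i, coordMetric g.form y z i β * (WithLp.toLp 2 v : EuclideanSpace ℝ (Fin m)) i = 0 :=
      by simpa [mul_comm] using this
    rw [e, zero_mul]
  simpa using congrArg WithLp.ofLp this

end ChartMetric

/-! ### Connection and constant curvature of the ambient metric in a chart. -/

section ChartMetric₃

variable {N : Type*} [TopologicalSpace N] [ChartedSpace (EuclideanSpace ℝ (Fin 3)) N]
  {y : OpenPartialHomeomorph N (EuclideanSpace ℝ (Fin 3))}

theorem LorentzMetric.isLeviCivita (g : LorentzMetric 3 N)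
    (hy : y ∈ IsManifold.maximalAtlas (𝓡 3) ∞ N) :
    IsLeviCivita y.target (metricOf (coordMetric g.form y)) (connOf (coordMetric g.form y)) :=
  isLeviCivita_connOf y.open_target (g.smooth y hy) (fun z _ => coordMetric_symm g z)
    fun _ hz => det_coordMetric_ne_zero g hy hz

theorem LorentzMetric.hasConstantCurvature (g : LorentzMetric 3 N)
    (hy : y ∈ IsManifold.maximalAtlas (𝓡 3) ∞ N) {c : ℝ}
    (hg : g.HasConstantSectionalCurvature c) :
    HasConstantCurvature y.target (metricOf (coordMetric g.form y))
      (connOf (coordMetric g.form y)) c := by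
  refine (g.isLeviCivita hy).hasConstantCurvature
    (fun z hz u hu => (isLorentzian_metricOf g hy hz).nondegenerate hu)
    (fun z hz => (isLorentzian_metricOf g hy hz).exists_gramDet_ne_zero (by simp))
    fun z hz u v huv => ?_
  rw [metricOf_curvatureOf y.open_target (g.smooth y hy) (fun z _ => coordMetric_symm g z)
    (fun _ hz => det_coordMetric_ne_zero g hy hz) hz]
  have := hg y hy z hz u v (by rwa [← gramDet_metricOf])
  rw [sectional, ← gramDet_metricOf, div_eq_iff huv] at this
  exact this

end ChartMetric₃

/-! ### Maps between manifolds in charts -/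

section CoordFun

variable {n m : ℕ} {M : Type*} [TopologicalSpace M] {N : Type*} [TopologicalSpace N]

/-- The map `y ∘ f ∘ x⁻¹`. -/
def coordFun (x : OpenPartialHomeomorph M (EuclideanSpace ℝ (Fin n)))
    (y : OpenPartialHomeomorph N (EuclideanSpace ℝ (Fin m))) (f : M → N)
    (z : EuclideanSpace ℝ (Fin n)) : EuclideanSpace ℝ (Fin m) := y (f (x.symm z))

variable {x x' : OpenPartialHomeomorph M (EuclideanSpace ℝ (Fin n))}
  {y y' : OpenPartialHomeomorph N (EuclideanSpace ℝ (Fin m))} {f : M → N} {p : M}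

theorem coordFun_apply (hp : p ∈ x.source) : coordFun x y f (x p) = y (f p) := by
  rw [coordFun, x.left_inv hp]

theorem coordFun_id_comp (hp : p ∈ x.source) (hfp : f p ∈ y.source) (hf : ContinuousAt f p) :
    coordFun x y' f =ᶠ[nhds (x p)] coordFun y y' id ∘ coordFun x y f := by
  have h₁ : Filter.Tendsto x.symm (nhds (x p)) (nhds p) := x.tendsto_symm hp
  filter_upwards [(hf.tendsto.comp h₁).eventually (y.open_source.mem_nhds hfp)] with z hz
  have hz : f (x.symm z) ∈ y.source := hz
  simp only [coordFun, Function.comp_apply, id]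
  rw [y.left_inv hz]

theorem coordFun_comp_id (hp : p ∈ x.source) (hp' : p ∈ x'.source) :
    coordFun x' y f =ᶠ[nhds (x' p)] coordFun x y f ∘ coordFun x' x id := by
  have h₁ : Filter.Tendsto x'.symm (nhds (x' p)) (nhds p) := x'.tendsto_symm hp'
  filter_upwards [h₁.eventually (x.open_source.mem_nhds hp)] with z hz
  simp only [coordFun, Function.comp_apply, id]
  rw [x.left_inv hz]

variable [ChartedSpace (EuclideanSpace ℝ (Fin n)) M] [ChartedSpace (EuclideanSpace ℝ (Fin m)) N]

theorem contDiffAt_coordFun (hx : x ∈ IsManifold.maximalAtlas (𝓡 n) ∞ M)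
    (hy : y ∈ IsManifold.maximalAtlas (𝓡 m) ∞ N) (hp : p ∈ x.source) (hfp : f p ∈ y.source)
    (hf : ContMDiffAt (𝓡 n) (𝓡 m) ∞ f p) : ContDiffAt ℝ ∞ (coordFun x y f) (x p) := by
  have h₁ : ContMDiffAt (𝓡 n) (𝓡 n) ∞ x.symm (x p) :=
    contMDiffAt_symm_of_mem_maximalAtlas hx (x.map_source hp)
  have h₂ : ContMDiffAt (𝓡 m) (𝓡 m) ∞ y (f p) := contMDiffAt_of_mem_maximalAtlas hy hfp
  have e := x.left_inv hp
  have h₃ : ContMDiffAt (𝓡 n) (𝓡 m) ∞ f (x.symm (x p)) := by rwa [e]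
  have h₄ : ContMDiffAt (𝓡 m) (𝓡 m) ∞ y ((f ∘ x.symm) (x p)) := by
    rwa [Function.comp_apply, e]
  exact (ContMDiffAt.comp (x p) h₄ (h₃.comp (x p) h₁)).contDiffAt

theorem fderiv_coordFun_components (hx : x ∈ IsManifold.maximalAtlas (𝓡 n) ∞ M)
    (hy : y ∈ IsManifold.maximalAtlas (𝓡 m) ∞ N) (hp : p ∈ x.source) (hfp : f p ∈ y.source)
    (hf : MDifferentiableAt (𝓡 n) (𝓡 m) f p) (v : TangentSpace (𝓡 n) p) :
    fderiv ℝ (coordFun x y f) (x p) (components x v) =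
      components y (mfderiv (𝓡 n) (𝓡 m) f p v) := by
  have e := x.left_inv hp
  have hxs := (mdifferentiable_of_mem_maximalAtlas hx).mdifferentiableAt_symm (x.map_source hp)
  have hxp := (mdifferentiable_of_mem_maximalAtlas hx).mdifferentiableAt hp
  have hyp := (mdifferentiable_of_mem_maximalAtlas hy).mdifferentiableAt hfp
  have hq : MDifferentiableAt (𝓡 n) (𝓡 m) (coordFun x y f) (x p) := by
    have h₃ : MDifferentiableAt (𝓡 n) (𝓡 m) f (x.symm (x p)) := by rwa [e]
    have h₄ : MDifferentiableAt (𝓡 m) (𝓡 m) y ((f ∘ x.symm) (x p)) := by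
      rwa [Function.comp_apply, e]
    exact MDifferentiableAt.comp (x p) h₄ (h₃.comp (x p) hxs)
  have k₁ : mfderiv (𝓡 n) (𝓡 m) (coordFun x y f ∘ x) p =
      (mfderiv (𝓡 n) (𝓡 m) (coordFun x y f) (x p)).comp (mfderiv (𝓡 n) (𝓡 n) x p) :=
    mfderiv_comp p hq hxp
  have k₂ : mfderiv (𝓡 n) (𝓡 m) (y ∘ f) p =
      (mfderiv (𝓡 m) (𝓡 m) y (f p)).comp (mfderiv (𝓡 n) (𝓡 m) f p) :=
    mfderiv_comp p hyp hf
  have ev : coordFun x y f ∘ x =ᶠ[nhds p] y ∘ f := by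
    filter_upwards [x.open_source.mem_nhds hp] with p' hp'
    exact coordFun_apply hp'
  have k₃ := ev.mfderiv_eq (I := 𝓡 n) (I' := 𝓡 m)
  have k₄ := congrArg (fun L => L v) ((k₁.symm.trans k₃).trans k₂)
  rw [mfderiv_eq_fderiv] at k₄
  exact k₄

theorem fderiv_coordFun_id (hx : x ∈ IsManifold.maximalAtlas (𝓡 n) ∞ M)
    (hx' : x' ∈ IsManifold.maximalAtlas (𝓡 n) ∞ M) (hp : p ∈ x.source) (hp' : p ∈ x'.source)
    (v : TangentSpace (𝓡 n) p) :
    fderiv ℝ (coordFun x x' id) (x p) (components x v) = components x' v := by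
  have h := fderiv_coordFun_components (f := id) hx hx' hp hp' mdifferentiableAt_id v
  rw [mfderiv_id] at h
  exact h

theorem contDiffAt_coordFun_id (hx : x ∈ IsManifold.maximalAtlas (𝓡 n) ∞ M)
    (hx' : x' ∈ IsManifold.maximalAtlas (𝓡 n) ∞ M) (hp : p ∈ x.source) (hp' : p ∈ x'.source) :
    ContDiffAt ℝ ∞ (coordFun x x' id) (x p) :=
  contDiffAt_coordFun (f := id) hx hx' hp hp' contMDiffAt_id

theorem injective_fderiv_coordFun_id (hx : x ∈ IsManifold.maximalAtlas (𝓡 n) ∞ M)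
    (hx' : x' ∈ IsManifold.maximalAtlas (𝓡 n) ∞ M) (hp : p ∈ x.source) (hp' : p ∈ x'.source) :
    Function.Injective (fderiv ℝ (coordFun x x' id) (x p)) := by
  intro u v huv
  obtain ⟨u, rfl⟩ := components_surjective hx hp u
  obtain ⟨v, rfl⟩ := components_surjective hx hp v
  rw [fderiv_coordFun_id hx hx' hp hp', fderiv_coordFun_id hx hx' hp hp'] at huv
  rw [components_injective hx' hp' huv]

end CoordFun

/-! ### Coordinate formulas for the fundamental forms. -/

section Forms

variable {n m : ℕ} {M : Type*} [TopologicalSpace M] {N : Type*} [TopologicalSpace N] [ChartedSpace (EuclideanSpace ℝ (Fin m)) N]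
  {x : OpenPartialHomeomorph M (EuclideanSpace ℝ (Fin n))}
  {y : OpenPartialHomeomorph N (EuclideanSpace ℝ (Fin m))} {f : M → N} {p : M}

theorem pd_apply {q : EuclideanSpace ℝ (Fin n) → EuclideanSpace ℝ (Fin m)}
    {z : EuclideanSpace ℝ (Fin n)} (hq : DifferentiableAt ℝ q z) (i : Fin n) (α : Fin m) :
    pd i (fun w => q w α) z = fderiv ℝ q z (EuclideanSpace.single i 1) α := by
  have := ((EuclideanSpace.proj α : EuclideanSpace ℝ (Fin m) →L[ℝ] ℝ).hasFDerivAt.comp z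
    hq.hasFDerivAt).fderiv
  exact congrArg (fun L => L (EuclideanSpace.single i 1)) this

theorem pd_pd_apply {q : EuclideanSpace ℝ (Fin n) → EuclideanSpace ℝ (Fin m)}
    {z : EuclideanSpace ℝ (Fin n)} (hq : ContDiffAt ℝ ∞ q z) (i j : Fin n) (α : Fin m) :
    pd i (pd j (fun w => q w α)) z =
      fderiv ℝ (fderiv ℝ q) z (EuclideanSpace.single i 1) (EuclideanSpace.single j 1) α := by
  have e : pd j (fun w => q w α) =ᶠ[nhds z]
      fun w => (fderiv ℝ q w (EuclideanSpace.single j 1)) α := by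
    filter_upwards [eventually_differentiableAt hq] with w hw using pd_apply hw j α
  have hd := differentiableAt_fderiv hq
  rw [pd, e.fderiv_eq, ← pd, pd_apply (q := fun w => fderiv ℝ q w (EuclideanSpace.single j 1))
    (hd.clm_apply (differentiableAt_const _)),
    fderiv_clm_apply hd (differentiableAt_const _)]
  simp

theorem firstForm_eq (g : LorentzMetric m N) (hp : p ∈ x.source)
    (hq : DifferentiableAt ℝ (coordFun x y f) (x p)) (i j : Fin n) :
    firstForm g x y f p i j = sliceFst (metricOf (coordMetric g.form y)) (coordFun x y f) (x p)
      (EuclideanSpace.single i 1) (EuclideanSpace.single j 1) := by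
  rw [sliceFst_apply, metricOf_apply, coordInner, coordFun_apply hp, firstForm, Matrix.of_apply]
  simp only [← pd_apply hq]
  rfl

theorem secondForm_eq (g : LorentzMetric m N) (hp : p ∈ x.source)
    (hq : ContDiffAt ℝ ∞ (coordFun x y f) (x p)) (ν : TangentSpace (𝓡 m) (f p)) (i j : Fin n) :
    secondForm g x y f p ν i j = sliceSnd (metricOf (coordMetric g.form y))
      (connOf (coordMetric g.form y)) (coordFun x y f) (components y ν) (x p)
      (EuclideanSpace.single i 1) (EuclideanSpace.single j 1) := by
  have symm : ∀ z u v, metricOf (coordMetric g.form y) z u v =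
      metricOf (coordMetric g.form y) z v u := fun z u v => by
    rw [metricOf_coordMetric, metricOf_coordMetric, g.symm]
  rw [sliceSnd_apply, symm, metricOf_apply, coordInner, coordFun_apply hp, secondForm,
    Matrix.of_apply]
  congr 1
  refine Finset.sum_congr rfl fun α _ => Finset.sum_congr rfl fun β _ => ?_
  congr 2
  rw [PiLp.add_apply, connOf_apply, ← pd_pd_apply hq]
  simp only [← pd_apply (hq.differentiableAt (by simp))]
  rfl

end Forms

/-! ### Chart independence of the trace and determinant of the Weingarten map. -/

section Curvatures

variable {M : Type*} [TopologicalSpace M] [ChartedSpace (EuclideanSpace ℝ (Fin 2)) M]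
  {N : Type*} [TopologicalSpace N] [ChartedSpace (EuclideanSpace ℝ (Fin 3)) N]
  {x x' : OpenPartialHomeomorph M (EuclideanSpace ℝ (Fin 2))}
  {y y' : OpenPartialHomeomorph N (EuclideanSpace ℝ (Fin 3))} {f : M → N} {p : M}

/-- The mean curvature of `f` at `p`, computed in the charts `x, y`. -/
def chartMean (g : LorentzMetric 3 N) (x : OpenPartialHomeomorph M (EuclideanSpace ℝ (Fin 2)))
    (y : OpenPartialHomeomorph N (EuclideanSpace ℝ (Fin 3))) (f : M → N) (p : M)
    (ν : TangentSpace (𝓡 3) (f p)) : ℝ :=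
  sliceMean (metricOf (coordMetric g.form y)) (connOf (coordMetric g.form y)) (coordFun x y f)
    (components y ν) (x p)

/-- The Gauss curvature of `f` at `p`, computed in the charts `x, y`. -/
def chartGauss (g : LorentzMetric 3 N) (x : OpenPartialHomeomorph M (EuclideanSpace ℝ (Fin 2)))
    (y : OpenPartialHomeomorph N (EuclideanSpace ℝ (Fin 3))) (f : M → N) (p : M)
    (ν : TangentSpace (𝓡 3) (f p)) : ℝ :=
  sliceGauss (metricOf (coordMetric g.form y)) (connOf (coordMetric g.form y)) (coordFun x y f)
    (components y ν) (x p)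

theorem chartCurv_target_eq (g : LorentzMetric 3 N)
    (hx : x ∈ IsManifold.maximalAtlas (𝓡 2) ∞ M)
    (hy : y ∈ IsManifold.maximalAtlas (𝓡 3) ∞ N) (hy' : y' ∈ IsManifold.maximalAtlas (𝓡 3) ∞ N)
    (hp : p ∈ x.source) (hfp : f p ∈ y.source) (hfp' : f p ∈ y'.source)
    (hf : ContMDiffAt (𝓡 2) (𝓡 3) ∞ f p) (ν : TangentSpace (𝓡 3) (f p)) :
    chartMean g x y' f p ν = chartMean g x y f p ν ∧
      chartGauss g x y' f p ν = chartGauss g x y f p ν := by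
  have hΩ : IsOpen (y.target ∩ y.symm ⁻¹' y'.source) :=
    y.isOpen_inter_preimage_symm y'.open_source
  have hq := contDiffAt_coordFun hx hy hp hfp hf
  have pt : ∀ z ∈ y.target ∩ y.symm ⁻¹' y'.source, ∃ q, q ∈ y.source ∧ q ∈ y'.source ∧ y q = z :=
    fun z hz => ⟨y.symm z, y.map_target hz.1, hz.2, y.right_inv hz.1⟩
  have hfz : coordFun x y f (x p) ∈ y.target ∩ y.symm ⁻¹' y'.source := by
    rw [coordFun_apply hp]
    exact ⟨y.map_source hfp, by rwa [Set.mem_preimage, y.left_inv hfp]⟩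
  obtain ⟨e₁, e₂⟩ := slice_comp_isometry (ψ := coordFun y y' id) (g.isLeviCivita hy)
    (g.isLeviCivita hy') hΩ Set.inter_subset_left
    (fun z hz => by
      obtain ⟨q, h₁, h₂, rfl⟩ := pt z hz
      exact (contDiffAt_coordFun_id hy hy' h₁ h₂).contDiffWithinAt)
    (fun z hz => by
      obtain ⟨q, h₁, h₂, rfl⟩ := pt z hz
      rw [coordFun_apply h₁]
      exact y'.map_source h₂)
    (fun z hz u v => by
      obtain ⟨q, h₁, h₂, rfl⟩ := pt z hz
      obtain ⟨u, rfl⟩ := components_surjective hy h₁ u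
      obtain ⟨v, rfl⟩ := components_surjective hy h₁ v
      rw [fderiv_coordFun_id hy hy' h₁ h₂, fderiv_coordFun_id hy hy' h₁ h₂, coordFun_apply h₁,
        metricOf_components g hy h₁]
      exact metricOf_components g hy' h₂ u v)
    hq hfz (components y ν)
  have en : fderiv ℝ (coordFun y y' id) (coordFun x y f (x p)) (components y ν) =
      components y' ν := by
    rw [coordFun_apply hp, fderiv_coordFun_id hy hy' hfp hfp']
  rw [en] at e₂
  have ev := coordFun_id_comp (y' := y') hp hfp hf.continuousAt
  rw [← sliceFst_congr ev] at e₁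
  rw [← sliceSnd_congr ev] at e₂
  constructor
  · rw [chartMean, chartMean, sliceMean, sliceMean, e₁, e₂]
  · rw [chartGauss, chartGauss, sliceGauss, sliceGauss, e₁, e₂]

/-- Normality of `ν` is essential here: it removes the second derivative of the transition map from
the second form. -/
theorem chartCurv_source_eq (g : LorentzMetric 3 N)
    (hx : x ∈ IsManifold.maximalAtlas (𝓡 2) ∞ M) (hx' : x' ∈ IsManifold.maximalAtlas (𝓡 2) ∞ M)
    (hy : y ∈ IsManifold.maximalAtlas (𝓡 3) ∞ N)
    (hp : p ∈ x.source) (hp' : p ∈ x'.source) (hfp : f p ∈ y.source)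
    (hf : ContMDiffAt (𝓡 2) (𝓡 3) ∞ f p) (ν : TangentSpace (𝓡 3) (f p))
    (hν : ∀ v : TangentSpace (𝓡 2) p, g.form (f p) (mfderiv (𝓡 2) (𝓡 3) f p v) ν = 0) :
    chartMean g x' y f p ν = chartMean g x y f p ν ∧
      chartGauss g x' y f p ν = chartGauss g x y f p ν := by
  have eP : coordFun x' x id (x' p) = x p := coordFun_apply hp'
  have hq : ContDiffAt ℝ ∞ (coordFun x y f) (coordFun x' x id (x' p)) := by
    rw [eP]; exact contDiffAt_coordFun hx hy hp hfp hf
  obtain ⟨e₁, e₂⟩ := sliceCurv_comp_right (metricOf (coordMetric g.form y))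
    (connOf (coordMetric g.form y)) hq (contDiffAt_coordFun_id hx' hx hp' hp)
    (n := components y ν) (fun w => by
      rw [eP]
      obtain ⟨w, rfl⟩ := components_surjective hx hp w
      rw [fderiv_coordFun_components hx hy hp hfp (hf.mdifferentiableAt (by simp)),
        coordFun_apply hp, metricOf_components g hy hfp, g.symm]
      exact hν w)
    (injective_fderiv_coordFun_id hx' hx hp' hp)
  rw [eP] at e₁ e₂
  have ev := coordFun_comp_id (y := y) (f := f) hp hp'
  constructor
  · rw [chartMean, chartMean, ← e₁, sliceMean, sliceMean, sliceFst_congr ev, sliceSnd_congr ev]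
  · rw [chartGauss, chartGauss, ← e₂, sliceGauss, sliceGauss, sliceFst_congr ev,
      sliceSnd_congr ev]

theorem trace_det_inv_mul {G h : Matrix (Fin 2) (Fin 2) ℝ} :
    (G⁻¹ * h).trace = (G 1 1 * h 0 0 - G 0 1 * h 1 0 - G 1 0 * h 0 1 + G 0 0 * h 1 1) /
        (G 0 0 * G 1 1 - G 0 1 * G 1 0) ∧
      (G⁻¹ * h).det = (h 0 0 * h 1 1 - h 0 1 * h 1 0) / (G 0 0 * G 1 1 - G 0 1 * G 1 0) := by
  constructor
  · rw [Matrix.inv_def, Ring.inverse_eq_inv', Matrix.det_fin_two, Matrix.adjugate_fin_two,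
      Matrix.smul_mul, Matrix.trace_smul, Matrix.trace_fin_two, smul_eq_mul, div_eq_inv_mul]
    congr 1
    simp [Matrix.mul_apply, Fin.sum_univ_two]
    ring
  · rw [Matrix.det_mul, Matrix.det_nonsing_inv, Ring.inverse_eq_inv', Matrix.det_fin_two,
      Matrix.det_fin_two, div_eq_inv_mul]

theorem trace_det_inv_mul_forms (g : LorentzMetric 3 N) (hp : p ∈ x.source)
    (hq : ContDiffAt ℝ ∞ (coordFun x y f) (x p)) (ν : TangentSpace (𝓡 3) (f p)) :
    ((firstForm g x y f p)⁻¹ * secondForm g x y f p ν).trace = chartMean g x y f p ν ∧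
      ((firstForm g x y f p)⁻¹ * secondForm g x y f p ν).det = chartGauss g x y f p ν := by
  have w := trace_det_inv_mul (G := firstForm g x y f p) (h := secondForm g x y f p ν)
  simp only [firstForm_eq g hp (hq.differentiableAt (by simp)), secondForm_eq g hp hq] at w
  simp only [chartMean, sliceMean, relTrace, pairDet, chartGauss, sliceGauss, relDet, stdVec]
  constructor
  · rw [w.1]
  · rw [w.2]

/-- The trace and the determinant of the Weingarten map may be computed in arbitrary charts. -/
theorem trace_det_weingarten [IsManifold (𝓡 2) ∞ M] [IsManifold (𝓡 3) ∞ N]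
    (g : LorentzMetric 3 N) (hx : x ∈ IsManifold.maximalAtlas (𝓡 2) ∞ M)
    (hy : y ∈ IsManifold.maximalAtlas (𝓡 3) ∞ N) (hp : p ∈ x.source) (hfp : f p ∈ y.source)
    (hf : ContMDiffAt (𝓡 2) (𝓡 3) ∞ f p) (ν : TangentSpace (𝓡 3) (f p))
    (hν : ∀ v : TangentSpace (𝓡 2) p, g.form (f p) (mfderiv (𝓡 2) (𝓡 3) f p v) ν = 0) :
    (weingarten (n := 2) g f p ν).trace = chartMean g x y f p ν ∧
      (weingarten (n := 2) g f p ν).det = chartGauss g x y f p ν := by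
  have hX : chartAt (EuclideanSpace ℝ (Fin 2)) p ∈ IsManifold.maximalAtlas (𝓡 2) ∞ M :=
    IsManifold.chart_mem_maximalAtlas p
  have hY : chartAt (EuclideanSpace ℝ (Fin 3)) (f p) ∈ IsManifold.maximalAtlas (𝓡 3) ∞ N :=
    IsManifold.chart_mem_maximalAtlas (f p)
  have hpX := mem_chart_source (EuclideanSpace ℝ (Fin 2)) p
  have hpY := mem_chart_source (EuclideanSpace ℝ (Fin 3)) (f p)
  have s := chartCurv_source_eq g hX hx hY hpX hp hpY hf ν hν
  have t := chartCurv_target_eq g hx hy hY hp hfp hpY hf ν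
  have w := trace_det_inv_mul_forms g hpX (contDiffAt_coordFun hX hY hpX hpY hf) ν
  exact ⟨w.1.trans (s.1.symm.trans t.1), w.2.trans (s.2.symm.trans t.2)⟩

end Curvatures

/-! ### Pairs of forms on the plane -/

section PlaneForms

theorem pairDet_stdVec_pos (g : EuclideanSpace ℝ (Fin 2) →L[ℝ] EuclideanSpace ℝ (Fin 2) →L[ℝ] ℝ)
    (gsymm : ∀ u v, g u v = g v u) (gpos : ∀ u, u ≠ 0 → 0 < g u u) :
    0 < pairDet (fun u v => g u v) (stdVec 0) (stdVec 1) := by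
  have p₀ : 0 < g (stdVec 0) (stdVec 0) := gpos _ (by simp [stdVec])
  set t := g (stdVec 0) (stdVec 1) / g (stdVec 0) (stdVec 0) with ht
  have p₁ : 0 < g (stdVec 1 - t • stdVec 0) (stdVec 1 - t • stdVec 0) :=
    gpos _ fun h0 => by
      have := congrArg (fun x : EuclideanSpace ℝ (Fin 2) => x 1) h0
      simp [stdVec] at this
  have e : pairDet (fun u v => g u v) (stdVec 0) (stdVec 1) =
      g (stdVec 0) (stdVec 0) * g (stdVec 1 - t • stdVec 0) (stdVec 1 - t • stdVec 0) := by
    simp only [map_sub, map_smul, sub_apply, smul_apply, smul_eq_mul, pairDet]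
    rw [gsymm (stdVec 1) (stdVec 0), ht]
    field_simp
    ring
  rw [e]
  exact mul_pos p₀ p₁

/-- A continuous bilinear form as a bilinear map. -/
def toBilin (g : EuclideanSpace ℝ (Fin 2) →L[ℝ] EuclideanSpace ℝ (Fin 2) →L[ℝ] ℝ) :
    EuclideanSpace ℝ (Fin 2) →ₗ[ℝ] EuclideanSpace ℝ (Fin 2) →ₗ[ℝ] ℝ :=
  (ContinuousLinearMap.coeLM ℝ).comp (g : EuclideanSpace ℝ (Fin 2) →ₗ[ℝ] _)

/-- In an orthonormal eigenbasis the inequality says that `(λ₁ - λ₂)²` is non-negative. -/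
theorem four_relDet_le (g h : EuclideanSpace ℝ (Fin 2) →L[ℝ] EuclideanSpace ℝ (Fin 2) →L[ℝ] ℝ)
    (gsymm : ∀ u v, g u v = g v u) (gpos : ∀ u, u ≠ 0 → 0 < g u u)
    (hsymm : ∀ u v, h u v = h v u) :
    4 * relDet (fun u v => g u v) (fun u v => h u v) (stdVec 0) (stdVec 1) ≤
      relTrace (fun u v => g u v) (fun u v => h u v) (stdVec 0) (stdVec 1) ^ 2 := by
  obtain ⟨u₁, u₂, g₁₁, g₂₂, g₁₂, h₁₂, -⟩ :=
    exists_orthonormal_diagonal (toBilin g) (toBilin h) gsymm hsymm gpos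
  have g₂₁ := (gsymm u₂ u₁).trans g₁₂
  have h₂₁ := (hsymm u₂ u₁).trans h₁₂
  change g u₁ u₁ = 1 at g₁₁
  change g u₂ u₂ = 1 at g₂₂
  change g u₁ u₂ = 0 at g₁₂
  change h u₁ u₂ = 0 at h₁₂
  change g u₂ u₁ = 0 at g₂₁
  change h u₂ u₁ = 0 at h₂₁
  have hd : u₁ 0 * u₂ 1 - u₁ 1 * u₂ 0 ≠ 0 := by
    intro h0
    have := pairDet_comb (toBilin g) (stdVec 0) (stdVec 1) (u₁ 0) (u₁ 1) (u₂ 0) (u₂ 1)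
    rw [h0, ← eq_stdVec_comb u₁, ← eq_stdVec_comb u₂] at this
    change g u₁ u₁ * g u₂ u₂ - g u₁ u₂ * g u₂ u₁ = _ at this
    rw [g₁₁, g₂₂, g₁₂, g₂₁] at this
    norm_num at this
  have t := relTrace_comb (toBilin g) (toBilin h) (stdVec 0) (stdVec 1) hd
  have d := relDet_comb (toBilin g) (toBilin h) (stdVec 0) (stdVec 1) hd
  rw [← eq_stdVec_comb, ← eq_stdVec_comb] at t d
  change relTrace (fun u v => g u v) (fun u v => h u v) u₁ u₂ =
    relTrace (fun u v => g u v) (fun u v => h u v) _ _ at t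
  change relDet (fun u v => g u v) (fun u v => h u v) u₁ u₂ =
    relDet (fun u v => g u v) (fun u v => h u v) _ _ at d
  rw [← t, ← d]
  simp only [relTrace, relDet, pairDet, g₁₁, g₂₂, g₁₂, g₂₁, h₁₂, h₂₁]
  nlinarith [sq_nonneg (h u₁ u₁ - h u₂ u₂)]

end PlaneForms

/-! ### The unit normal of a spacelike plane -/

section UnitNormal

variable {E : Type*} [NormedAddCommGroup E] [NormedSpace ℝ E]

theorem exists_isLorentzFrame {b : E →L[ℝ] E →L[ℝ] ℝ} {L : EuclideanSpace ℝ (Fin 2) →L[ℝ] E}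
    {n : E} (symm : ∀ u v, b u v = b v u) (pos : ∀ u, u ≠ 0 → 0 < b (L u) (L u))
    (normal : ∀ u, b (L u) n = 0) (unit : b n n = -1) :
    ∃ u₁ u₂, IsLorentzFrame b (L u₁) (L u₂) n := by
  obtain ⟨u₁, u₂, g₁₁, g₂₂, g₁₂, -, -⟩ :=
    exists_orthonormal_diagonal (toBilin (b.bilinearComp L L)) 0 (fun u v => symm _ _)
      (fun u v => rfl) pos
  exact ⟨u₁, u₂, symm, g₁₁, g₂₂, g₁₂, normal _, normal _, unit⟩

/-- The component of `w` orthogonal to `x₁, x₂`. -/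
def normalPart (b : E →L[ℝ] E →L[ℝ] ℝ) (x₁ x₂ w : E) : E :=
  w - (b x₁ x₁ * b x₂ x₂ - b x₁ x₂ * b x₂ x₁)⁻¹ •
    ((b x₂ x₂ * b x₁ w - b x₁ x₂ * b x₂ w) • x₁ + (b x₁ x₁ * b x₂ w - b x₂ x₁ * b x₁ w) • x₂)

/-- The unit normal of the plane of `x₁, x₂` on the side of `w`. -/
def unitNormal (b : E →L[ℝ] E →L[ℝ] ℝ) (x₁ x₂ w : E) : E :=
  (√(-b (normalPart b x₁ x₂ w) (normalPart b x₁ x₂ w)))⁻¹ • normalPart b x₁ x₂ w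

/-- Cramer's rule for the Gram matrix makes the remainder orthogonal to the whole plane, hence a
multiple of `n`; pairing with `n` gives the factor. -/
theorem normalPart_eq {b : E →L[ℝ] E →L[ℝ] ℝ} {L : EuclideanSpace ℝ (Fin 2) →L[ℝ] E}
    {n : E} (hE : Module.finrank ℝ E = 3) (symm : ∀ u v, b u v = b v u)
    (pos : ∀ u, u ≠ 0 → 0 < b (L u) (L u)) (normal : ∀ u, b (L u) n = 0) (unit : b n n = -1)
    (w : E) : normalPart b (L (stdVec 0)) (L (stdVec 1)) w = -b w n • n := by
  obtain ⟨u₁, u₂, F⟩ := exists_isLorentzFrame symm pos normal unit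
  have hdet := (pairDet_stdVec_pos (b.bilinearComp L L) (fun u v => symm _ _) pos).ne'
  change b (L (stdVec 0)) (L (stdVec 0)) * b (L (stdVec 1)) (L (stdVec 1)) -
    b (L (stdVec 0)) (L (stdVec 1)) * b (L (stdVec 1)) (L (stdVec 0)) ≠ 0 at hdet
  set x₁ := L (stdVec 0) with hx₁
  set x₂ := L (stdVec 1) with hx₂
  set P := normalPart b x₁ x₂ w with hP
  have i₁ : b x₁ P = 0 := by
    rw [hP, normalPart, map_sub, map_smul, map_add, map_smul, map_smul]
    simp only [smul_eq_mul]
    rw [symm x₂ x₁] at hdet ⊢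
    linear_combination -(b x₁ w) * inv_mul_cancel₀ hdet
  have i₂ : b x₂ P = 0 := by
    rw [hP, normalPart, map_sub, map_smul, map_add, map_smul, map_smul]
    simp only [smul_eq_mul]
    rw [symm x₂ x₁] at hdet ⊢
    linear_combination -(b x₂ w) * inv_mul_cancel₀ hdet
  have i : ∀ u, b P (L u) = 0 := fun u => by
    rw [symm, eq_stdVec_comb u, map_add, map_smul, map_smul, ← hx₁, ← hx₂, map_add, map_smul,
      map_smul, add_apply, smul_apply, smul_apply, i₁, i₂]
    simp
  have k := F.expand hE P
  rw [i, i] at k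
  have : b P n = b w n := by
    rw [hP, normalPart, map_sub, map_smul, map_add, map_smul, map_smul]
    simp [hx₁, hx₂, normal]
  rw [k, this]
  simp

/-- The sign of `b w n` selects the side. A normal known only pointwise is thereby recovered from
the tangent plane and the auxiliary vector `w`. -/
theorem unitNormal_eq {b : E →L[ℝ] E →L[ℝ] ℝ} {L : EuclideanSpace ℝ (Fin 2) →L[ℝ] E}
    {n : E} (hE : Module.finrank ℝ E = 3) (symm : ∀ u v, b u v = b v u)
    (pos : ∀ u, u ≠ 0 → 0 < b (L u) (L u)) (normal : ∀ u, b (L u) n = 0) (unit : b n n = -1)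
    {w : E} (hw : b w n < 0) :
    0 < -b (normalPart b (L (stdVec 0)) (L (stdVec 1)) w)
        (normalPart b (L (stdVec 0)) (L (stdVec 1)) w) ∧
      unitNormal b (L (stdVec 0)) (L (stdVec 1)) w = n := by
  have e : -b (normalPart b (L (stdVec 0)) (L (stdVec 1)) w)
        (normalPart b (L (stdVec 0)) (L (stdVec 1)) w) = (-b w n) ^ 2 := by
    rw [normalPart_eq hE symm pos normal unit, map_smul, map_smul, smul_apply, unit]
    simp only [smul_eq_mul]
    ring
  have hw' : 0 < -b w n := by linarith
  refine ⟨e ▸ pow_pos hw' 2, ?_⟩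
  rw [unitNormal, e, normalPart_eq hE symm pos normal unit, Real.sqrt_sq hw'.le,
    smul_smul, inv_mul_cancel₀ hw'.ne', one_smul]

end UnitNormal

/-! ### Smoothness of the geometry of the time slices -/

section SliceSmooth

variable {V X : Type*} [NormedAddCommGroup V] [NormedSpace ℝ V] [NormedAddCommGroup X]
  [NormedSpace ℝ X] {U : Set V} {J : Set ℝ}

/-- `J` may contain an end point, where only the derivative within the domain is available.
Restricted to spatial directions it is an ordinary derivative, since `U` is open. -/
theorem contDiffOn_slice_fderiv (hU : IsOpen U) (hJ : UniqueDiffOn ℝ J) {q : V × ℝ → X}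
    (hq : ContDiffOn ℝ ∞ q (U ×ˢ J)) :
    ContDiffOn ℝ ∞ (fun ζ : V × ℝ => fderiv ℝ (fun z => q (z, ζ.2)) ζ.1) (U ×ˢ J) := by
  have h := hq.fderivWithin (hU.uniqueDiffOn.prod hJ) (m := ∞) (by simp)
  have h' : ContDiffOn ℝ ∞ (fun ζ => (fderivWithin ℝ q (U ×ˢ J) ζ).comp
      (ContinuousLinearMap.inl ℝ V ℝ)) (U ×ˢ J) := h.clm_comp contDiffOn_const
  refine h'.congr fun ζ hζ => ?_
  have hd := ((hq.differentiableOn (by simp)) ζ hζ).hasFDerivWithinAt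
  have hi : HasFDerivAt (fun z : V => (z, ζ.2)) (ContinuousLinearMap.inl ℝ V ℝ) ζ.1 :=
    hasFDerivAt_prodMk_left ζ.1 ζ.2
  have := HasFDerivWithinAt.comp (s := U) ζ.1 (g := q) (f := fun z : V => (z, ζ.2)) hd
    hi.hasFDerivWithinAt fun z hz => ⟨hz, hζ.2⟩
  exact (this.hasFDerivAt (hU.mem_nhds hζ.1)).fderiv

variable {E : Type*} [NormedAddCommGroup E] [NormedSpace ℝ E]
  {Ω : Set E} {B : E → E →L[ℝ] E →L[ℝ] ℝ} {Γ : E → E →L[ℝ] E →L[ℝ] E}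
  {U : Set (EuclideanSpace ℝ (Fin 2))} {f n : EuclideanSpace ℝ (Fin 2) × ℝ → E}

/-- No regularity of `n` is assumed: on the side of `w` it equals the explicit expression
`unitNormal`, smooth in the first derivatives of `f`. -/
theorem contDiffOn_unitNormal (h : IsLeviCivita Ω B Γ) (hU : IsOpen U) (hJ : UniqueDiffOn ℝ J)
    (hf : ContDiffOn ℝ ∞ f (U ×ˢ J)) (hfΩ : ∀ ζ ∈ U ×ˢ J, f ζ ∈ Ω)
    (hE : Module.finrank ℝ E = 3) {w : E}
    (pos : ∀ ζ ∈ U ×ˢ J, ∀ u, u ≠ 0 → 0 < B (f ζ) (fderiv ℝ (fun z => f (z, ζ.2)) ζ.1 u)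
      (fderiv ℝ (fun z => f (z, ζ.2)) ζ.1 u))
    (normal : ∀ ζ ∈ U ×ˢ J, ∀ u, B (f ζ) (fderiv ℝ (fun z => f (z, ζ.2)) ζ.1 u) (n ζ) = 0)
    (unit : ∀ ζ ∈ U ×ˢ J, B (f ζ) (n ζ) (n ζ) = -1)
    (side : ∀ ζ ∈ U ×ˢ J, B (f ζ) w (n ζ) < 0) : ContDiffOn ℝ ∞ n (U ×ˢ J) := by
  have hD := contDiffOn_slice_fderiv hU hJ hf
  have hB : ContDiffOn ℝ ∞ (fun ζ => B (f ζ)) (U ×ˢ J) := h.smooth_metric.comp hf hfΩ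
  have d : ∀ i, ContDiffOn ℝ ∞ (fun ζ : EuclideanSpace ℝ (Fin 2) × ℝ =>
      fderiv ℝ (fun z => f (z, ζ.2)) ζ.1 (stdVec i)) (U ×ˢ J) := fun i =>
    hD.clm_apply contDiffOn_const
  have b : ∀ {p q : EuclideanSpace ℝ (Fin 2) × ℝ → E}, ContDiffOn ℝ ∞ p (U ×ˢ J) →
      ContDiffOn ℝ ∞ q (U ×ˢ J) → ContDiffOn ℝ ∞ (fun ζ => B (f ζ) (p ζ) (q ζ)) (U ×ˢ J) :=
    fun hp hq => (hB.clm_apply hp).clm_apply hq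
  have key := fun ζ (hζ : ζ ∈ U ×ˢ J) => unitNormal_eq (b := B (f ζ))
    (L := fderiv ℝ (fun z => f (z, ζ.2)) ζ.1) hE (h.metric_symm _ (hfΩ ζ hζ)) (pos ζ hζ)
    (normal ζ hζ) (unit ζ hζ) (side ζ hζ)
  have hw : ContDiffOn ℝ ∞ (fun _ : EuclideanSpace ℝ (Fin 2) × ℝ => w) (U ×ˢ J) :=
    contDiffOn_const
  have hP : ContDiffOn ℝ ∞ (fun ζ : EuclideanSpace ℝ (Fin 2) × ℝ => normalPart (B (f ζ))
      (fderiv ℝ (fun z => f (z, ζ.2)) ζ.1 (stdVec 0))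
      (fderiv ℝ (fun z => f (z, ζ.2)) ζ.1 (stdVec 1)) w) (U ×ˢ J) := by
    refine hw.sub (ContDiffOn.smul (ContDiffOn.inv ?_ fun ζ hζ =>
      (pairDet_stdVec_pos (sliceFst B (fun z => f (z, ζ.2)) ζ.1)
        (fun u v => h.metric_symm _ (hfΩ ζ hζ) _ _) (pos ζ hζ)).ne') (ContDiffOn.add ?_ ?_))
    · exact ((b (d 0) (d 0)).mul (b (d 1) (d 1))).sub ((b (d 0) (d 1)).mul (b (d 1) (d 0)))
    · exact (((b (d 1) (d 1)).mul (b (d 0) hw)).sub ((b (d 0) (d 1)).mul (b (d 1) hw))).smul (d 0)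
    · exact (((b (d 0) (d 0)).mul (b (d 1) hw)).sub ((b (d 1) (d 0)).mul (b (d 0) hw))).smul (d 1)
  refine ContDiffOn.congr (f := fun ζ : EuclideanSpace ℝ (Fin 2) × ℝ => unitNormal (B (f ζ))
      (fderiv ℝ (fun z => f (z, ζ.2)) ζ.1 (stdVec 0))
      (fderiv ℝ (fun z => f (z, ζ.2)) ζ.1 (stdVec 1)) w) ?_ fun ζ hζ => (key ζ hζ).2.symm
  exact ContDiffOn.smul (((b hP hP).neg.sqrt fun ζ hζ => (key ζ hζ).1.ne').inv
    fun ζ hζ => (Real.sqrt_pos.2 (key ζ hζ).1).ne') hP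

theorem contDiffOn_sliceCurv (h : IsLeviCivita Ω B Γ) (hU : IsOpen U) (hJ : UniqueDiffOn ℝ J)
    (hf : ContDiffOn ℝ ∞ f (U ×ˢ J)) (hfΩ : ∀ ζ ∈ U ×ˢ J, f ζ ∈ Ω)
    (hn : ContDiffOn ℝ ∞ n (U ×ˢ J))
    (pos : ∀ ζ ∈ U ×ˢ J, ∀ u, u ≠ 0 → 0 < B (f ζ) (fderiv ℝ (fun z => f (z, ζ.2)) ζ.1 u)
      (fderiv ℝ (fun z => f (z, ζ.2)) ζ.1 u)) :
    ContDiffOn ℝ ∞ (fun ζ => sliceMean B Γ (fun z => f (z, ζ.2)) (n ζ) ζ.1) (U ×ˢ J) ∧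
      ContDiffOn ℝ ∞ (fun ζ => sliceGauss B Γ (fun z => f (z, ζ.2)) (n ζ) ζ.1) (U ×ˢ J) := by
  have hD := contDiffOn_slice_fderiv hU hJ hf
  have hDD := contDiffOn_slice_fderiv hU hJ hD
  have hB : ContDiffOn ℝ ∞ (fun ζ => B (f ζ)) (U ×ˢ J) := h.smooth_metric.comp hf hfΩ
  have hΓ : ContDiffOn ℝ ∞ (fun ζ => Γ (f ζ)) (U ×ˢ J) := h.smooth_conn.comp hf hfΩ
  have g : ∀ u v, ContDiffOn ℝ ∞ (fun ζ : EuclideanSpace ℝ (Fin 2) × ℝ =>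
      sliceFst B (fun z => f (z, ζ.2)) ζ.1 u v) (U ×ˢ J) := fun u v =>
    (hB.clm_apply (hD.clm_apply contDiffOn_const)).clm_apply (hD.clm_apply contDiffOn_const)
  have k : ∀ u v, ContDiffOn ℝ ∞ (fun ζ : EuclideanSpace ℝ (Fin 2) × ℝ =>
      sliceSnd B Γ (fun z => f (z, ζ.2)) (n ζ) ζ.1 u v) (U ×ˢ J) := fun u v => by
    simp only [sliceSnd_apply]
    refine ((hB.clm_apply hn).clm_apply (ContDiffOn.add ?_ ?_)).neg
    · exact (hDD.clm_apply contDiffOn_const).clm_apply contDiffOn_const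
    · exact (hΓ.clm_apply (hD.clm_apply contDiffOn_const)).clm_apply
        (hD.clm_apply contDiffOn_const)
  have hne : ∀ ζ ∈ U ×ˢ J, pairDet (fun u v => sliceFst B (fun z => f (z, ζ.2)) ζ.1 u v)
      (stdVec 0) (stdVec 1) ≠ 0 := fun ζ hζ =>
    (pairDet_stdVec_pos (sliceFst B (fun z => f (z, ζ.2)) ζ.1)
        (fun u v => h.metric_symm _ (hfΩ ζ hζ) _ _) (pos ζ hζ)).ne'
  constructor
  · refine ContDiffOn.div ?_ (((g _ _).mul (g _ _)).sub ((g _ _).mul (g _ _))) hne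
    exact ((((g _ _).mul (k _ _)).sub ((g _ _).mul (k _ _))).sub ((g _ _).mul (k _ _))).add
      ((g _ _).mul (k _ _))
  · exact ContDiffOn.div (((k _ _).mul (k _ _)).sub ((k _ _).mul (k _ _)))
      (((g _ _).mul (g _ _)).sub ((g _ _).mul (g _ _))) hne

theorem four_sliceGauss_le (h : IsLeviCivita Ω B Γ) {q : EuclideanSpace ℝ (Fin 2) → E}
    {z : EuclideanSpace ℝ (Fin 2)} (hq : ContDiffAt ℝ ∞ q z) (hz : q z ∈ Ω)
    (pos : ∀ u, u ≠ 0 → 0 < B (q z) (fderiv ℝ q z u) (fderiv ℝ q z u)) (n : E) :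
    4 * sliceGauss B Γ q n z ≤ sliceMean B Γ q n z ^ 2 := by
  refine four_relDet_le _ _ (fun u v => h.metric_symm _ hz _ _) pos fun u v => ?_
  rw [sliceSnd_apply, sliceSnd_apply, h.torsion_free _ hz]
  congr 3
  exact hq.isSymmSndFDerivAt (by simpa using two_le_smooth) u v

/-- On an open set, the curvatures of the slices are the curvatures of the local flow. -/
theorem IsLocalFlow.sliceCurv_eq {O : Set (EuclideanSpace ℝ (Fin 2) × ℝ)}
    {φ : EuclideanSpace ℝ (Fin 2) × ℝ → ℝ} (F : IsLocalFlow Ω B O f n φ) (h : IsLeviCivita Ω B Γ)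
    {ζ : EuclideanSpace ℝ (Fin 2) × ℝ} (hζ : ζ ∈ O) :
    sliceMean B Γ (fun z => f (z, ζ.2)) (n ζ) ζ.1 = meanCurv B Γ f n ζ ∧
      sliceGauss B Γ (fun z => f (z, ζ.2)) (n ζ) ζ.1 = gaussCurv B Γ f n ζ := by
  have hd : ∀ u, fderiv ℝ (fun z => f (z, ζ.2)) ζ.1 u = fderiv ℝ f ζ (u, 0) := fun u =>
    fderiv_slice (F.differentiableAt F.smooth_f hζ) u
  have hdd : ∀ u v, fderiv ℝ (fderiv ℝ fun z => f (z, ζ.2)) ζ.1 u v =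
      fderiv ℝ (fderiv ℝ f) ζ (u, 0) (v, 0) := fun u v =>
    fderiv_fderiv_slice F.isOpen F.smooth_f hζ u v
  have e₁ : ∀ u v, sliceFst B (fun z => f (z, ζ.2)) ζ.1 u v = fstForm B f ζ u v := fun u v => by
    rw [sliceFst_apply, hd, hd]; rfl
  -- One form differentiates `f` twice, the other differentiates the normal; they agree by
  -- differentiating orthogonality.
  have e₂ : ∀ u v, sliceSnd B Γ (fun z => f (z, ζ.2)) (n ζ) ζ.1 u v = sndForm B Γ f n ζ u v :=
    fun u v => by
      rw [sliceSnd_apply, hd, hd, hdd, F.sndForm_eq h hζ, cov,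
        fderiv_fderiv_apply F.isOpen F.smooth_f contDiffOn_const hζ,
        h.metric_symm _ (F.maps ζ hζ)]
      simp
  constructor
  · simp only [sliceMean, meanCurv, relTrace, pairDet, e₁, e₂]
  · simp only [sliceGauss, gaussCurv, relDet, pairDet, e₁, e₂]

end SliceSmooth

/-! ### The time interval -/

section TimeInterval

variable {T : EReal}

theorem zero_mem_timeInterval (hT : 0 < T) : (0 : ℝ) ∈ timeInterval T := ⟨le_rfl, by simpa using hT⟩

theorem mem_timeInterval_of_le {s t : ℝ} (ht : t ∈ timeInterval T) (h0 : 0 ≤ s) (hst : s ≤ t) :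
    s ∈ timeInterval T := ⟨h0, lt_of_le_of_lt (by exact_mod_cast hst) ht.2⟩

theorem timeInterval_mem_nhds {t : ℝ} (ht : t ∈ timeInterval T) (h0 : 0 < t) :
    timeInterval T ∈ nhds t := by
  obtain ⟨r, hr, hrT⟩ := EReal.lt_iff_exists_real_btwn.1 ht.2
  filter_upwards [Ioo_mem_nhds h0 (EReal.coe_lt_coe_iff.1 hr)] with s hs
  exact ⟨hs.1.le, lt_trans (by exact_mod_cast hs.2) hrT⟩

theorem uniqueDiffOn_timeInterval (hT : 0 < T) : UniqueDiffOn ℝ (timeInterval T) := by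
  have hconv : Convex ℝ (timeInterval T) := Set.OrdConnected.convex
    ⟨fun a ha b hb c hc => mem_timeInterval_of_le hb (ha.1.trans hc.1) hc.2⟩
  obtain ⟨r, hr, hrT⟩ := EReal.lt_iff_exists_real_btwn.1 hT
  have hr' : 0 < r := by exact_mod_cast hr
  refine uniqueDiffOn_convex hconv ⟨r, mem_interior_iff_mem_nhds.2 ?_⟩
  exact timeInterval_mem_nhds ⟨hr'.le, hrT⟩ hr'

end TimeInterval

/-! ### Flow boxes -/

section FlowBox

variable {M : Type*} [TopologicalSpace M] [ChartedSpace (EuclideanSpace ℝ (Fin 2)) M]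
  {N : Type*} [TopologicalSpace N] [ChartedSpace (EuclideanSpace ℝ (Fin 3)) N]
  {x : OpenPartialHomeomorph M (EuclideanSpace ℝ (Fin 2))}
  {y : OpenPartialHomeomorph N (EuclideanSpace ℝ (Fin 3))}
  {κ : ℝ} {g : LorentzMetric 3 N} {T : EReal} {F : M → ℝ → N}
  {ν : ∀ (p : M) (t : ℝ), TangentSpace (𝓡 3) (F p t)}

/-- The family `F` in the charts `x, y`. -/
def flowMap (x : OpenPartialHomeomorph M (EuclideanSpace ℝ (Fin 2)))
    (y : OpenPartialHomeomorph N (EuclideanSpace ℝ (Fin 3))) (F : M → ℝ → N)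
    (ζ : EuclideanSpace ℝ (Fin 2) × ℝ) : EuclideanSpace ℝ (Fin 3) :=
  coordFun x y (fun p => F p ζ.2) ζ.1

/-- The unit normal in the charts `x, y`. -/
def flowNormal (x : OpenPartialHomeomorph M (EuclideanSpace ℝ (Fin 2)))
    (y : OpenPartialHomeomorph N (EuclideanSpace ℝ (Fin 3)))
    (ν : ∀ (p : M) (t : ℝ), TangentSpace (𝓡 3) (F p t))
    (ζ : EuclideanSpace ℝ (Fin 2) × ℝ) : EuclideanSpace ℝ (Fin 3) :=
  components y (ν (x.symm ζ.1) ζ.2)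

/-- A pair of charts and a product of open sets which is mapped by the flow into the second
chart. -/
structure IsFlowBox (T : EReal) (F : M → ℝ → N)
    (x : OpenPartialHomeomorph M (EuclideanSpace ℝ (Fin 2)))
    (y : OpenPartialHomeomorph N (EuclideanSpace ℝ (Fin 3)))
    (U : Set (EuclideanSpace ℝ (Fin 2))) (J : Set ℝ) : Prop where
  mem_source : x ∈ IsManifold.maximalAtlas (𝓡 2) ∞ M
  mem_target : y ∈ IsManifold.maximalAtlas (𝓡 3) ∞ N
  isOpen_space : IsOpen U
  isOpen_time : IsOpen J
  subset : U ⊆ x.target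
  maps : ∀ z ∈ U, ∀ t ∈ J ∩ timeInterval T, F (x.symm z) t ∈ y.source

variable {U : Set (EuclideanSpace ℝ (Fin 2))} {J : Set ℝ}

theorem IsFlowBox.flowMap_mem (b : IsFlowBox T F x y U J) {ζ : EuclideanSpace ℝ (Fin 2) × ℝ}
    (hζ : ζ ∈ U ×ˢ (J ∩ timeInterval T)) : flowMap x y F ζ ∈ y.target :=
  y.map_source (b.maps _ hζ.1 _ hζ.2)

theorem IsFlowBox.uniqueDiffOn (b : IsFlowBox T F x y U J) (hT : 0 < T) :
    UniqueDiffOn ℝ (J ∩ timeInterval T) := by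
  rw [Set.inter_comm]
  exact (uniqueDiffOn_timeInterval hT).inter b.isOpen_time

variable [IsManifold (𝓡 3) ∞ N] {τ : TimeOrientation g}

namespace IsLagrangianAngleFlow

theorem contMDiff_slice (hF : IsLagrangianAngleFlow (n := 2) κ g τ T F ν) {t : ℝ}
    (ht : t ∈ timeInterval T) : ContMDiff (𝓡 2) (𝓡 3) ∞ fun p => F p t := by
  rw [← contMDiffOn_univ]
  exact hF.smooth.comp (contMDiffOn_id.prodMk contMDiffOn_const) fun p _ => ⟨trivial, ht⟩

theorem contDiffOn_flowMap (hF : IsLagrangianAngleFlow (n := 2) κ g τ T F ν)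
    (b : IsFlowBox T F x y U J) :
    ContDiffOn ℝ ∞ (flowMap x y F) (U ×ˢ (J ∩ timeInterval T)) := by
  rw [← contMDiffOn_iff_contDiffOn]
  have h₁ : ContMDiffOn 𝓘(ℝ, EuclideanSpace ℝ (Fin 2) × ℝ) (𝓡 2) ∞
      (fun ζ : EuclideanSpace ℝ (Fin 2) × ℝ => x.symm ζ.1) (U ×ˢ (J ∩ timeInterval T)) :=
    (contMDiffOn_symm_of_mem_maximalAtlas b.mem_source).comp
      (contDiff_fst.contMDiff.contMDiffOn) fun ζ hζ => b.subset hζ.1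
  have h₂ : ContMDiffOn 𝓘(ℝ, EuclideanSpace ℝ (Fin 2) × ℝ) 𝓘(ℝ, ℝ) ∞
      (fun ζ : EuclideanSpace ℝ (Fin 2) × ℝ => ζ.2) (U ×ˢ (J ∩ timeInterval T)) :=
    contDiff_snd.contMDiff.contMDiffOn
  have h₃ := hF.smooth.comp (h₁.prodMk h₂) fun ζ hζ => ⟨trivial, hζ.2.2⟩
  exact (contMDiffOn_of_mem_maximalAtlas b.mem_target).comp h₃ fun ζ hζ => b.maps _ hζ.1 _ hζ.2

theorem fderiv_flowMap_slice (hF : IsLagrangianAngleFlow (n := 2) κ g τ T F ν)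
    (b : IsFlowBox T F x y U J) {ζ : EuclideanSpace ℝ (Fin 2) × ℝ}
    (hζ : ζ ∈ U ×ˢ (J ∩ timeInterval T)) (v : TangentSpace (𝓡 2) (x.symm ζ.1)) :
    fderiv ℝ (fun z => flowMap x y F (z, ζ.2)) ζ.1 (components x v) =
      components y (mfderiv (𝓡 2) (𝓡 3) (fun p => F p ζ.2) (x.symm ζ.1) v) := by
  have h := fderiv_coordFun_components (f := fun p => F p ζ.2) b.mem_source b.mem_target
    (x.map_target (b.subset hζ.1)) (b.maps _ hζ.1 _ hζ.2)
    ((hF.contMDiff_slice hζ.2.2).mdifferentiable (by simp) _) v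
  rw [x.right_inv (b.subset hζ.1)] at h
  exact h

theorem flowMap_spacelike (hF : IsLagrangianAngleFlow (n := 2) κ g τ T F ν)
    (b : IsFlowBox T F x y U J) {ζ : EuclideanSpace ℝ (Fin 2) × ℝ}
    (hζ : ζ ∈ U ×ˢ (J ∩ timeInterval T)) (u : EuclideanSpace ℝ (Fin 2)) (hu : u ≠ 0) :
    0 < metricOf (coordMetric g.form y) (flowMap x y F ζ)
      (fderiv ℝ (fun z => flowMap x y F (z, ζ.2)) ζ.1 u)
      (fderiv ℝ (fun z => flowMap x y F (z, ζ.2)) ζ.1 u) := by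
  obtain ⟨u, rfl⟩ := components_surjective b.mem_source (x.map_target (b.subset hζ.1)) u
  rw [hF.fderiv_flowMap_slice b hζ]
  refine lt_of_lt_of_eq (hF.spacelike _ hζ.2.2 (x.symm ζ.1) u fun h => hu ?_)
    (metricOf_components g b.mem_target (b.maps _ hζ.1 _ hζ.2) _ _).symm
  rw [h]
  exact map_zero _

theorem flowMap_normal (hF : IsLagrangianAngleFlow (n := 2) κ g τ T F ν)
    (b : IsFlowBox T F x y U J) {ζ : EuclideanSpace ℝ (Fin 2) × ℝ}
    (hζ : ζ ∈ U ×ˢ (J ∩ timeInterval T)) (u : EuclideanSpace ℝ (Fin 2)) :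
    metricOf (coordMetric g.form y) (flowMap x y F ζ)
      (fderiv ℝ (fun z => flowMap x y F (z, ζ.2)) ζ.1 u) (flowNormal x y ν ζ) = 0 := by
  obtain ⟨u, rfl⟩ := components_surjective b.mem_source (x.map_target (b.subset hζ.1)) u
  rw [hF.fderiv_flowMap_slice b hζ]
  exact (metricOf_components g b.mem_target (b.maps _ hζ.1 _ hζ.2) _ _).trans
    ((hF.normal _ hζ.2.2 (x.symm ζ.1)).normal u)

theorem flowNormal_unit (hF : IsLagrangianAngleFlow (n := 2) κ g τ T F ν)
    (b : IsFlowBox T F x y U J) {ζ : EuclideanSpace ℝ (Fin 2) × ℝ}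
    (hζ : ζ ∈ U ×ˢ (J ∩ timeInterval T)) :
    metricOf (coordMetric g.form y) (flowMap x y F ζ) (flowNormal x y ν ζ) (flowNormal x y ν ζ) =
      -1 :=
  (metricOf_components g b.mem_target (b.maps _ hζ.1 _ hζ.2) _ _).trans
    (hF.normal _ hζ.2.2 (x.symm ζ.1)).unit

end IsLagrangianAngleFlow

/-- Over the chart domain the fibre coordinate of the tangent bundle trivialisation at `q₀` is the
vector of chart components. -/
theorem TimeOrientation.continuousAt_components (τ : TimeOrientation g) (q₀ : N) :
    ContinuousAt (fun q => components (chartAt (EuclideanSpace ℝ (Fin 3)) q₀) (τ.field q)) q₀ := by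
  set e := trivializationAt (EuclideanSpace ℝ (Fin 3)) (TangentSpace (𝓡 3) : N → Type _) q₀
  have h₁ : ContinuousAt (fun q => (e ⟨q, τ.field q⟩).2) q₀ :=
    continuousAt_snd.comp (ContinuousAt.comp (g := e) (f := fun q =>
      (⟨q, τ.field q⟩ : TangentBundle (𝓡 3) N))
      (e.continuousOn.continuousAt (e.open_source.mem_nhds
        (e.mem_source.2 (FiberBundle.mem_baseSet_trivializationAt' q₀))))
      τ.continuous.continuousAt)
  refine h₁.congr ?_
  filter_upwards [(chartAt (EuclideanSpace ℝ (Fin 3)) q₀).open_source.mem_nhds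
    (mem_chart_source _ q₀)] with q hq
  have h := TangentBundle.continuousLinearMapAt_trivializationAt (I := 𝓡 3) hq
  have h' := congrArg (fun L => L (τ.field q)) h
  have hb : q ∈ e.baseSet := hq
  exact (Bundle.Trivialization.continuousLinearMapAt_apply_of_mem ℝ e hb _).symm.trans h'

/-- The box is small enough for the constant coordinate vector `w`, equal to the normal at `(p₀,
t₀)`, to stay timelike and on the future side. Hence `ν` stays on the side of `w` and is smooth up
to `t = 0`. -/
theorem exists_isFlowBox [IsManifold (𝓡 2) ∞ M] (hT : 0 < T)
    (hF : IsLagrangianAngleFlow (n := 2) κ g τ T F ν) (p₀ : M) {t₀ : ℝ}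
    (ht₀ : t₀ ∈ timeInterval T) :
    ∃ x y U J, IsFlowBox T F x y U J ∧ p₀ ∈ x.source ∧ x p₀ ∈ U ∧ t₀ ∈ J ∧
      ContDiffOn ℝ ∞ (flowNormal x y ν) (U ×ˢ (J ∩ timeInterval T)) := by
  set x := chartAt (EuclideanSpace ℝ (Fin 2)) p₀ with hx
  set y := chartAt (EuclideanSpace ℝ (Fin 3)) (F p₀ t₀) with hy
  have hxm : x ∈ IsManifold.maximalAtlas (𝓡 2) ∞ M := IsManifold.chart_mem_maximalAtlas p₀
  have hym : y ∈ IsManifold.maximalAtlas (𝓡 3) ∞ N := IsManifold.chart_mem_maximalAtlas _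
  have hp₀ : p₀ ∈ x.source := mem_chart_source _ p₀
  have hq₀ : F p₀ t₀ ∈ y.source := mem_chart_source _ _
  have hL := g.isLeviCivita hym
  set B := metricOf (coordMetric g.form y) with hB
  set w := components y (ν p₀ t₀) with hw
  have hN₀ := hF.normal t₀ ht₀ p₀
  have cB : ContinuousAt (fun q => B (y q)) (F p₀ t₀) :=
    ContinuousAt.comp (g := B) (f := y) (hL.smooth_metric.continuousOn.continuousAt
      (y.open_target.mem_nhds (y.map_source hq₀))) (y.continuousAt hq₀)
  have c₁ : ContinuousAt (fun q => B (y q) w w) (F p₀ t₀) :=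
    (cB.clm_apply continuousAt_const).clm_apply continuousAt_const
  have c₂ : ContinuousAt (fun q => B (y q) w (components y (τ.field q))) (F p₀ t₀) :=
    (cB.clm_apply continuousAt_const).clm_apply (τ.continuousAt_components _)
  have v₁ : B (y (F p₀ t₀)) w w < 0 := by
    refine lt_of_eq_of_lt (metricOf_components g hym hq₀ _ _) ?_
    rw [hN₀.unit]; norm_num
  have v₂ : B (y (F p₀ t₀)) w (components y (τ.field (F p₀ t₀))) < 0 :=
    lt_of_eq_of_lt (metricOf_components g hym hq₀ _ _) hN₀.future
  have hW : ∀ᶠ q in nhds (F p₀ t₀), q ∈ y.source ∧ B (y q) w w < 0 ∧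
      B (y q) w (components y (τ.field q)) < 0 :=
    Filter.Eventually.and (y.open_source.mem_nhds hq₀) ((c₁.eventually_lt_const v₁).and
      (c₂.eventually_lt_const v₂))
  have cF : ContinuousWithinAt (fun a : M × ℝ => F a.1 a.2) (Set.univ ×ˢ timeInterval T) (p₀, t₀) :=
    hF.smooth.continuousOn (p₀, t₀) ⟨trivial, ht₀⟩
  have hW' := cF.eventually hW
  rw [nhdsWithin_prod_eq, nhdsWithin_univ] at hW'
  obtain ⟨P, hP, Q, hQ, hPQ⟩ := Filter.eventually_prod_iff.1 hW'
  obtain ⟨A, hAP, hA, hpA⟩ := eventually_nhds_iff.1 hP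
  obtain ⟨J, hJ, htJ, hJQ⟩ := mem_nhdsWithin.1 hQ
  have box : IsFlowBox T F x y (x.target ∩ x.symm ⁻¹' A) J :=
    { mem_source := hxm
      mem_target := hym
      isOpen_space := x.isOpen_inter_preimage_symm hA
      isOpen_time := hJ
      subset := Set.inter_subset_left
      maps := fun z hz t ht => (hPQ (hAP _ hz.2) (hJQ ht)).1 }
  refine ⟨x, y, x.target ∩ x.symm ⁻¹' A, J, box, hp₀,
    ⟨x.map_source hp₀, by rwa [Set.mem_preimage, x.left_inv hp₀]⟩, htJ, ?_⟩
  refine contDiffOn_unitNormal (w := w) hL box.isOpen_space (box.uniqueDiffOn hT)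
    (hF.contDiffOn_flowMap box) (fun ζ hζ => box.flowMap_mem hζ) (by simp)
    (fun ζ hζ => hF.flowMap_spacelike box hζ) (fun ζ hζ => hF.flowMap_normal box hζ)
    (fun ζ hζ => hF.flowNormal_unit box hζ) fun ζ hζ => ?_
  obtain ⟨hs, s₁, s₂⟩ := hPQ (hAP _ hζ.1.2) (hJQ hζ.2)
  obtain ⟨u₁, u₂, fr⟩ := exists_isLorentzFrame (b := B (flowMap x y F ζ))
    (L := fderiv ℝ (fun z => flowMap x y F (z, ζ.2)) ζ.1)
    (hL.metric_symm _ (box.flowMap_mem hζ)) (hF.flowMap_spacelike box hζ)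
    (hF.flowMap_normal box hζ) (hF.flowNormal_unit box hζ)
  refine fr.inner_neg_of_timelike (by simp) (τ := components y (τ.field (F (x.symm ζ.1) ζ.2)))
    s₁ ?_ ?_ s₂
  · exact lt_of_eq_of_lt (metricOf_components g hym hs _ _) (τ.timelike _)
  · exact lt_of_eq_of_lt (metricOf_components g hym hs _ _)
      (hF.normal _ hζ.2.2 (x.symm ζ.1)).future

end FlowBox

/-! ### Principal curvatures in terms of trace and determinant -/

section PrincipalCurvatures

/-- The hypothesis is a non-negative discriminant; otherwise the multiset of real roots would be
empty. -/
theorem exists_charpoly_roots_eq (W : Matrix (Fin 2) (Fin 2) ℝ) (h : 4 * W.det ≤ W.trace ^ 2) :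
    ∃ a b : ℝ, W.charpoly.roots = {a, b} ∧ a + b = W.trace ∧ a * b = W.det := by
  set r := √(W.trace ^ 2 - 4 * W.det) with hr
  have hr2 : r ^ 2 = W.trace ^ 2 - 4 * W.det := Real.sq_sqrt (by linarith)
  have hab : (W.trace + r) / 2 * ((W.trace - r) / 2) = W.det := by linear_combination -hr2 / 4
  have hsum : (W.trace + r) / 2 + (W.trace - r) / 2 = W.trace := by ring
  refine ⟨(W.trace + r) / 2, (W.trace - r) / 2, ?_, hsum, hab⟩
  have e : W.charpoly = (Polynomial.X - Polynomial.C ((W.trace + r) / 2)) *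
      (Polynomial.X - Polynomial.C ((W.trace - r) / 2)) := by
    rw [Matrix.charpoly_fin_two]
    conv_lhs => rw [← hab, Polynomial.C_mul]
    conv_lhs =>
      enter [1, 2, 1]
      rw [← hsum, Polynomial.C_add]
    ring
  rw [e, Polynomial.roots_mul (mul_ne_zero (Polynomial.X_sub_C_ne_zero _)
    (Polynomial.X_sub_C_ne_zero _)), Polynomial.roots_X_sub_C, Polynomial.roots_X_sub_C]
  rfl

variable {M : Type*} [TopologicalSpace M] [ChartedSpace (EuclideanSpace ℝ (Fin 2)) M]
  {N : Type*} [TopologicalSpace N] [ChartedSpace (EuclideanSpace ℝ (Fin 3)) N]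

theorem curvature_invariants_eq (g : LorentzMetric 3 N) (f : M → N) (p : M)
    (ν : TangentSpace (𝓡 3) (f p)) {κ : ℝ} (hκ : 0 < κ)
    (h : 4 * (weingarten (n := 2) g f p ν).det ≤ (weingarten (n := 2) g f p ν).trace ^ 2) :
    gaussCurvature (n := 2) g f p ν = (weingarten (n := 2) g f p ν).det ∧
      secondFormNormSq (n := 2) g f p ν =
        (weingarten (n := 2) g f p ν).trace ^ 2 - 2 * (weingarten (n := 2) g f p ν).det ∧
      lagrangianAngle (n := 2) κ g f p ν = 1 / √κ * angleSum √κ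
        (weingarten (n := 2) g f p ν).trace (weingarten (n := 2) g f p ν).det := by
  obtain ⟨a, b, hr, hs, hp⟩ := exists_charpoly_roots_eq _ h
  rw [gaussCurvature, secondFormNormSq, lagrangianAngle, principalCurvatures, hr, ← hs, ← hp,
    angleSum_eq (Real.sqrt_pos.2 hκ)]
  simp only [Multiset.insert_eq_cons, Multiset.prod_cons, Multiset.prod_singleton,
    Multiset.map_cons, Multiset.map_singleton, Multiset.sum_cons, Multiset.sum_singleton, true_and,
    and_true]
  ring

end PrincipalCurvatures

/-! ### The curvatures along the flow -/

section FlowCurvature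

variable {M : Type*} [TopologicalSpace M] [ChartedSpace (EuclideanSpace ℝ (Fin 2)) M]
  {N : Type*} [TopologicalSpace N] [ChartedSpace (EuclideanSpace ℝ (Fin 3)) N]
  {κ : ℝ} {g : LorentzMetric 3 N} {T : EReal} {F : M → ℝ → N}
  {ν : ∀ (p : M) (t : ℝ), TangentSpace (𝓡 3) (F p t)}

/-- The mean curvature along the flow. -/
def flowMean (g : LorentzMetric 3 N) (F : M → ℝ → N)
    (ν : ∀ (p : M) (t : ℝ), TangentSpace (𝓡 3) (F p t)) (p : M) (t : ℝ) : ℝ :=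
  (weingarten (n := 2) g (fun p' => F p' t) p (ν p t)).trace

/-- The Gauss curvature along the flow. -/
def flowGauss (g : LorentzMetric 3 N) (F : M → ℝ → N)
    (ν : ∀ (p : M) (t : ℝ), TangentSpace (𝓡 3) (F p t)) (p : M) (t : ℝ) : ℝ :=
  (weingarten (n := 2) g (fun p' => F p' t) p (ν p t)).det

theorem hasDerivAt_time {V X : Type*} [NormedAddCommGroup V] [NormedSpace ℝ V]
    [NormedAddCommGroup X] [NormedSpace ℝ X] {A : V × ℝ → X} {z : V} {t : ℝ}
    (hA : DifferentiableAt ℝ A (z, t)) :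
    HasDerivAt (fun r => A (z, r)) (fderiv ℝ A (z, t) (0, 1)) t := by
  have h : HasDerivAt (fun r : ℝ => (z, r)) ((0 : V), (1 : ℝ)) t :=
    (hasDerivAt_const t z).prodMk (hasDerivAt_id t)
  exact HasFDerivAt.comp_hasDerivAt (f := fun r : ℝ => (z, r)) (l := A) t hA.hasFDerivAt h

theorem IsFlowBox.continuousWithinAt_of_eq
    {x : OpenPartialHomeomorph M (EuclideanSpace ℝ (Fin 2))}
    {y : OpenPartialHomeomorph N (EuclideanSpace ℝ (Fin 3))}
    {U : Set (EuclideanSpace ℝ (Fin 2))} {J : Set ℝ} (b : IsFlowBox T F x y U J)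
    {A : EuclideanSpace ℝ (Fin 2) × ℝ → ℝ} {a : M → ℝ → ℝ}
    (hA : ContinuousOn A (U ×ˢ (J ∩ timeInterval T)))
    (h : ∀ ζ ∈ U ×ˢ (J ∩ timeInterval T), a (x.symm ζ.1) ζ.2 = A ζ) {p : M} {t : ℝ}
    (hp : p ∈ x.source) (hpU : x p ∈ U) (htJ : t ∈ J) (ht : t ∈ timeInterval T) :
    ContinuousWithinAt (fun c : M × ℝ => a c.1 c.2) (Set.univ ×ˢ timeInterval T) (p, t) := by
  have hW : (x.source ∩ x ⁻¹' U) ×ˢ J ∈ nhds (p, t) :=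
    (((x.isOpen_inter_preimage b.isOpen_space)).prod b.isOpen_time).mem_nhds ⟨⟨hp, hpU⟩, htJ⟩
  set S : Set (M × ℝ) := ((x.source ∩ x ⁻¹' U) ×ˢ J) ∩ Set.univ ×ˢ timeInterval T with hSdef
  have hmaps : Set.MapsTo (fun c : M × ℝ => (x c.1, c.2)) S (U ×ˢ (J ∩ timeInterval T)) :=
    fun c hc => ⟨hc.1.1.2, hc.1.2, hc.2.2⟩
  have hc : ContinuousWithinAt (fun c : M × ℝ => (x c.1, c.2)) S (p, t) :=
    (((x.continuousAt hp).comp continuousAt_fst).prodMk continuousAt_snd).continuousWithinAt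
  have hSn : nhdsWithin (p, t) S = nhdsWithin (p, t) (Set.univ ×ˢ timeInterval T) :=
    nhdsWithin_inter_of_mem (mem_nhdsWithin_of_mem_nhds hW)
  have e : ∀ c ∈ S, a c.1 c.2 = A (x c.1, c.2) := fun c hc => by
    have := h _ (hmaps hc)
    simpa only [x.left_inv hc.1.1.1] using this
  have hpt : (p, t) ∈ S := ⟨⟨⟨hp, hpU⟩, htJ⟩, trivial, ht⟩
  have hAc : ContinuousWithinAt (A ∘ fun c : M × ℝ => (x c.1, c.2)) S (p, t) :=
    ContinuousWithinAt.comp (hA _ (hmaps hpt)) hc hmaps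
  rw [ContinuousWithinAt, ← hSn]
  exact hAc.congr e (e _ hpt)

variable [IsManifold (𝓡 3) ∞ N] {τ : TimeOrientation g}
  {x : OpenPartialHomeomorph M (EuclideanSpace ℝ (Fin 2))}
  {y : OpenPartialHomeomorph N (EuclideanSpace ℝ (Fin 3))}
  {U : Set (EuclideanSpace ℝ (Fin 2))} {J : Set ℝ}

namespace IsLagrangianAngleFlow

theorem hasDerivAt_flowMap (hF : IsLagrangianAngleFlow (n := 2) κ g τ T F ν)
    (b : IsFlowBox T F x y U J) {z : EuclideanSpace ℝ (Fin 2)} {t : ℝ} (hz : z ∈ U) (ht : t ∈ J)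
    (htT : t ∈ timeInterval T) (h0 : 0 < t) :
    HasDerivAt (fun r => flowMap x y F (z, r))
      (lagrangianAngle (n := 2) κ g (fun p' => F p' t) (x.symm z) (ν (x.symm z) t) •
        flowNormal x y ν (z, t)) t := by
  -- For `t > 0` the time interval is a neighbourhood of `t`, so the derivative within it is
  -- two-sided.
  have h₁ := (hF.evolution t htT (x.symm z)).hasMFDerivAt (timeInterval_mem_nhds htT h0)
  have h₂ := ((mdifferentiable_of_mem_maximalAtlas b.mem_target).mdifferentiableAt
    (b.maps _ hz _ ⟨ht, htT⟩)).hasMFDerivAt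
  let L : EuclideanSpace ℝ (Fin 3) →L[ℝ] EuclideanSpace ℝ (Fin 3) :=
    mfderiv (𝓡 3) (𝓡 3) y (F (x.symm z) t)
  let n : EuclideanSpace ℝ (Fin 3) := ν (x.symm z) t
  have h₃ : HasFDerivAt (fun r => flowMap x y F (z, r))
      (L.comp (ContinuousLinearMap.smulRight (1 : ℝ →L[ℝ] ℝ)
        (lagrangianAngle (n := 2) κ g (fun p' => F p' t) (x.symm z) (ν (x.symm z) t) • n))) t :=
    (HasMFDerivAt.comp t h₂ h₁).hasFDerivAt
  refine h₃.hasDerivAt.congr_deriv ?_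
  rw [ContinuousLinearMap.comp_apply, ContinuousLinearMap.smulRight_apply, one_apply_eq_self,
    one_smul, map_smul]
  rfl

variable [IsManifold (𝓡 2) ∞ M]

theorem flowCurv_eq_slice (hF : IsLagrangianAngleFlow (n := 2) κ g τ T F ν)
    (b : IsFlowBox T F x y U J) {ζ : EuclideanSpace ℝ (Fin 2) × ℝ}
    (hζ : ζ ∈ U ×ˢ (J ∩ timeInterval T)) :
    flowMean g F ν (x.symm ζ.1) ζ.2 = sliceMean (metricOf (coordMetric g.form y))
        (connOf (coordMetric g.form y)) (fun z => flowMap x y F (z, ζ.2)) (flowNormal x y ν ζ) ζ.1 ∧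
      flowGauss g F ν (x.symm ζ.1) ζ.2 = sliceGauss (metricOf (coordMetric g.form y))
        (connOf (coordMetric g.form y)) (fun z => flowMap x y F (z, ζ.2)) (flowNormal x y ν ζ)
        ζ.1 := by
  have h := trace_det_weingarten (f := fun p => F p ζ.2) g b.mem_source b.mem_target
    (x.map_target (b.subset hζ.1)) (b.maps _ hζ.1 _ hζ.2) (hF.contMDiff_slice hζ.2.2 _)
    (ν (x.symm ζ.1) ζ.2) (hF.normal _ hζ.2.2 _).normal
  rw [chartMean, chartGauss, x.right_inv (b.subset hζ.1)] at h
  exact h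

theorem four_flowGauss_le (hT : 0 < T) (hF : IsLagrangianAngleFlow (n := 2) κ g τ T F ν)
    (p : M) {t : ℝ} (ht : t ∈ timeInterval T) :
    4 * flowGauss g F ν p t ≤ flowMean g F ν p t ^ 2 := by
  obtain ⟨x, y, U, J, b, hp, hpU, htJ, -⟩ := exists_isFlowBox hT hF p ht
  have hζ : (x p, t) ∈ U ×ˢ (J ∩ timeInterval T) := ⟨hpU, htJ, ht⟩
  have h := hF.flowCurv_eq_slice b hζ
  simp only [x.left_inv hp] at h
  rw [h.1, h.2]
  refine four_sliceGauss_le (g.isLeviCivita b.mem_target) ?_ (b.flowMap_mem hζ)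
    (hF.flowMap_spacelike b hζ) _
  exact contDiffAt_coordFun (f := fun p => F p t) b.mem_source b.mem_target hp
    (by simpa only [x.left_inv hp] using b.maps _ hpU _ hζ.2) (hF.contMDiff_slice ht p)

theorem invariants_eq (hκ : 0 < κ) (hT : 0 < T) (hF : IsLagrangianAngleFlow (n := 2) κ g τ T F ν)
    (p : M) {t : ℝ} (ht : t ∈ timeInterval T) :
    gaussCurvature (n := 2) g (fun p' => F p' t) p (ν p t) = flowGauss g F ν p t ∧
      secondFormNormSq (n := 2) g (fun p' => F p' t) p (ν p t) =
        flowMean g F ν p t ^ 2 - 2 * flowGauss g F ν p t ∧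
      lagrangianAngle (n := 2) κ g (fun p' => F p' t) p (ν p t) =
        1 / √κ * angleSum √κ (flowMean g F ν p t) (flowGauss g F ν p t) :=
  curvature_invariants_eq g (fun p' => F p' t) p (ν p t) hκ (hF.four_flowGauss_le hT p ht)

/-- Includes `t = 0`, which the open flow charts do not reach; the maximum principle starts from
there. -/
theorem continuousOn_flowCurv (hT : 0 < T) (hF : IsLagrangianAngleFlow (n := 2) κ g τ T F ν) :
    ContinuousOn (fun a : M × ℝ => flowMean g F ν a.1 a.2) (Set.univ ×ˢ timeInterval T) ∧
      ContinuousOn (fun a : M × ℝ => flowGauss g F ν a.1 a.2) (Set.univ ×ˢ timeInterval T) := by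
  have key : ∀ a ∈ (Set.univ : Set M) ×ˢ timeInterval T,
      ContinuousWithinAt (fun a : M × ℝ => flowMean g F ν a.1 a.2) (Set.univ ×ˢ timeInterval T) a ∧
      ContinuousWithinAt (fun a : M × ℝ => flowGauss g F ν a.1 a.2)
        (Set.univ ×ˢ timeInterval T) a := by
    rintro ⟨p, t⟩ ⟨-, ht⟩
    obtain ⟨x, y, U, J, b, hp, hpU, htJ, hn⟩ := exists_isFlowBox hT hF p ht
    have hS := contDiffOn_sliceCurv (g.isLeviCivita b.mem_target) b.isOpen_space
      (b.uniqueDiffOn hT) (hF.contDiffOn_flowMap b) (fun ζ hζ => b.flowMap_mem hζ) hn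
      (fun ζ hζ => hF.flowMap_spacelike b hζ)
    exact ⟨b.continuousWithinAt_of_eq hS.1.continuousOn
        (fun ζ hζ => (hF.flowCurv_eq_slice b hζ).1) hp hpU htJ ht,
      b.continuousWithinAt_of_eq hS.2.continuousOn
        (fun ζ hζ => (hF.flowCurv_eq_slice b hζ).2) hp hpU htJ ht⟩
  exact ⟨fun a ha => (key a ha).1, fun a ha => (key a ha).2⟩

end IsLagrangianAngleFlow

end FlowCurvature

/-! ### Extrema along the flow -/

section FlowExtrema

variable {M : Type*} [TopologicalSpace M] [ChartedSpace (EuclideanSpace ℝ (Fin 2)) M]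
  {N : Type*} [TopologicalSpace N] [ChartedSpace (EuclideanSpace ℝ (Fin 3)) N]
  {κ : ℝ} {g : LorentzMetric 3 N} {T : EReal} {F : M → ℝ → N}
  {ν : ∀ (p : M) (t : ℝ), TangentSpace (𝓡 3) (F p t)}

/-- A local flow whose curvatures are those of `F`. -/
structure IsFlowChart (κ : ℝ) (g : LorentzMetric 3 N) (F : M → ℝ → N)
    (ν : ∀ (p : M) (t : ℝ), TangentSpace (𝓡 3) (F p t))
    (x : OpenPartialHomeomorph M (EuclideanSpace ℝ (Fin 2)))
    (y : OpenPartialHomeomorph N (EuclideanSpace ℝ (Fin 3)))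
    (O : Set (EuclideanSpace ℝ (Fin 2) × ℝ)) (φ : EuclideanSpace ℝ (Fin 2) × ℝ → ℝ) : Prop where
  mem_target : y ∈ IsManifold.maximalAtlas (𝓡 3) ∞ N
  flow : IsLocalFlow y.target (metricOf (coordMetric g.form y)) O (flowMap x y F)
    (flowNormal x y ν) φ
  meanCurv_eq : ∀ ζ ∈ O, meanCurv (metricOf (coordMetric g.form y))
    (connOf (coordMetric g.form y)) (flowMap x y F) (flowNormal x y ν) ζ =
      flowMean g F ν (x.symm ζ.1) ζ.2
  gaussCurv_eq : ∀ ζ ∈ O, gaussCurv (metricOf (coordMetric g.form y))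
    (connOf (coordMetric g.form y)) (flowMap x y F) (flowNormal x y ν) ζ =
      flowGauss g F ν (x.symm ζ.1) ζ.2
  speed_eq : ∀ ζ ∈ O, φ ζ =
    1 / √κ * angleSum √κ (flowMean g F ν (x.symm ζ.1) ζ.2) (flowGauss g F ν (x.symm ζ.1) ζ.2)

namespace IsFlowChart

variable {x : OpenPartialHomeomorph M (EuclideanSpace ℝ (Fin 2))}
  {y : OpenPartialHomeomorph N (EuclideanSpace ℝ (Fin 3))}
  {O : Set (EuclideanSpace ℝ (Fin 2) × ℝ)} {φ : EuclideanSpace ℝ (Fin 2) × ℝ → ℝ}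

theorem hasDerivAt_of_eq (c : IsFlowChart κ g F ν x y O φ) {A : EuclideanSpace ℝ (Fin 2) × ℝ → ℝ}
    {a : M → ℝ → ℝ} (hA : ContDiffOn ℝ ∞ A O) (h : ∀ ζ ∈ O, A ζ = a (x.symm ζ.1) ζ.2) {p : M}
    {t : ℝ} (hp : p ∈ x.source) (hO : (x p, t) ∈ O) :
    HasDerivAt (a p) (fderiv ℝ A (x p, t) (0, 1)) t := by
  have h₁ := hasDerivAt_time ((hA.contDiffAt (c.flow.isOpen.mem_nhds hO)).differentiableAt
    (by simp))
  refine h₁.congr_of_eventuallyEq ?_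
  have hc : Filter.Tendsto (fun r : ℝ => (x p, r)) (nhds t) (nhds (x p, t)) :=
    (Continuous.prodMk_right (x p)).continuousAt
  filter_upwards [hc.eventually (c.flow.isOpen.mem_nhds hO)] with r hr
  have := h _ hr
  simp only [x.left_inv hp] at this
  exact this.symm

/-- Extremality over the whole surface at time `t` is inherited by every coordinate line, where the
local evolution inequalities apply. -/
theorem angle (c : IsFlowChart κ g F ν x y O φ) (hκ : 0 < κ)
    (hg : g.HasConstantSectionalCurvature (-κ)) {p : M} {t : ℝ} (hp : p ∈ x.source)
    (hO : (x p, t) ∈ O) :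
    ∃ d, HasDerivAt (fun r => angleSum √κ (flowMean g F ν p r) (flowGauss g F ν p r)) d t ∧
      ((∀ q, angleSum √κ (flowMean g F ν q t) (flowGauss g F ν q t) ≤
          angleSum √κ (flowMean g F ν p t) (flowGauss g F ν p t)) →
        d ≤ -2 * angleSum √κ (flowMean g F ν p t) (flowGauss g F ν p t)) ∧
      ((∀ q, angleSum √κ (flowMean g F ν p t) (flowGauss g F ν p t) ≤
          angleSum √κ (flowMean g F ν q t) (flowGauss g F ν q t)) →
        -2 * angleSum √κ (flowMean g F ν p t) (flowGauss g F ν p t) ≤ d) := by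
  have hs := Real.sqrt_pos.2 hκ
  have hL := g.isLeviCivita c.mem_target
  have hC' : HasConstantCurvature y.target (metricOf (coordMetric g.form y))
      (connOf (coordMetric g.form y)) (-√κ ^ 2) := by
    rw [Real.sq_sqrt hκ.le]
    exact g.hasConstantCurvature c.mem_target hg
  have e : ∀ ζ ∈ O, angleSum √κ (meanCurv (metricOf (coordMetric g.form y))
      (connOf (coordMetric g.form y)) (flowMap x y F) (flowNormal x y ν) ζ)
      (gaussCurv (metricOf (coordMetric g.form y)) (connOf (coordMetric g.form y))
        (flowMap x y F) (flowNormal x y ν) ζ) =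
      angleSum √κ (flowMean g F ν (x.symm ζ.1) ζ.2) (flowGauss g F ν (x.symm ζ.1) ζ.2) :=
    fun ζ hζ => by rw [c.meanCurv_eq ζ hζ, c.gaussCurv_eq ζ hζ]
  have hsm := contDiffOn_angleSum hs (c.flow.smooth_meanCurv hL) (c.flow.smooth_gaussCurv hL)
    fun ζ hζ => c.flow.four_gaussCurv_le hL hC' (by simp) hζ
  have hφ : √κ * φ (x p, t) = angleSum √κ (flowMean g F ν p t) (flowGauss g F ν p t) := by
    have := c.speed_eq _ hO
    simp only [x.left_inv hp] at this
    rw [this]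
    field_simp
  have near : ∀ u : EuclideanSpace ℝ (Fin 2), ∀ᶠ r : ℝ in nhds 0,
      (x p, t) + r • (u, (0 : ℝ)) ∈ O := fun u => by
    have : Filter.Tendsto (fun r : ℝ => (x p, t) + r • (u, (0 : ℝ))) (nhds 0) (nhds (x p, t)) := by
      have hc : Continuous fun r : ℝ => (x p, t) + r • (u, (0 : ℝ)) := by fun_prop
      simpa using hc.tendsto 0
    exact this.eventually (c.flow.isOpen.mem_nhds hO)
  refine ⟨_, c.hasDerivAt_of_eq (a := fun p t =>
    angleSum √κ (flowMean g F ν p t) (flowGauss g F ν p t)) hsm e hp hO, fun hmax => ?_,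
    fun hmin => ?_⟩
  · rw [← hφ]
    refine c.flow.fderiv_angleSum_le_of_isLocalMax hL (by simp) hs hC' hO fun u => ?_
    filter_upwards [near u] with r hr
    rw [zero_smul, add_zero, ← mul_le_mul_iff_right₀ hs, hφ, c.speed_eq _ hr, ← mul_assoc,
      mul_one_div_cancel hs.ne', one_mul]
    simpa using hmax _
  · rw [← hφ]
    refine c.flow.le_fderiv_angleSum_of_isLocalMin hL (by simp) hs hC' hO fun u => ?_
    filter_upwards [near u] with r hr
    rw [zero_smul, add_zero, ← mul_le_mul_iff_right₀ hs, hφ, c.speed_eq _ hr, ← mul_assoc,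
      mul_one_div_cancel hs.ne', one_mul]
    simpa using hmin _

theorem cosAngle (c : IsFlowChart κ g F ν x y O φ) (hκ : 0 < κ)
    (hg : g.HasConstantSectionalCurvature (-κ)) {p : M} {t : ℝ} (hp : p ∈ x.source)
    (hO : (x p, t) ∈ O)
    (hmin : ∀ q, cosAngleDiff √κ (flowMean g F ν p t) (flowGauss g F ν p t) ≤
      cosAngleDiff √κ (flowMean g F ν q t) (flowGauss g F ν q t))
    (h0 : 0 < cosAngleDiff √κ (flowMean g F ν p t) (flowGauss g F ν p t))
    (h1 : cosAngleDiff √κ (flowMean g F ν p t) (flowGauss g F ν p t) < 1) :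
    ∃ d, HasDerivAt (fun r => cosAngleDiff √κ (flowMean g F ν p r) (flowGauss g F ν p r)) d t ∧
      -2 * cosAngleDiff √κ (flowMean g F ν p t) (flowGauss g F ν p t) ≤ d := by
  have hs := Real.sqrt_pos.2 hκ
  have hL := g.isLeviCivita c.mem_target
  have hC' : HasConstantCurvature y.target (metricOf (coordMetric g.form y))
      (connOf (coordMetric g.form y)) (-√κ ^ 2) := by
    rw [Real.sq_sqrt hκ.le]
    exact g.hasConstantCurvature c.mem_target hg
  have e : ∀ ζ ∈ O, cosAngleDiff √κ (meanCurv (metricOf (coordMetric g.form y))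
      (connOf (coordMetric g.form y)) (flowMap x y F) (flowNormal x y ν) ζ)
      (gaussCurv (metricOf (coordMetric g.form y)) (connOf (coordMetric g.form y))
        (flowMap x y F) (flowNormal x y ν) ζ) =
      cosAngleDiff √κ (flowMean g F ν (x.symm ζ.1) ζ.2) (flowGauss g F ν (x.symm ζ.1) ζ.2) :=
    fun ζ hζ => by rw [c.meanCurv_eq ζ hζ, c.gaussCurv_eq ζ hζ]
  have hsm := contDiffOn_cosAngleDiff hs (c.flow.smooth_meanCurv hL)
    (c.flow.smooth_gaussCurv hL) fun ζ hζ => c.flow.four_gaussCurv_le hL hC' (by simp) hζ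
  have e₀ := e _ hO
  simp only [x.left_inv hp] at e₀
  refine ⟨_, c.hasDerivAt_of_eq (a := fun p t =>
    cosAngleDiff √κ (flowMean g F ν p t) (flowGauss g F ν p t)) hsm e hp hO, ?_⟩
  rw [← e₀] at h0 h1 ⊢
  refine c.flow.le_fderiv_cosAngleDiff_of_isLocalMin hL (by simp) hs hC' (fun ζ hζ => ?_) hO ?_
    h0 h1
  · rw [c.speed_eq ζ hζ, c.meanCurv_eq ζ hζ, c.gaussCurv_eq ζ hζ]
  · filter_upwards [(isOpen_slice c.flow.isOpen t).mem_nhds hO] with z hz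
    rw [e₀, e _ hz]
    exact hmin _

end IsFlowChart

variable [IsManifold (𝓡 2) ∞ M] [IsManifold (𝓡 3) ∞ N] {τ : TimeOrientation g}

namespace IsLagrangianAngleFlow

/-- The speed is written through `H` and `K`, hence smooth across umbilics. Interior times keep the
domain open. -/
theorem exists_isFlowChart (hκ : 0 < κ) (hT : 0 < T)
    (hF : IsLagrangianAngleFlow (n := 2) κ g τ T F ν) (p₀ : M) {t₀ : ℝ}
    (ht₀ : t₀ ∈ timeInterval T) (h0 : 0 < t₀) :
    ∃ x y O φ, IsFlowChart κ g F ν x y O φ ∧ p₀ ∈ x.source ∧ (x p₀, t₀) ∈ O := by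
  obtain ⟨x, y, U, J, b, hp, hpU, htJ, hn⟩ := exists_isFlowBox hT hF p₀ ht₀
  set B := metricOf (coordMetric g.form y)
  set Γ := connOf (coordMetric g.form y)
  have hL := g.isLeviCivita b.mem_target
  set O : Set (EuclideanSpace ℝ (Fin 2) × ℝ) := U ×ˢ (J ∩ interior (timeInterval T)) with hO
  have hsub : O ⊆ U ×ˢ (J ∩ timeInterval T) :=
    Set.prod_mono_right (Set.inter_subset_inter_right _ interior_subset)
  have hOo : IsOpen O := b.isOpen_space.prod (b.isOpen_time.inter isOpen_interior)
  have hpos : ∀ ζ ∈ O, 0 < ζ.2 := fun ζ hζ => by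
    have : interior (timeInterval T) ⊆ interior (Set.Ici 0) := interior_mono fun t ht => ht.1
    rw [interior_Ici] at this
    exact this hζ.2.2
  have hf := (hF.contDiffOn_flowMap b).mono hsub
  have hS := contDiffOn_sliceCurv hL b.isOpen_space
    (b.uniqueDiffOn hT) (hF.contDiffOn_flowMap b) (fun ζ hζ => b.flowMap_mem hζ) hn
    (fun ζ hζ => hF.flowMap_spacelike b hζ)
  have hH : ContDiffOn ℝ ∞ (fun ζ => flowMean g F ν (x.symm ζ.1) ζ.2) O :=
    (hS.1.mono hsub).congr fun ζ hζ => (hF.flowCurv_eq_slice b (hsub hζ)).1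
  have hK : ContDiffOn ℝ ∞ (fun ζ => flowGauss g F ν (x.symm ζ.1) ζ.2) O :=
    (hS.2.mono hsub).congr fun ζ hζ => (hF.flowCurv_eq_slice b (hsub hζ)).2
  have hd : ∀ ζ ∈ O, ∀ u, fderiv ℝ (flowMap x y F) ζ (u, 0) =
      fderiv ℝ (fun z => flowMap x y F (z, ζ.2)) ζ.1 u := fun ζ hζ u =>
    (fderiv_slice ((hf.contDiffAt (hOo.mem_nhds hζ)).differentiableAt (by simp)) u).symm
  set φ : EuclideanSpace ℝ (Fin 2) × ℝ → ℝ := fun ζ => 1 / √κ *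
    angleSum √κ (flowMean g F ν (x.symm ζ.1) ζ.2) (flowGauss g F ν (x.symm ζ.1) ζ.2)
  have hflow : IsLocalFlow y.target B O (flowMap x y F) (flowNormal x y ν) φ :=
    { isOpen := hOo
      maps := fun ζ hζ => b.flowMap_mem (hsub hζ)
      smooth_f := hf
      smooth_ν := hn.mono hsub
      smooth_φ := contDiffOn_const.mul (contDiffOn_angleSum (Real.sqrt_pos.2 hκ) hH hK
        fun ζ hζ => hF.four_flowGauss_le hT _ (hsub hζ).2.2)
      spacelike := fun ζ hζ u hu => by
        rw [hd ζ hζ]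
        exact hF.flowMap_spacelike b (hsub hζ) u hu
      normal := fun ζ hζ u => by
        rw [hd ζ hζ]
        exact hF.flowMap_normal b (hsub hζ) u
      unit := fun ζ hζ => hF.flowNormal_unit b (hsub hζ)
      evolution := fun ζ hζ => by
        have h₁ := hF.hasDerivAt_flowMap b (hsub hζ).1 (hsub hζ).2.1 (hsub hζ).2.2 (hpos ζ hζ)
        have h₂ := hasDerivAt_time (A := flowMap x y F) (z := ζ.1) (t := ζ.2)
          ((hf.contDiffAt (hOo.mem_nhds hζ)).differentiableAt (by simp))
        rw [(hF.invariants_eq hκ hT (x.symm ζ.1) (hsub hζ).2.2).2.2] at h₁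
        exact h₂.unique h₁ }
  refine ⟨x, y, O, φ, ⟨b.mem_target, hflow, fun ζ hζ => ?_, fun ζ hζ => ?_, fun ζ hζ => rfl⟩, hp,
    hpU, htJ, mem_interior_iff_mem_nhds.2 (timeInterval_mem_nhds ht₀ h0)⟩
  · rw [(hF.flowCurv_eq_slice b (hsub hζ)).1, (hflow.sliceCurv_eq hL hζ).1]
  · rw [(hF.flowCurv_eq_slice b (hsub hζ)).2, (hflow.sliceCurv_eq hL hζ).2]

end IsLagrangianAngleFlow

end FlowExtrema

/-! ### The maximum principle -/

section MaximumPrinciple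

theorem exists_lt_of_hasDerivAt_neg {u : ℝ → ℝ} {t d : ℝ} (ht : 0 < t) (hd : HasDerivAt u d t)
    (hneg : d < 0) : ∃ s, 0 ≤ s ∧ s < t ∧ u t < u s := by
  have h := (hasDerivAt_iff_tendsto_slope.1 hd).eventually (gt_mem_nhds hneg)
  have h' : ∀ᶠ s in nhdsWithin t (Set.Iio t), slope u t s < 0 :=
    h.filter_mono (nhdsWithin_mono t fun s hs => ne_of_lt hs)
  obtain ⟨s, hs, hs0, hst⟩ := (h'.and (Ioo_mem_nhdsLT ht)).exists
  refine ⟨s, hs0.le, hst, ?_⟩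
  rw [slope_def_field, div_neg_iff] at hs
  rcases hs with hs | hs <;> linarith [hs.1, hs.2]

/-- A continuous function on a compact space that decreases in time wherever it touches the level
`C` from below stays below `C`. -/
theorem lt_of_first_touch {X : Type*} [TopologicalSpace X] [CompactSpace X] {u : X → ℝ → ℝ}
    {C r : ℝ}
    (hu : ContinuousOn (fun a : X × ℝ => u a.1 a.2) (Set.univ ×ˢ Set.Icc 0 r))
    (h0 : ∀ p, u p 0 < C)
    (touch : ∀ t, 0 < t → t ≤ r → ∀ p, u p t = C → (∀ q, u q t ≤ C) →
      ∃ d, d < 0 ∧ HasDerivAt (u p) d t) :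
    ∀ p, ∀ t ∈ Set.Icc 0 r, u p t < C := by
  by_contra! hbad
  obtain ⟨p₁, t₁, ht₁, hp₁⟩ := hbad
  have hK : IsCompact ((Set.univ : Set X) ×ˢ Set.Icc (0 : ℝ) r) := isCompact_univ.prod isCompact_Icc
  set S : Set (X × ℝ) := {a | a ∈ (Set.univ : Set X) ×ˢ Set.Icc (0 : ℝ) r ∧ C ≤ u a.1 a.2} with hS
  have hSc : IsCompact S := by
    obtain ⟨Z, hZ, hZe⟩ := (continuousOn_iff_isClosed.1 hu) (Set.Ici C) isClosed_Ici
    have : S = Z ∩ (Set.univ : Set X) ×ˢ Set.Icc (0 : ℝ) r := by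
      rw [← hZe]
      ext a
      exact ⟨fun h => ⟨h.2, h.1⟩, fun h => ⟨h.2, h.1⟩⟩
    rw [this, Set.inter_comm]
    exact hK.inter_right hZ
  -- Among the compact set of points where the level is reached, one of least time is the first
  -- touch.
  obtain ⟨⟨p, t⟩, ⟨⟨-, ht⟩, hpt⟩, hmin⟩ := hSc.exists_isMinOn ⟨(p₁, t₁), ⟨trivial, ht₁⟩, hp₁⟩
    continuous_snd.continuousOn
  have before : ∀ q s, 0 ≤ s → s < t → u q s < C := fun q s hs hst => by
    by_contra! hq
    have := hmin (show (q, s) ∈ S from ⟨⟨trivial, hs, hst.le.trans ht.2⟩, hq⟩)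
    exact absurd hst (not_lt.2 this)
  have tpos : 0 < t := by
    refine lt_of_le_of_ne ht.1 fun h => ?_
    rw [← h] at hpt
    exact absurd (h0 p) (not_lt.2 hpt)
  have le_now : ∀ q, u q t ≤ C := fun q => by
    have hc : ContinuousWithinAt (fun s => u q s) (Set.Ico 0 t) t := by
      have h₁ : ContinuousWithinAt (fun a : X × ℝ => u a.1 a.2) (Set.univ ×ˢ Set.Icc 0 r) (q, t) :=
        hu (q, t) ⟨trivial, ht⟩
      exact ContinuousWithinAt.comp (g := fun a : X × ℝ => u a.1 a.2) (f := fun s : ℝ => (q, s))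
        h₁ (Continuous.prodMk_right q).continuousWithinAt
        fun s hs => ⟨trivial, hs.1, hs.2.le.trans ht.2⟩
    have : (nhdsWithin t (Set.Ico 0 t)).NeBot := by
      rw [← mem_closure_iff_nhdsWithin_neBot, closure_Ico tpos.ne]
      exact ⟨tpos.le, le_rfl⟩
    refine le_of_tendsto hc.tendsto ?_
    filter_upwards [self_mem_nhdsWithin] with s hs
    exact (before q s hs.1 hs.2).le
  -- A negative derivative at the touch puts slightly earlier values above `C`, a contradiction.
  obtain ⟨d, hd, hder⟩ := touch t tpos ht.2 p (le_antisymm (le_now p) hpt) le_now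
  obtain ⟨s, hs, hst, hlt⟩ := exists_lt_of_hasDerivAt_neg tpos hder hd
  have := before p s hs hst
  have hpt' : C ≤ u p t := hpt
  linarith

/-- Compactness leaves room below a strict bound. The floor `c` keeps the new level above a
prescribed number, also when the space is empty. -/
theorem exists_uniform_lt {X : Type*} [TopologicalSpace X] [CompactSpace X] {u : X → ℝ}
    (hu : Continuous u) {C c : ℝ} (hc : c < C) (h : ∀ p, u p < C) : ∃ C', c < C' ∧ C' < C ∧
      ∀ p, u p < C' := by
  rcases isEmpty_or_nonempty X with hX | hX
  · exact ⟨(c + C) / 2, by linarith, by linarith, fun p => hX.elim p⟩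
  · obtain ⟨p, -, hp⟩ := isCompact_univ.exists_isMaxOn Set.univ_nonempty hu.continuousOn
    have hm : max c (u p) < C := max_lt hc (h p)
    refine ⟨(max c (u p) + C) / 2, ?_, by linarith, fun q => ?_⟩
    · linarith [le_max_left c (u p)]
    · have : u q ≤ u p := hp trivial
      linarith [le_max_right c (u p)]

end MaximumPrinciple

/-! ### Continuity of the angle functions and the curvature bounds they encode. -/

section Angles

theorem continuousOn_angleSum {X : Type*} [TopologicalSpace X] {S : Set X} {s : ℝ} (hs : 0 < s)
    {H K : X → ℝ} (hH : ContinuousOn H S) (hK : ContinuousOn K S)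
    (hHK : ∀ a ∈ S, 4 * K a ≤ H a ^ 2) : ContinuousOn (fun a => angleSum s (H a) (K a)) S := by
  have hz : ContinuousOn (fun a => (⟨s ^ 2 - K a, s * H a⟩ : ℂ)) S :=
    Complex.equivRealProdCLM.symm.continuous.comp_continuousOn
      ((continuousOn_const.sub hK).prodMk (continuousOn_const.mul hH))
  exact Complex.continuous_im.comp_continuousOn
    (hz.clog fun a ha => mem_slitPlane_of_le hs (hHK a ha))

/-- The inequality `s⁴ ≤ (s² + a²)(s² + b²)` in terms of `H` and `K`. -/
theorem pow_four_le_radicand {s H K : ℝ} (h : 4 * K ≤ H ^ 2) :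
    s ^ 4 ≤ (s ^ 2 - K) ^ 2 + s ^ 2 * H ^ 2 := by
  nlinarith [mul_le_mul_of_nonneg_left h (sq_nonneg s), sq_nonneg K, mul_nonneg (sq_nonneg s)
    (sq_nonneg H)]

theorem continuousOn_cosAngleDiff {X : Type*} [TopologicalSpace X] {S : Set X} {s : ℝ}
    (hs : 0 < s) {H K : X → ℝ} (hH : ContinuousOn H S) (hK : ContinuousOn K S)
    (hHK : ∀ a ∈ S, 4 * K a ≤ H a ^ 2) : ContinuousOn (fun a => cosAngleDiff s (H a) (K a)) S := by
  refine (continuousOn_const.add hK).div ?_ fun a ha =>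
    (Real.sqrt_pos.2 ((pow_pos hs 4).trans_le (pow_four_le_radicand (hHK a ha)))).ne'
  exact (((continuousOn_const.sub hK).pow 2).add (continuousOn_const.mul (hH.pow 2))).sqrt

theorem cosAngleDiff_pos_iff {s H K : ℝ} (hs : 0 < s) (h : 4 * K ≤ H ^ 2) :
    0 < cosAngleDiff s H K ↔ 0 < s ^ 2 + K := by
  have hr := Real.sqrt_pos.2 ((pow_pos hs 4).trans_le (pow_four_le_radicand h))
  rw [cosAngleDiff]
  exact ⟨fun h0 => (div_pos_iff_of_pos_right hr).1 h0, fun h0 => div_pos h0 hr⟩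

/-- A positive real part places the argument strictly between `-π/2` and `π/2`. -/
theorem abs_angleSum_lt {s H K : ℝ} (hK : K < s ^ 2) : |angleSum s H K| < Real.pi / 2 := by
  rw [angleSum, Complex.log_im, Complex.abs_arg_lt_pi_div_two_iff]
  left
  simpa using hK

/-- The consequences of an angle bound: `s² - K ≥ s² cos Θ` and `s |H| ≤ (s² - K) tan Θ`. -/
theorem bounds_of_abs_angleSum_lt {s H K Θ : ℝ} (hs : 0 < s) (h : 4 * K ≤ H ^ 2)
    (hΘ : |angleSum s H K| < Θ) (hΘ' : Θ < Real.pi / 2) :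
    s ^ 2 * Real.cos Θ ≤ s ^ 2 - K ∧ s * |H| * Real.cos Θ ≤ s ^ 2 - K := by
  set z : ℂ := ⟨s ^ 2 - K, s * H⟩ with hz
  have harg : angleSum s H K = z.arg := by rw [angleSum, Complex.log_im]
  rw [harg] at hΘ
  have hre : ‖z‖ * Real.cos z.arg = s ^ 2 - K := Complex.norm_mul_cos_arg z
  have him : ‖z‖ * Real.sin z.arg = s * H := Complex.norm_mul_sin_arg z
  have hcos : Real.cos Θ ≤ Real.cos z.arg := by
    rw [← Real.cos_abs z.arg]
    exact Real.cos_le_cos_of_nonneg_of_le_pi (abs_nonneg _) (by linarith [Real.pi_pos]) hΘ.le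
  have hc0 : 0 ≤ Real.cos Θ := (Real.cos_pos_of_mem_Ioo
    ⟨by linarith [abs_nonneg z.arg, Real.pi_pos], hΘ'⟩).le
  -- The modulus is bounded below independently of the curvatures, which makes the bound on `s² - K`
  -- uniform.
  have hnorm : s ^ 2 ≤ ‖z‖ := by
    have h₁ : ‖z‖ ^ 2 = (s ^ 2 - K) ^ 2 + s ^ 2 * H ^ 2 := by
      rw [Complex.sq_norm, Complex.normSq_apply, hz]; ring
    refine abs_le_of_sq_le_sq' ?_ (norm_nonneg z) |>.2
    rw [h₁]
    linarith [pow_four_le_radicand (s := s) h]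
  have hHz : s * |H| ≤ ‖z‖ := by
    have := Complex.abs_im_le_norm z
    rwa [hz, abs_mul, abs_of_pos hs] at this
  rw [← hre]
  exact ⟨mul_le_mul hnorm hcos hc0 (norm_nonneg z), mul_le_mul hHz hcos hc0 (norm_nonneg z)⟩

end Angles

/-! ### Preservation of the curvature bounds -/

section Preservation

variable {M : Type*} [TopologicalSpace M] [ChartedSpace (EuclideanSpace ℝ (Fin 2)) M]
  [IsManifold (𝓡 2) ∞ M]
  {N : Type*} [TopologicalSpace N] [ChartedSpace (EuclideanSpace ℝ (Fin 3)) N]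
  [IsManifold (𝓡 3) ∞ N]
  {κ : ℝ} {g : LorentzMetric 3 N} {τ : TimeOrientation g} {T : EReal} {F : M → ℝ → N}
  {ν : ∀ (p : M) (t : ℝ), TangentSpace (𝓡 3) (F p t)}

namespace IsLagrangianAngleFlow

theorem continuousOn_angle (hκ : 0 < κ) (hT : 0 < T)
    (hF : IsLagrangianAngleFlow (n := 2) κ g τ T F ν) :
    ContinuousOn (fun a : M × ℝ => angleSum √κ (flowMean g F ν a.1 a.2) (flowGauss g F ν a.1 a.2))
      (Set.univ ×ˢ timeInterval T) :=
  continuousOn_angleSum (Real.sqrt_pos.2 hκ) (hF.continuousOn_flowCurv hT).1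
    (hF.continuousOn_flowCurv hT).2 fun a ha => hF.four_flowGauss_le hT a.1 ha.2

/-- At a first touch of the level `Θ > 0` the angle equation gives a time derivative of at most `-2Θ
< 0`. The lower bound is the same argument for the negated angle, with minima in place of maxima. -/
theorem abs_angle_lt [CompactSpace M] (hκ : 0 < κ) (hT : 0 < T)
    (hg : g.HasConstantSectionalCurvature (-κ))
    (hF : IsLagrangianAngleFlow (n := 2) κ g τ T F ν) {Θ : ℝ} (hΘ : 0 < Θ)
    (h0 : ∀ p, |angleSum √κ (flowMean g F ν p 0) (flowGauss g F ν p 0)| < Θ)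
    (p : M) {t : ℝ} (ht : t ∈ timeInterval T) :
    |angleSum √κ (flowMean g F ν p t) (flowGauss g F ν p t)| < Θ := by
  have hsub : (Set.univ : Set M) ×ˢ Set.Icc 0 t ⊆ Set.univ ×ˢ timeInterval T :=
    Set.prod_mono_right fun r hr => mem_timeInterval_of_le ht hr.1 hr.2
  have hc := (hF.continuousOn_angle hκ hT).mono hsub
  rw [abs_lt]
  constructor
  · have := lt_of_first_touch (C := Θ)
      (u := fun p t => -angleSum √κ (flowMean g F ν p t) (flowGauss g F ν p t)) hc.neg
      (fun p => (neg_le_abs _).trans_lt (h0 p)) (fun r hr hrt p hp hq => by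
        have hrT := mem_timeInterval_of_le ht hr.le hrt
        obtain ⟨x, y, O, φ, c, hpx, hO⟩ := hF.exists_isFlowChart hκ hT p hrT hr
        obtain ⟨d, hd, -, hmin⟩ := c.angle hκ hg hpx hO
        have := hmin fun q => by have := hq q; linarith
        exact ⟨-d, by linarith, hd.neg⟩) p t ⟨ht.1, le_rfl⟩
    linarith
  · exact lt_of_first_touch (C := Θ)
      (u := fun p t => angleSum √κ (flowMean g F ν p t) (flowGauss g F ν p t)) hc
      (fun p => (le_abs_self _).trans_lt (h0 p)) (fun r hr hrt p hp hq => by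
        have hrT := mem_timeInterval_of_le ht hr.le hrt
        obtain ⟨x, y, O, φ, c, hpx, hO⟩ := hF.exists_isFlowChart hκ hT p hrT hr
        obtain ⟨d, hd, hmax, -⟩ := c.angle hκ hg hpx hO
        have := hmax fun q => by have := hq q; linarith
        exact ⟨d, by linarith, hd⟩) p t ⟨ht.1, le_rfl⟩

/-- The local estimate is `v' ≥ -2v` at a minimum. Any exponent above 2 makes the derivative of `v *
exp (3 t)` strictly positive there, so its minimum cannot drop to a smaller level. -/
theorem cosAngle_pos [CompactSpace M] (hκ : 0 < κ) (hT : 0 < T)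
    (hg : g.HasConstantSectionalCurvature (-κ))
    (hF : IsLagrangianAngleFlow (n := 2) κ g τ T F ν)
    (h0 : ∀ p, 0 < cosAngleDiff √κ (flowMean g F ν p 0) (flowGauss g F ν p 0))
    (p : M) {t : ℝ} (ht : t ∈ timeInterval T) :
    0 < cosAngleDiff √κ (flowMean g F ν p t) (flowGauss g F ν p t) := by
  set v : M → ℝ → ℝ := fun p t => cosAngleDiff √κ (flowMean g F ν p t) (flowGauss g F ν p t)
    with hv
  have hcv : ContinuousOn (fun a : M × ℝ => v a.1 a.2) (Set.univ ×ˢ timeInterval T) :=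
    continuousOn_cosAngleDiff (Real.sqrt_pos.2 hκ) (hF.continuousOn_flowCurv hT).1
      (hF.continuousOn_flowCurv hT).2 fun a ha => hF.four_flowGauss_le hT a.1 ha.2
  have hc0 : Continuous fun p => -v p 0 := by
    have : Continuous fun p => v p 0 :=
      hcv.comp_continuous (f := fun p : M => (p, (0 : ℝ))) (by fun_prop)
        fun p => ⟨trivial, zero_mem_timeInterval hT⟩
    exact this.neg
  -- Keeping `C` above `-1` matters: at a touch `v * exp (3 r) = -C < 1`, and the exponential
  -- exceeds 1, so `v < 1` and the point is not umbilic.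
  obtain ⟨C, hC1, hC0, hC⟩ := exists_uniform_lt hc0 (show (-1 : ℝ) < 0 by norm_num)
    fun p => neg_lt_zero.2 (h0 p)
  have hsub : (Set.univ : Set M) ×ˢ Set.Icc 0 t ⊆ Set.univ ×ˢ timeInterval T :=
    Set.prod_mono_right fun r hr => mem_timeInterval_of_le ht hr.1 hr.2
  have hcont : ContinuousOn (fun a : M × ℝ => -(v a.1 a.2 * Real.exp (3 * a.2)))
      (Set.univ ×ˢ Set.Icc 0 t) :=
    ((hcv.mono hsub).mul (by fun_prop)).neg
  have key := lt_of_first_touch (C := C) (u := fun p t => -(v p t * Real.exp (3 * t))) hcont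
    (fun p => by simpa using hC p) (fun r hr hrt p hp hq => by
      have hrT := mem_timeInterval_of_le ht hr.le hrt
      obtain ⟨x, y, O, φ, c, hpx, hO⟩ := hF.exists_isFlowChart hκ hT p hrT hr
      have hE : 1 < Real.exp (3 * r) := Real.one_lt_exp_iff.2 (by linarith)
      have hE0 : 0 < Real.exp (3 * r) := Real.exp_pos _
      have v0 : 0 < v p r := by
        by_contra! hle
        have := mul_nonpos_of_nonpos_of_nonneg hle hE0.le
        linarith
      have v1 : v p r < 1 := by nlinarith
      obtain ⟨d, hd, hle⟩ := c.cosAngle hκ hg hpx hO (fun q => by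
        have := hq q
        rw [← hp, neg_le_neg_iff, mul_le_mul_iff_left₀ hE0] at this
        exact this) v0 v1
      have hexp : HasDerivAt (fun r : ℝ => Real.exp (3 * r)) (Real.exp (3 * r) * 3) r := by
        simpa using ((hasDerivAt_id r).const_mul 3).exp
      refine ⟨_, ?_, (hd.mul hexp).neg⟩
      have hle' : -2 * v p r ≤ d := hle
      have : 0 < (d + 3 * v p r) * Real.exp (3 * r) := mul_pos (by linarith) hE0
      change -(d * Real.exp (3 * r) + v p r * (Real.exp (3 * r) * 3)) < 0
      linarith) p t ⟨ht.1, le_rfl⟩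
  change 0 < v p t
  by_contra! hle
  have := mul_nonpos_of_nonpos_of_nonneg hle (Real.exp_pos (3 * t)).le
  have key' : -(v p t * Real.exp (3 * t)) < C := key
  linarith

end IsLagrangianAngleFlow

end Preservation

end AdSFlow

end

theorem lemma4p5
    {M : Type*} [TopologicalSpace M] [T2Space M] [CompactSpace M]
    [ChartedSpace (EuclideanSpace ℝ (Fin 2)) M] [IsManifold (𝓡 2) ∞ M]
    {N : Type*} [TopologicalSpace N] [T2Space N]
    [ChartedSpace (EuclideanSpace ℝ (Fin 3)) N] [IsManifold (𝓡 3) ∞ N]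
    (κ : ℝ) (hκ : 0 < κ)
    (g : AdSFlow.LorentzMetric 3 N) (τ : AdSFlow.TimeOrientation g)
    (hg : g.HasConstantSectionalCurvature (-κ))
    (T : EReal) (hT : 0 < T)
    (F : M → ℝ → N) (ν : ∀ (p : M) (t : ℝ), TangentSpace (𝓡 3) (F p t))
    (hF : AdSFlow.IsLagrangianAngleFlow (n := 2) κ g τ T F ν)
    (hK : ∀ p : M,
      AdSFlow.gaussCurvature (n := 2) g (fun p' => F p' 0) p (ν p 0) ^ 2 < κ ^ 2) :
    (∃ ε : ℝ, 0 < ε ∧ ∀ t ∈ AdSFlow.timeInterval T, ∀ p : M,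
      ε < κ - AdSFlow.gaussCurvature (n := 2) g (fun p' => F p' t) p (ν p t) ∧
      0 < κ + AdSFlow.gaussCurvature (n := 2) g (fun p' => F p' t) p (ν p t)) ∧
    (∃ C : ℝ, ∀ t ∈ AdSFlow.timeInterval T, ∀ p : M,
      √(AdSFlow.secondFormNormSq (n := 2) g (fun p' => F p' t) p (ν p t)) ≤ C) := by
  have hs := Real.sqrt_pos.2 hκ
  have hs2 : √κ ^ 2 = κ := Real.sq_sqrt hκ.le
  have hzero := AdSFlow.zero_mem_timeInterval hT
  have h₀ : ∀ p, |AdSFlow.flowGauss g F ν p 0| < κ := fun p => by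
    have := hK p
    rw [(hF.invariants_eq hκ hT p hzero).1] at this
    exact abs_lt_of_sq_lt_sq this hκ.le
  have hcθ : Continuous fun p => |AdSFlow.angleSum √κ (AdSFlow.flowMean g F ν p 0)
      (AdSFlow.flowGauss g F ν p 0)| :=
    ((hF.continuousOn_angle hκ hT).comp_continuous (f := fun p : M => (p, (0 : ℝ))) (by fun_prop)
      fun p => ⟨trivial, hzero⟩).abs
  -- Compactness of `M` turns the pointwise bound by `π/2` at time zero into one angle `Θ < π/2`;
  -- the floor 0 makes `Θ` positive.
  obtain ⟨Θ, hΘ0, hΘ1, hΘ⟩ := AdSFlow.exists_uniform_lt hcθ (half_pos Real.pi_pos) fun p =>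
    AdSFlow.abs_angleSum_lt (by rw [hs2]; exact (abs_lt.1 (h₀ p)).2)
  have hcos : 0 < Real.cos Θ := Real.cos_pos_of_mem_Ioo ⟨by linarith, hΘ1⟩
  have hv₀ : ∀ p, 0 < AdSFlow.cosAngleDiff √κ (AdSFlow.flowMean g F ν p 0)
      (AdSFlow.flowGauss g F ν p 0) := fun p =>
    (AdSFlow.cosAngleDiff_pos_iff hs (hF.four_flowGauss_le hT p hzero)).2
      (by rw [hs2]; linarith [(abs_lt.1 (h₀ p)).1])
  have main : ∀ t ∈ AdSFlow.timeInterval T, ∀ p : M,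
      κ * Real.cos Θ ≤ κ - AdSFlow.flowGauss g F ν p t ∧
      √κ * |AdSFlow.flowMean g F ν p t| * Real.cos Θ ≤ κ - AdSFlow.flowGauss g F ν p t ∧
      0 < κ + AdSFlow.flowGauss g F ν p t := fun t ht p => by
    have h4 := hF.four_flowGauss_le hT p ht
    have hb := AdSFlow.bounds_of_abs_angleSum_lt hs h4 (hF.abs_angle_lt hκ hT hg hΘ0 hΘ p ht) hΘ1
    have hp := (AdSFlow.cosAngleDiff_pos_iff hs h4).1 (hF.cosAngle_pos hκ hT hg hv₀ p ht)
    rw [hs2] at hb hp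
    exact ⟨hb.1, hb.2, hp⟩
  -- Halving makes the inequality strict. The other constant combines `|H| ≤ 2κ / (√κ cos Θ)`, which
  -- uses `κ - K < 2κ`, with `-2K < 2κ` in `|h|² = H² - 2K`.
  refine ⟨⟨κ * Real.cos Θ / 2, by positivity, fun t ht p => ?_⟩,
    √((2 * κ / (√κ * Real.cos Θ)) ^ 2 + 2 * κ), fun t ht p => Real.sqrt_le_sqrt ?_⟩
  · rw [(hF.invariants_eq hκ hT p ht).1]
    have hpos : 0 < κ * Real.cos Θ := by positivity
    exact ⟨by linarith [(main t ht p).1], (main t ht p).2.2⟩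
  · rw [(hF.invariants_eq hκ hT p ht).2.1]
    obtain ⟨-, h₂, h₃⟩ := main t ht p
    have hH : |AdSFlow.flowMean g F ν p t| ≤ 2 * κ / (√κ * Real.cos Θ) := by
      rw [le_div_iff₀ (by positivity)]
      linarith
    have := pow_le_pow_left₀ (abs_nonneg _) hH 2
    rw [sq_abs] at this
    linarith
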